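/- **Setting.** Fix a smooth $\varphi_0:\mathbb R\to[0,1]$ with $\varphi_0=1$ on $[-1,1]$ and $\varphi_0(\xi)=0$ for $|\xi|\ge 2$; put $\varphi_j(\xi)=\varphi_0(2^{-j}\xi)-\varphi_0(2^{-j+1}\xi)$ for $j\ge1$ and $S_jf=\mathcal F^{-1}(\varphi_j\hat f)$, $j\ge 0$, where $\hat f=\mathcal F f$ is the Fourier transform in the space variable $x$, $\hat f(\xi)=\int e^{-2\pi i x\xi}f(x)\,dx$. For each integer $l\ge0$ fix a partition $\mathcal Q_l$ of $\mathbb R$ into half-open intervals of length $2^l$, and for each $j\ge0$ a smooth partition of unity $1=\sum_{Q\in\mathcal Q_{2j}}\chi_Q$ with $\chi_Q\ge0$, $\operatorname{supp}\chi_Q\subset B(Q,\tfrac12)$ (the $\tfrac12$-neighbourhood of $Q$) and $\chi_Q\ge c$ on $Q$, with a constant $c>0$ independent of $Q$ and $j$. For a norm $U$ put $\|u\|_{l^1_{2j}U}=\sum_{Q\in\mathcal Q_{2j}}\|\chi_Qu\|_U$. All norms in $t$ are over $t\in[0,1]$. Define $$\|u\|_X=\sup_{l\ge0}\sup_{Q\in\mathcal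 Q_l}2^{-l/2}\|u\|_{L^2_{t,x}([0,1]\times Q)},\qquad \|u\|_{X_j}=2^j\|u\|_X+\|u\|_{L^\infty_tL^2_x}.$$ An atom is a measurable function $A$ for which there are $l\ge 0$ and $Q\in\mathcal Q_l$ such that $A$ vanishes outside $[0,1]\times Q$ and $\|A\|_{L^2_{t,x}}\le2^{-l/2}$; set $$\|f\|_Y=\inf\Big\{\sum_k|c_k|:\ f=\sum_kc_kA_k\ \text{a.e. on }[0,1]\times\mathbb R,\ A_k\text{ atoms}\Big\},\qquad \|f\|_{Y_j}=\inf_{f=f_1+f_2}\big\{2^{-j}\|f_1\|_Y+\|f_2\|_{L^1_tL^2_x}\big\}.$$ For $s\in\mathbb R$ put $$\|a\|_{l^1H^s}^2=\sum_{j\ge0}2^{2sj}\|S_ja\|_{l^1_{2j}L^2}^2,\quad \|u\|_{l^1X^s}^2=\sum_{j\ge0}2^{2sj}\|S_ju\|_{l^1_{2j}X_j}^2,\quad \|f\|_{l^1Y^s}^2=\sum_{j\ge0}2^{2sj}\|S_jf\|_{l^1_{2j}Y_j}^2,$$ and $\|a\|_{C^\gamma_*}=\sup_{j\ge0}2^{\gamma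 j}\|S_ja\|_{L^\infty}$ for $\gamma>0$. Functions $a,b:\mathbb R\to\mathbb C$ are assumed to be tempered, i.e. measurable with $\int|a(x)|(1+|x|)^{-N}dx<\infty$ for some $N$; functions $u,v:\mathbb R\times\mathbb R\to\mathbb C$ of $(t,x)$ are assumed to be measurable on $[0,1]\times\mathbb R$ with $u(t,\cdot)$ tempered for almost every $t\in[0,1]$. Such a function belongs to one of the above spaces if the corresponding norm is finite. **Proposition.** In each of the following, whenever the two factors on the left belong to the spaces whose norms appear on the right, their pointwise product belongs to the space on the left (in particular it is again tempered in the sense above) and the estimate holds, with an implicit constant depending only on the exponents $s,\alpha,\beta,\gamma$ that occur and on the fixed $\varphi_0,\mathcal Q_l,\chi_Q$. a) Algebra estimates: $$\|uv\|_{l^1X^s}\lesssim\|u\|_{l^1X^s}\|v\|_{l^1X^s}\quad(s>1),\qquad \|ab\|_{l^1H^s}\lesssim\|a\|_{l^1H^s}\|b\|_{l^1H^s}\quad(s>\tfrac12).$$ b) Bilinear estimates I: for $s>\tfrac12$, $$\|uv\|_{l^1Y^s}\lesssim\|u\|_{l^1X^\alpha}\|v\|_{l^1X^\beta}\quad(\alpha,\beta\ge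 s-2,\ \alpha+\beta>s+\tfrac12),$$ $$\|au\|_{l^1Y^s}\lesssim\|a\|_{l^1H^\alpha}\|u\|_{l^1X^\beta}\quad(\alpha,\beta\ge s-1,\ \alpha+\beta>s+\tfrac12).$$ c) Bilinear estimates II: $$\|au\|_{l^1X^s}\lesssim\|a\|_{C^\gamma_*}\|u\|_{l^1X^s}\quad(s>\tfrac12,\ \gamma>s+1),$$ $$\|au\|_{l^1Y^s}\lesssim\|a\|_{C^\gamma_*}\|u\|_{l^1Y^s}\quad(s>\tfrac32,\ \gamma>s),$$ $$\|ab\|_{l^1H^s}\lesssim\|a\|_{C^\gamma_*}\|b\|_{l^1H^s}\quad(s>1,\ \gamma>s).$$ -/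

import Mathlib

open MeasureTheory Set
open scoped ENNReal NNReal FourierTransform ContDiff

noncomputable section

namespace BilEst

/-- The interval `[o + m 2^l, o + (m+1) 2^l)`; for fixed `o` and `l` these intervals, `m ∈ ℤ`,
partition `ℝ`. -/
def interval (o : ℝ) (l : ℕ) (m : ℤ) : Set ℝ :=
  Ico (o + (m : ℝ) * 2 ^ l) (o + ((m : ℝ) + 1) * 2 ^ l)

/-- The data on which the spaces depend: the smooth low-frequency cutoff `φ₀`, for every `l ≥ 0` the
partition of `ℝ` into intervals of length `2 ^ l` (determined by one endpoint `offset l`), and for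
every `j ≥ 0` a smooth partition of unity `(χ j m)`, `m ∈ ℤ`, subordinate to the partition into
intervals of length `2 ^ (2 j)`. -/
structure Setup where
  φ₀ : ℝ → ℝ
  φ₀_smooth : ContDiff ℝ ∞ φ₀
  φ₀_mem : ∀ ξ, φ₀ ξ ∈ Icc (0 : ℝ) 1
  φ₀_one : ∀ ξ ∈ Icc (-1 : ℝ) 1, φ₀ ξ = 1
  φ₀_zero : ∀ ξ : ℝ, 2 ≤ |ξ| → φ₀ ξ = 0
  offset : ℕ → ℝ
  χ : ℕ → ℤ → ℝ → ℝ
  χ_smooth : ∀ j m, ContDiff ℝ ∞ (χ j m)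
  χ_nonneg : ∀ j m x, 0 ≤ χ j m x
  χ_sum : ∀ j x, HasSum (fun m => χ j m x) 1
  /-- `χ_Q ∼ 1` on `Q`, uniformly in `Q` and in the scale (the upper bound `χ_Q ≤ 1` follows from
  the two preceding fields). -/
  χ_lower : ∃ c : ℝ, 0 < c ∧ ∀ j m,
    ∀ x ∈ interval (offset (2 * j)) (2 * j) m, c ≤ χ j m x
  χ_supp : ∀ j m, tsupport (χ j m) ⊆ Metric.thickening (1 / 2)
    (interval (offset (2 * j)) (2 * j) m)

/-- A function on `ℝ` that is integrable against a negative power of `1 + |x|`; these are the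
functions which (by integration) define tempered distributions. -/
def TemperedFun (a : ℝ → ℂ) : Prop :=
  ∃ N : ℕ, Integrable (fun x : ℝ => (((1 + |x|) ^ N : ℝ) : ℂ)⁻¹ * a x)

/-- The space-time slab `[0,1] × ℝ`; points are written `(t, x)`. -/
def slab : Set (ℝ × ℝ) := Icc (0 : ℝ) 1 ×ˢ univ

/-- Space-time functions to which the spatial Littlewood-Paley projections apply: measurable on
`[0,1] × ℝ`, with tempered slices at almost every time. -/
def TemperedSlices (u : ℝ × ℝ → ℂ) : Prop :=
  AEStronglyMeasurable u (volume.restrict slab) ∧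
    ∀ᵐ t ∂(volume.restrict (Icc (0 : ℝ) 1)), TemperedFun (fun x => u (t, x))

/-- The mixed norm `L^∞_t L^2_x` over `t ∈ [0,1]`. -/
def normLinfL2 (u : ℝ × ℝ → ℂ) : ℝ≥0∞ :=
  essSup (fun t => eLpNorm (fun x => u (t, x)) 2 volume) (volume.restrict (Icc (0 : ℝ) 1))

/-- The mixed norm `L^1_t L^2_x` over `t ∈ [0,1]`. -/
def normL1L2 (u : ℝ × ℝ → ℂ) : ℝ≥0∞ :=
  ∫⁻ t in Icc (0 : ℝ) 1, eLpNorm (fun x => u (t, x)) 2 volume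

namespace Setup

variable (𝓓 : Setup)

/-- The Littlewood-Paley multipliers `φ_j`. -/
def φ : ℕ → ℝ → ℝ
  | 0, ξ => 𝓓.φ₀ ξ
  | j + 1, ξ => 𝓓.φ₀ (ξ / 2 ^ (j + 1)) - 𝓓.φ₀ (ξ / 2 ^ j)

/-- The convolution kernel of `S_j`, i.e. the inverse Fourier transform of `φ_j`. -/
def kernel (j : ℕ) : ℝ → ℂ := 𝓕⁻ (fun ξ : ℝ => (𝓓.φ j ξ : ℂ))

/-- The projection `S_j a`, the inverse Fourier transform of `φ_j â`, written as the convolution of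
`a` with the inverse Fourier transform of `φ_j`. -/
def S (j : ℕ) (a : ℝ → ℂ) (x : ℝ) : ℂ := ∫ y, 𝓓.kernel j (x - y) * a y

/-- The projection `S_j` acting on space-time functions in the space variable. -/
def St (j : ℕ) (u : ℝ × ℝ → ℂ) (p : ℝ × ℝ) : ℂ := 𝓓.S j (fun y => u (p.1, y)) p.2

/-- The `m`-th interval of the partition into intervals of length `2 ^ l`. -/
def Q (l : ℕ) (m : ℤ) : Set ℝ := interval (𝓓.offset l) l m

/-- The norm `l^1_{2j} L^2` for functions of `x`. -/
def l1L2 (j : ℕ) (a : ℝ → ℂ) : ℝ≥0∞ :=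
  ∑' m : ℤ, eLpNorm (fun x => (𝓓.χ j m x : ℂ) * a x) 2 volume

/-- The norm `l^1_{2j} U` for space-time functions, `U` being given by its norm. -/
def l1 (j : ℕ) (U : (ℝ × ℝ → ℂ) → ℝ≥0∞) (u : ℝ × ℝ → ℂ) : ℝ≥0∞ :=
  ∑' m : ℤ, U (fun p => (𝓓.χ j m p.2 : ℂ) * u p)

/-- The local energy norm `X`. -/
def normX (u : ℝ × ℝ → ℂ) : ℝ≥0∞ :=
  ⨆ (l : ℕ) (m : ℤ), (2 : ℝ≥0∞) ^ (-(l : ℝ) / 2) *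
    eLpNorm u 2 (volume.restrict (Icc (0 : ℝ) 1 ×ˢ 𝓓.Q l m))

/-- The norm `X_j`. -/
def normXj (j : ℕ) (u : ℝ × ℝ → ℂ) : ℝ≥0∞ :=
  (2 : ℝ≥0∞) ^ j * 𝓓.normX u + normLinfL2 u

/-- The atoms of `Y`. -/
def IsAtom (A : ℝ × ℝ → ℂ) : Prop :=
  ∃ (l : ℕ) (m : ℤ), AEStronglyMeasurable A volume ∧
    Function.support A ⊆ Icc (0 : ℝ) 1 ×ˢ 𝓓.Q l m ∧
    eLpNorm A 2 volume ≤ (2 : ℝ≥0∞) ^ (-(l : ℝ) / 2)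

/-- The atomic norm `Y` (infinite if there is no atomic decomposition with summable
coefficients). -/
def normY (f : ℝ × ℝ → ℂ) : ℝ≥0∞ :=
  ⨅ (c : ℕ → ℂ) (A : ℕ → ℝ × ℝ → ℂ) (_ : ∀ k, 𝓓.IsAtom (A k))
    (_ : ∀ᵐ p ∂(volume.restrict slab), HasSum (fun k => c k * A k p) (f p)), ∑' k, ‖c k‖ₑ

/-- The norm of `Y_j = 2^j Y + L^1_t L^2_x`. -/
def normYj (j : ℕ) (f : ℝ × ℝ → ℂ) : ℝ≥0∞ :=
  ⨅ (f₁ : ℝ × ℝ → ℂ) (f₂ : ℝ × ℝ → ℂ)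
    (_ : AEStronglyMeasurable f₁ (volume.restrict slab) ∧
      AEStronglyMeasurable f₂ (volume.restrict slab) ∧
      ∀ᵐ p ∂(volume.restrict slab), f p = f₁ p + f₂ p),
    ((2 : ℝ≥0∞) ^ j)⁻¹ * 𝓓.normY f₁ + normL1L2 f₂

/-- The norm `l^1 H^s`. -/
def normL1H (s : ℝ) (a : ℝ → ℂ) : ℝ≥0∞ :=
  (∑' j : ℕ, (2 : ℝ≥0∞) ^ (2 * s * j) * 𝓓.l1L2 j (𝓓.S j a) ^ 2) ^ (1 / 2 : ℝ)

/-- The norm `l^1 X^s`. -/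
def normL1X (s : ℝ) (u : ℝ × ℝ → ℂ) : ℝ≥0∞ :=
  (∑' j : ℕ, (2 : ℝ≥0∞) ^ (2 * s * j) * 𝓓.l1 j (𝓓.normXj j) (𝓓.St j u) ^ 2) ^ (1 / 2 : ℝ)

/-- The norm `l^1 Y^s`. -/
def normL1Y (s : ℝ) (f : ℝ × ℝ → ℂ) : ℝ≥0∞ :=
  (∑' j : ℕ, (2 : ℝ≥0∞) ^ (2 * s * j) * 𝓓.l1 j (𝓓.normYj j) (𝓓.St j f) ^ 2) ^ (1 / 2 : ℝ)

/-- The Zygmund norm `C^γ_*`. -/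
def normZyg (γ : ℝ) (a : ℝ → ℂ) : ℝ≥0∞ :=
  ⨆ j : ℕ, (2 : ℝ≥0∞) ^ (γ * j) * eLpNorm (𝓓.S j a) ⊤ volume

/-- `a ∈ l^1 H^s`. -/
def MemL1H (s : ℝ) (a : ℝ → ℂ) : Prop := TemperedFun a ∧ 𝓓.normL1H s a < ⊤

/-- `u ∈ l^1 X^s`. -/
def MemL1X (s : ℝ) (u : ℝ × ℝ → ℂ) : Prop := TemperedSlices u ∧ 𝓓.normL1X s u < ⊤

/-- `f ∈ l^1 Y^s`. -/
def MemL1Y (s : ℝ) (f : ℝ × ℝ → ℂ) : Prop := TemperedSlices f ∧ 𝓓.normL1Y s f < ⊤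

/-- `a ∈ C^γ_*`. -/
def MemZyg (γ : ℝ) (a : ℝ → ℂ) : Prop := TemperedFun a ∧ 𝓓.normZyg γ a < ⊤

end Setup

end BilEst

end

/-! ### Fourier analysis of the Littlewood-Paley kernels. -/

noncomputable section

namespace BilEst

open Filter Topology SchwartzMap

/-! The proof is a paraproduct argument. Decompose `u = Σ_j S_j u` and `v = Σ_k S_k v`. Fourier
supports force `S_i (S_j u · S_k v) = 0` unless two of the frequencies `2^i, 2^j, 2^k` are
comparable and the third is not much larger (`Interact`, `S_mul_eq_zero`). Suppose that each
surviving piece, with output weight `2^(si)`, is bounded by `2^(-ε min(j,k)) a_j b_k`, where the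
`ℓ²` norms of `a` and `b` are controlled by the norms of the two factors. Then the sum over all
pieces converges (`l2_bilinear_le`). With `besov_mul_le` each of the seven estimates becomes an
inequality between exponents, to be checked in three frequency regimes.

The bounds for the pieces rest on a uniform description of the kernels: by rapid decay and scaling,
the kernel of `S_j` is dominated by a summable combination of indicators of blocks of length
`2^(-j)`, with coefficients independent of `j` (`exists_block_bound`). Convolution thus becomes a
sum of averages over translated blocks, and an `l^1` sum over a partition does not see translations,
up to a factor 3 (`tsum_le_of_shift`). Hence `S_i` acts boundedly on the sharply cut off versions of
`X`, `L^∞L^2` and `L^1L^2`, and sharp and smooth cutoffs are comparable. Bernstein's inequality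
costs `2^(k/2)` from `L^2` to `L^∞` and `2^(i/2)` from `L^1` to `L^2`. Passing to a finer partition
costs the number of subintervals (`tsum_Q_le`), or only its square root in `L^1L^2`
(`tsum_mix_one_two_le`).

For products in `Y_i` with a high frequency `2^j` and a low frequency `2^k`, the product is cut into
atoms on intervals of length `2^(2k)`. The atoms cost `2^k`, the weight of `Y_i` gains `2^(-i)`, the
low factor costs `2^(k/2)`, and the `L^2` norm of the high factor on such an interval is at most
`2^(k-j)` times its `X_j` norm. This local smoothing is the source of the condition `α ≥ s - 2`. A
time-independent high factor has no such gain, hence `α ≥ s - 1`. High-high products are placed in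
`L^1L^2`.

Since the functions are merely tempered, the product must also be identified with its double series.
In every estimate the hypotheses make `Σ_j ‖S_j v‖_∞` finite for one of the factors. Almost every
slice of that factor then agrees with a bounded continuous function, so the product is tempered, and
the weak convergence of the low frequency truncations of the other factor gives the identity
(`tendsto_sum_S_mul`). Functions of `x` alone are treated as space-time functions that are constant
in time. -/

/-- The character `s ↦ exp (2 π i s)`. -/
def char (s : ℝ) : ℂ := Complex.exp ((2 * Real.pi * s : ℝ) * Complex.I)

theorem norm_char (s : ℝ) : ‖char s‖ = 1 := Complex.norm_exp_ofReal_mul_I _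

theorem char_add (s t : ℝ) : char (s + t) = char s * char t := by
  simp only [char, ← Complex.exp_add]
  congr 1
  push_cast
  ring

theorem continuous_char : Continuous char := by
  unfold char
  fun_prop

theorem fourierInv_eq_integral_char (ψ : 𝓢(ℝ, ℂ)) (x : ℝ) :
    (𝓕⁻ ψ) x = ∫ ξ, char (x * ξ) * ψ ξ := by
  rw [fourierInv_coe, Real.fourierInv_eq']
  simp only [char, smul_eq_mul, RCLike.inner_apply, conj_trivial]

/-- Characters are eigenfunctions of convolution: the substitution `z = x - y` leaves `char (x * ξ)`
times the Fourier integral of `𝓕⁻ ψ`, which Fourier inversion evaluates. Kernel identities can thus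
be checked on symbols. -/
theorem integral_fourierInv_mul_char (ψ : 𝓢(ℝ, ℂ)) (x ξ : ℝ) :
    ∫ y, (𝓕⁻ ψ) (x - y) * char (y * ξ) = char (x * ξ) * ψ ξ := by
  have h1 : ψ ξ = ∫ z, char (-(z * ξ)) * (𝓕⁻ ψ) z := by
    have h0 : 𝓕 (𝓕⁻ ψ : 𝓢(ℝ, ℂ)) = ψ := FourierTransform.fourier_fourierInv_eq ψ
    conv_lhs => rw [← h0]
    rw [fourier_coe, Real.fourier_real_eq_integral_exp_smul]
    simp only [smul_eq_mul]
    congr 1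
    ext z
    congr 1
    simp only [char]
    congr 2
    push_cast
    ring
  rw [h1, ← integral_const_mul, ← integral_sub_left_eq_self
    (fun z => char (x * ξ) * (char (-(z * ξ)) * (𝓕⁻ ψ : 𝓢(ℝ, ℂ)) z)) _ x]
  congr 1
  ext y
  have : char (y * ξ) = char (x * ξ) * char (-((x - y) * ξ)) := by
    rw [← char_add]
    congr 1
    ring
  rw [this]
  ring

/-- Convolution of `𝓕⁻ ψ` with a superposition of characters. -/
theorem integral_fourierInv_mul_integral_char {α : Type*} [MeasurableSpace α] {ν : Measure α}
    [SFinite ν] (ψ : 𝓢(ℝ, ℂ)) {ζ : α → ℝ} (hζ : Measurable ζ) {g : α → ℂ} (hg : Integrable g ν)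
    (x : ℝ) :
    ∫ y, (𝓕⁻ ψ) (x - y) * ∫ s, char (y * ζ s) * g s ∂ν =
      ∫ s, char (x * ζ s) * ψ (ζ s) * g s ∂ν := by
  have hint : Integrable (fun p : ℝ × α => (𝓕⁻ ψ) (x - p.1) * (char (p.1 * ζ p.2) * g p.2))
      (volume.prod ν) := by
    have h1 : Integrable (fun y => (𝓕⁻ ψ) (x - y)) :=
      ((𝓕⁻ ψ : 𝓢(ℝ, ℂ)).integrable (μ := volume)).comp_sub_left x
    have h2 := h1.mul_prod hg
    have h3 : Measurable fun p : ℝ × α => char (p.1 * ζ p.2) :=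
      continuous_char.measurable.comp (measurable_fst.mul (hζ.comp measurable_snd))
    have h4 := h2.bdd_mul (c := 1) h3.aestronglyMeasurable
      (Eventually.of_forall fun p => (norm_char _).le)
    refine h4.congr (Eventually.of_forall fun p => ?_)
    simp only
    ring
  simp_rw [← integral_const_mul]
  rw [integral_integral_swap hint]
  congr 1
  ext s
  calc ∫ y, (𝓕⁻ ψ) (x - y) * (char (y * ζ s) * g s)
      = ∫ y, ((𝓕⁻ ψ) (x - y) * char (y * ζ s)) * g s := by simp_rw [mul_assoc]
    _ = _ := by rw [integral_mul_const, integral_fourierInv_mul_char]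

theorem integrable_char_mul (ψ : 𝓢(ℝ, ℂ)) (z : ℝ) :
    Integrable (fun ξ => char (-(z * ξ)) * ψ ξ) := by
  refine (ψ.integrable (μ := volume)).bdd_mul (c := 1) ?_
    (Eventually.of_forall fun p => (norm_char _).le)
  exact (continuous_char.comp (by fun_prop)).aestronglyMeasurable

theorem fourierInv_sub (ψ : 𝓢(ℝ, ℂ)) (y z : ℝ) :
    (𝓕⁻ ψ) (y - z) = ∫ ξ, char (y * ξ) * (char (-(z * ξ)) * ψ ξ) := by
  rw [fourierInv_eq_integral_char]
  congr 1
  ext ξ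
  rw [← mul_assoc, ← char_add]
  congr 2
  ring

/-- If `ψ₁ = 1` on the support of `ψ₂` then convolution with `𝓕⁻ ψ₁` reproduces `𝓕⁻ ψ₂`. -/
theorem integral_fourierInv_mul_fourierInv {ψ₁ ψ₂ : 𝓢(ℝ, ℂ)} (h : ∀ ξ, ψ₁ ξ * ψ₂ ξ = ψ₂ ξ)
    (x z : ℝ) : ∫ y, (𝓕⁻ ψ₁) (x - y) * (𝓕⁻ ψ₂) (y - z) = (𝓕⁻ ψ₂) (x - z) := by
  simp_rw [fourierInv_sub ψ₂]
  rw [integral_fourierInv_mul_integral_char ψ₁ (ζ := fun ξ => ξ) measurable_id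
    (integrable_char_mul ψ₂ z)]
  congr 1
  ext ξ
  linear_combination (char (x * ξ) * char (-(z * ξ))) * h ξ

/-- The product of two functions with frequencies in the supports of `ψ₂` and `ψ₃` has no
frequencies in the support of `ψ₁` if the latter does not meet the sum of the former. -/
theorem integral_fourierInv_mul_fourierInv_mul_fourierInv {ψ₁ ψ₂ ψ₃ : 𝓢(ℝ, ℂ)}
    (h : ∀ ξ η, ψ₁ (ξ + η) * (ψ₂ ξ * ψ₃ η) = 0) (x z w : ℝ) :
    ∫ y, (𝓕⁻ ψ₁) (x - y) * ((𝓕⁻ ψ₂) (y - z) * (𝓕⁻ ψ₃) (y - w)) = 0 := by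
  have h1 : ∀ y, (𝓕⁻ ψ₂) (y - z) * (𝓕⁻ ψ₃) (y - w) =
      ∫ p : ℝ × ℝ, char (y * (p.1 + p.2)) *
        ((char (-(z * p.1)) * ψ₂ p.1) * (char (-(w * p.2)) * ψ₃ p.2)) := by
    intro y
    rw [fourierInv_sub, fourierInv_sub, ← integral_prod_mul, Measure.volume_eq_prod]
    congr 1
    ext p
    rw [mul_add, char_add]
    ring
  simp_rw [h1, Measure.volume_eq_prod]
  rw [integral_fourierInv_mul_integral_char ψ₁ (ζ := fun p : ℝ × ℝ => p.1 + p.2)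
    (measurable_fst.add measurable_snd)
    ((integrable_char_mul ψ₂ z).mul_prod (integrable_char_mul ψ₃ w))]
  refine integral_eq_zero_of_ae (Eventually.of_forall fun p => ?_)
  simp only [Pi.zero_apply]
  linear_combination (char (x * (p.1 + p.2)) * char (-(z * p.1)) * char (-(w * p.2))) * h p.1 p.2

theorem schwartz_decay (f : 𝓢(ℝ, ℂ)) (N : ℕ) :
    ∃ C : ℝ, 0 < C ∧ ∀ x, ‖f x‖ * (1 + |x|) ^ N ≤ C := by
  refine ⟨2 ^ N * ((Finset.Iic (N, 0)).sup fun m => SchwartzMap.seminorm ℂ m.1 m.2) f + 1, ?_, ?_⟩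
  · have : 0 ≤ ((Finset.Iic (N, 0)).sup fun m => SchwartzMap.seminorm ℂ m.1 m.2) f :=
      apply_nonneg _ _
    positivity
  · intro x
    have := one_add_le_sup_seminorm_apply (𝕜 := ℂ) (m := (N, 0)) (k := N) (n := 0) le_rfl le_rfl f x
    simp only [norm_iteratedFDeriv_zero, Real.norm_eq_abs] at this
    linarith [mul_comm ‖f x‖ ((1 + |x|) ^ N)]

/-! ### Size and frequency support of the kernels. -/

namespace Setup

variable (𝓓 : Setup)

/-- The symbol of the projection to frequencies below `2 ^ J`. -/
def lowSymbol (J : ℕ) : 𝓢(ℝ, ℂ) :=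
  HasCompactSupport.toSchwartzMap (f := fun ξ : ℝ => ((𝓓.φ₀ (ξ / 2 ^ J) : ℝ) : ℂ))
    (HasCompactSupport.intro (isCompact_Icc (a := -(2 * 2 ^ J : ℝ)) (b := 2 * 2 ^ J)) fun ξ hξ => by
      rw [𝓓.φ₀_zero, Complex.ofReal_zero]
      rw [abs_div, abs_of_pos (by positivity : (0 : ℝ) < 2 ^ J), le_div_iff₀ (by positivity)]
      by_contra! hlt
      exact hξ (abs_le.1 hlt.le))
    (Complex.ofRealCLM.contDiff.comp (𝓓.φ₀_smooth.comp (contDiff_id.div_const _)))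

theorem lowSymbol_apply (J : ℕ) (ξ : ℝ) : 𝓓.lowSymbol J ξ = (𝓓.φ₀ (ξ / 2 ^ J) : ℝ) := rfl

/-- The symbol `φ_j` as a Schwartz function. -/
def symbol : ℕ → 𝓢(ℝ, ℂ)
  | 0 => 𝓓.lowSymbol 0
  | j + 1 => 𝓓.lowSymbol (j + 1) - 𝓓.lowSymbol j

theorem symbol_apply (j : ℕ) (ξ : ℝ) : 𝓓.symbol j ξ = (𝓓.φ j ξ : ℂ) := by
  cases j with
  | zero => simp [symbol, lowSymbol_apply, φ]
  | succ j => simp [symbol, lowSymbol_apply, φ]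

/-- The kernel of the projection to frequencies below `2 ^ J`. -/
def low (J : ℕ) : 𝓢(ℝ, ℂ) := 𝓕⁻ (𝓓.lowSymbol J)

/-- The kernel of `S_j` as a Schwartz function. -/
def ker (j : ℕ) : 𝓢(ℝ, ℂ) := 𝓕⁻ (𝓓.symbol j)

theorem kernel_eq (j : ℕ) : 𝓓.kernel j = 𝓓.ker j := by
  rw [kernel, ker, fourierInv_coe]
  congr 1
  ext ξ
  rw [symbol_apply]

theorem ker_zero : 𝓓.ker 0 = 𝓓.low 0 := rfl

theorem ker_succ (j : ℕ) : 𝓓.ker (j + 1) = 𝓓.low (j + 1) - 𝓓.low j := by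
  exact map_sub (FourierTransform.fourierInvCLM ℂ 𝓢(ℝ, ℂ)) (𝓓.lowSymbol (j + 1)) (𝓓.lowSymbol j)

theorem sum_ker (J : ℕ) (x : ℝ) : ∑ j ∈ Finset.range (J + 1), 𝓓.ker j x = 𝓓.low J x := by
  induction J with
  | zero => simp [ker_zero]
  | succ J ih => rw [Finset.sum_range_succ, ih, ker_succ]; simp

/-- The low-pass symbols are dilates of one another, so decay of the single function `low 0`
controls the kernels at all scales. -/
theorem low_apply (J : ℕ) (x : ℝ) : 𝓓.low J x = 2 ^ J * 𝓓.low 0 (2 ^ J * x) := by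
  have h2 : (0 : ℝ) < 2 ^ J := by positivity
  rw [low, low, fourierInv_eq_integral_char, fourierInv_eq_integral_char]
  have := Measure.integral_comp_div
    (fun ξ => char (2 ^ J * x * ξ) * 𝓓.lowSymbol 0 ξ) (2 ^ J : ℝ)
  rw [abs_of_pos h2] at this
  rw [show ((2 : ℂ) ^ J) = ((2 ^ J : ℝ) : ℂ) by push_cast; rfl, ← Complex.real_smul, ← this]
  congr 1
  ext ξ
  simp only [lowSymbol_apply, pow_zero, div_one]
  congr 2
  field_simp

/-- The mass of a kernel is the value of its symbol at frequency zero, here `φ₀ 0 = 1`. This makes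
`low J` an approximate identity. -/
theorem integral_low_zero : ∫ x, 𝓓.low 0 x = 1 := by
  have := integral_fourierInv_mul_char (𝓓.lowSymbol 0) 0 0
  simp only [mul_zero, lowSymbol_apply, zero_div] at this
  rw [𝓓.φ₀_one 0 (by simp)] at this
  have hc : char 0 = 1 := by simp [char]
  rw [hc] at this
  simp only [mul_one, zero_sub, Complex.ofReal_one] at this
  rw [← this, low]
  exact (integral_neg_eq_self (fun x => (𝓕⁻ (𝓓.lowSymbol 0)) x) volume).symm

theorem summable_one_div_one_add_abs_sq :
    Summable fun r : ℤ => 1 / (1 + |(r : ℝ)|) ^ 2 := by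
  have h : Summable fun n : ℕ => 1 / (1 + (n : ℝ)) ^ 2 := by
    have := (summable_nat_add_iff 1).2 (Real.summable_one_div_nat_pow.2 one_lt_two)
    refine this.congr fun n => ?_
    push_cast
    ring
  refine Summable.of_nat_of_neg ?_ ?_
  · simpa using h
  · simpa using h

/-- The blocks `[r 2^(-j), (r+1) 2^(-j))` into which the kernels at scale `2^(-j)` are cut. -/
def block (j : ℕ) (r : ℤ) : Set ℝ := Ico ((r : ℝ) / 2 ^ j) (((r : ℝ) + 1) / 2 ^ j)

/-- Quadratic decay of `low 0`, rescaled by `low_apply`, gives the size `2 ^ j (1 + |r|)^(-2)` where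
`2 ^ j * x` is close to `r`. The coefficients do not depend on `j`, which makes all later constants
uniform in the frequency. -/
theorem exists_block_bound : ∃ c : ℤ → ℝ≥0∞, ∑' r, c r ≠ ⊤ ∧
    (∀ j r, ∀ x ∈ block j r, ‖𝓓.low j x‖ₑ ≤ c r * 2 ^ j) ∧
    ∀ j r, ∀ x ∈ block j r, ‖𝓓.ker j x‖ₑ ≤ c r * 2 ^ j := by
  obtain ⟨C, hC, hdec⟩ := schwartz_decay (𝓓.low 0) 2
  have key : ∀ (j : ℕ) (r : ℤ) (x : ℝ), (1 + |(r : ℝ)|) ≤ 2 * (1 + |2 ^ j * x|) →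
      ‖𝓓.low j x‖ ≤ 4 * C * (1 / (1 + |(r : ℝ)|) ^ 2) * 2 ^ j := by
    intro j r x hr
    have h1 : ‖𝓓.low j x‖ = 2 ^ j * ‖𝓓.low 0 (2 ^ j * x)‖ := by
      rw [low_apply, norm_mul]
      simp
    have h2 := hdec (2 ^ j * x)
    have h3 : (1 + |(r : ℝ)|) ^ 2 ≤ 4 * (1 + |2 ^ j * x|) ^ 2 := by
      calc (1 + |(r : ℝ)|) ^ 2 ≤ (2 * (1 + |2 ^ j * x|)) ^ 2 := by gcongr
        _ = _ := by ring
    have h4 : ‖𝓓.low 0 (2 ^ j * x)‖ ≤ 4 * C * (1 / (1 + |(r : ℝ)|) ^ 2) := by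
      rw [mul_one_div, le_div_iff₀ (by positivity)]
      calc ‖𝓓.low 0 (2 ^ j * x)‖ * (1 + |(r : ℝ)|) ^ 2
          ≤ ‖𝓓.low 0 (2 ^ j * x)‖ * (4 * (1 + |2 ^ j * x|) ^ 2) := by gcongr
        _ = 4 * (‖𝓓.low 0 (2 ^ j * x)‖ * (1 + |2 ^ j * x|) ^ 2) := by ring
        _ ≤ 4 * C := by linarith
    rw [h1, mul_comm]
    gcongr
  have hmem : ∀ (j : ℕ) (r : ℤ) (x : ℝ), x ∈ block j r → (r : ℝ) ≤ 2 ^ j * x ∧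
      2 ^ j * x < r + 1 := by
    intro j r x hx
    obtain ⟨h1, h2⟩ := hx
    have h0 : (0 : ℝ) < 2 ^ j := by positivity
    rw [div_le_iff₀ h0] at h1
    rw [lt_div_iff₀ h0] at h2
    constructor <;> linarith
  have hcast : ∀ (j : ℕ) (r : ℤ) (f : ℝ → ℂ) (x : ℝ),
      ‖f x‖ ≤ 8 * C * (1 / (1 + |(r : ℝ)|) ^ 2) * 2 ^ j →
      ‖f x‖ₑ ≤ ENNReal.ofReal (8 * C * (1 / (1 + |(r : ℝ)|) ^ 2)) * 2 ^ j := by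
    intro j r f x h
    rw [← ofReal_norm]
    have : (2 : ℝ≥0∞) ^ j = ENNReal.ofReal (2 ^ j) := by
      rw [ENNReal.ofReal_pow (by norm_num)]
      simp
    rw [this, ← ENNReal.ofReal_mul (by positivity)]
    exact ENNReal.ofReal_le_ofReal h
  have habs : ∀ (r : ℤ) (y : ℝ), (r : ℝ) ≤ y → y < r + 1 → 1 + |(r : ℝ)| ≤ 2 * (1 + |y|) := by
    intro r y h1 h2
    have : |(r : ℝ)| ≤ |y| + 1 := by
      rw [abs_le]
      constructor
      · linarith [neg_abs_le y]
      · linarith [le_abs_self y, abs_nonneg y]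
    linarith [abs_nonneg y]
  -- The constant is `8 * C` because `ker (j + 1)` is a difference of two low-pass kernels, each
  -- bounded with `4 * C`.
  refine ⟨fun r => ENNReal.ofReal (8 * C * (1 / (1 + |(r : ℝ)|) ^ 2)), ?_, ?_, ?_⟩
  · exact ((summable_one_div_one_add_abs_sq.mul_left (8 * C))).tsum_ofReal_ne_top
  · intro j r x hx
    obtain ⟨h1, h2⟩ := hmem j r x hx
    refine hcast j r _ x ((key j r x (habs r _ h1 h2)).trans ?_)
    gcongr
    norm_num
  · intro j r x hx
    obtain ⟨h1, h2⟩ := hmem j r x hx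
    refine hcast j r _ x ?_
    cases j with
    | zero =>
      rw [ker_zero]
      refine ((key 0 r x (habs r _ h1 h2)).trans ?_)
      gcongr
      norm_num
    | succ j =>
      rw [ker_succ, sub_apply]
      refine (norm_sub_le _ _).trans ?_
      have hA := key (j + 1) r x (habs r _ h1 h2)
      -- The block has scale `j + 1` while `low j` lives at scale `j`, where the point sits near `r
      -- / 2`; the factor 2 in the hypothesis of `key` leaves room for this.
      have hB := key j r x (by
        have := habs r _ h1 h2
        have e : |(2 : ℝ) ^ (j + 1) * x| = 2 * |2 ^ j * x| := by
          rw [pow_succ, mul_comm ((2 : ℝ) ^ j) 2, mul_assoc, abs_mul, abs_two]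
        have h3 : |(r : ℝ)| ≤ |(2 : ℝ) ^ (j + 1) * x| + 1 := by
          rw [abs_le]
          constructor
          · linarith [neg_abs_le ((2 : ℝ) ^ (j + 1) * x)]
          · linarith [le_abs_self ((2 : ℝ) ^ (j + 1) * x), abs_nonneg ((2 : ℝ) ^ (j + 1) * x)]
        rw [e] at h3
        linarith)
      have : 4 * C * (1 / (1 + |(r : ℝ)|) ^ 2) * 2 ^ j ≤
          4 * C * (1 / (1 + |(r : ℝ)|) ^ 2) * 2 ^ (j + 1) := by
        gcongr
        · norm_num
        · omega
      linarith

/-! ### Supports of the symbols -/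

theorem φ₀_eq_zero_of_le {ξ : ℝ} {J : ℕ} (h : 2 ^ (J + 1) ≤ |ξ|) : 𝓓.φ₀ (ξ / 2 ^ J) = 0 := by
  refine 𝓓.φ₀_zero _ ?_
  rw [abs_div, abs_of_pos (by positivity : (0 : ℝ) < 2 ^ J), le_div_iff₀ (by positivity)]
  linarith [pow_succ (2 : ℝ) J]

theorem φ₀_eq_one_of_le {ξ : ℝ} {J : ℕ} (h : |ξ| ≤ 2 ^ J) : 𝓓.φ₀ (ξ / 2 ^ J) = 1 := by
  refine 𝓓.φ₀_one _ ?_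
  rw [mem_Icc, ← abs_le, abs_div, abs_of_pos (by positivity : (0 : ℝ) < 2 ^ J),
    div_le_one (by positivity)]
  exact h

theorem φ_eq_zero_of_le {ξ : ℝ} {j : ℕ} (h : 2 ^ (j + 1) ≤ |ξ|) : 𝓓.φ j ξ = 0 := by
  cases j with
  | zero => simpa [φ] using 𝓓.φ₀_eq_zero_of_le h
  | succ j =>
    rw [φ, 𝓓.φ₀_eq_zero_of_le h, 𝓓.φ₀_eq_zero_of_le, sub_zero]
    exact (pow_le_pow_right₀ one_le_two (by omega)).trans h

theorem φ_succ_eq_zero_of_le {ξ : ℝ} {j : ℕ} (h : |ξ| ≤ 2 ^ j) : 𝓓.φ (j + 1) ξ = 0 := by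
  rw [φ, 𝓓.φ₀_eq_one_of_le h, 𝓓.φ₀_eq_one_of_le, sub_self]
  exact h.trans (pow_le_pow_right₀ one_le_two (by omega))

theorem lowSymbol_succ_mul_symbol (j : ℕ) (ξ : ℝ) :
    𝓓.lowSymbol (j + 1) ξ * 𝓓.symbol j ξ = 𝓓.symbol j ξ := by
  rw [symbol_apply, lowSymbol_apply]
  rcases le_total |ξ| (2 ^ (j + 1)) with h | h
  · rw [𝓓.φ₀_eq_one_of_le h]
    simp
  · rw [𝓓.φ_eq_zero_of_le h]
    simp

/-- Products of frequencies `2^j` and `2^k` contain no frequency `2^i` with `i > max j k + 2`, and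
similarly for permuted indices. -/
def Interact (i j k : ℕ) : Prop := i ≤ max j k + 2 ∧ j ≤ max i k + 2 ∧ k ≤ max i j + 2

/-- The last two factors confine `|ξ|` and `|η|` below `2^(i-2)`, so the sum stays below `2^(i-1)`,
where `φ i` vanishes. The margin 2 in `Interact` comes from this count. -/
theorem φ_triple_eq_zero_of_lt {i j k : ℕ} (h : max j k + 2 < i) {ξ η : ℝ} :
    𝓓.φ i (ξ + η) * 𝓓.φ j ξ * 𝓓.φ k η = 0 := by
  by_cases h1 : 2 ^ (j + 1) ≤ |ξ|
  · simp [𝓓.φ_eq_zero_of_le h1]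
  by_cases h2 : 2 ^ (k + 1) ≤ |η|
  · simp [𝓓.φ_eq_zero_of_le h2]
  push Not at h1 h2
  obtain ⟨i, rfl⟩ : ∃ i', i = i' + 1 := ⟨i - 1, by omega⟩
  rw [𝓓.φ_succ_eq_zero_of_le, zero_mul, zero_mul]
  have h3 : (2 : ℝ) ^ (j + 1) ≤ 2 ^ (i - 1) := pow_le_pow_right₀ one_le_two (by omega)
  have h4 : (2 : ℝ) ^ (k + 1) ≤ 2 ^ (i - 1) := pow_le_pow_right₀ one_le_two (by omega)
  have h5 : (2 : ℝ) ^ i = 2 * 2 ^ (i - 1) := by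
    rw [← pow_succ']
    congr 1
    omega
  linarith [abs_add_le ξ η]

/-- The same count, applied to `ξ = (ξ + η) - η`. -/
theorem φ_neg_triple {i j k : ℕ} (h : max i k + 2 < j) {ξ η : ℝ} :
    𝓓.φ i (ξ + η) * 𝓓.φ j ξ * 𝓓.φ k η = 0 := by
  by_cases h1 : 2 ^ (i + 1) ≤ |ξ + η|
  · simp [𝓓.φ_eq_zero_of_le h1]
  by_cases h2 : 2 ^ (k + 1) ≤ |η|
  · simp [𝓓.φ_eq_zero_of_le h2]
  push Not at h1 h2
  obtain ⟨j, rfl⟩ : ∃ i', j = i' + 1 := ⟨j - 1, by omega⟩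
  rw [𝓓.φ_succ_eq_zero_of_le (j := j) (ξ := ξ), mul_zero, zero_mul]
  have h3 : (2 : ℝ) ^ (i + 1) ≤ 2 ^ (j - 1) := pow_le_pow_right₀ one_le_two (by omega)
  have h4 : (2 : ℝ) ^ (k + 1) ≤ 2 ^ (j - 1) := pow_le_pow_right₀ one_le_two (by omega)
  have h5 : (2 : ℝ) ^ j = 2 * 2 ^ (j - 1) := by
    rw [← pow_succ']
    congr 1
    omega
  have h6 := abs_sub (ξ + η) η
  rw [add_sub_cancel_right] at h6
  linarith

theorem symbol_triple_eq_zero {i j k : ℕ} (h : ¬ Interact i j k) (ξ η : ℝ) :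
    𝓓.symbol i (ξ + η) * (𝓓.symbol j ξ * 𝓓.symbol k η) = 0 := by
  simp only [symbol_apply]
  norm_cast
  rw [← mul_assoc]
  by_cases h1 : max j k + 2 < i
  · exact 𝓓.φ_triple_eq_zero_of_lt h1
  by_cases h2 : max i k + 2 < j
  · exact 𝓓.φ_neg_triple h2
  by_cases h3 : max i j + 2 < k
  · have := 𝓓.φ_neg_triple (k := j) h3 (ξ := η) (η := ξ)
    rw [add_comm η ξ] at this
    linarith
  exact absurd ⟨by omega, by omega, by omega⟩ h

end Setup

end BilEst

end

/-! ### Tempered functions and convolution with Schwartz kernels. -/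

noncomputable section

namespace BilEst

open Filter Topology SchwartzMap

/-- Peetre's inequality: a polynomial weight moves from one variable of `K (x - y)` to the other at
the price of a weight in the difference, which rapid decay absorbs. -/
theorem one_add_abs_le_mul (x y : ℝ) : 1 + |x| ≤ (1 + |y|) * (1 + |y - x|) := by
  have h : |x| ≤ |y| + |y - x| := by
    have := abs_sub y (y - x)
    simpa using this
  nlinarith [abs_nonneg y, abs_nonneg (y - x)]

/-- Functions that decay faster than every power. -/
def RapidDecay (f : ℝ → ℂ) : Prop := ∀ N : ℕ, ∃ C : ℝ, ∀ x, ‖f x‖ * (1 + |x|) ^ N ≤ C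

/-- Functions of at most polynomial growth. -/
def PolyGrowth (f : ℝ → ℂ) : Prop := ∃ (C : ℝ) (N : ℕ), ∀ x, ‖f x‖ ≤ C * (1 + |x|) ^ N

theorem rapidDecay_schwartz (f : 𝓢(ℝ, ℂ)) : RapidDecay f := fun N => by
  obtain ⟨C, -, hC⟩ := schwartz_decay f N
  exact ⟨C, hC⟩

theorem RapidDecay.mul_polyGrowth {f g : ℝ → ℂ} (hf : RapidDecay f) (hg : PolyGrowth g) :
    RapidDecay (fun x => f x * g x) := by
  intro N
  obtain ⟨C, M, hC⟩ := hg
  obtain ⟨D, hD⟩ := hf (N + M)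
  refine ⟨D * C, fun x => ?_⟩
  have hC0 : 0 ≤ C := by
    have := (norm_nonneg _).trans (hC x)
    by_contra! h
    have : 0 < (1 + |x|) ^ M := by positivity
    nlinarith
  calc ‖f x * g x‖ * (1 + |x|) ^ N = ‖f x‖ * (1 + |x|) ^ N * ‖g x‖ := by rw [norm_mul]; ring
    _ ≤ ‖f x‖ * (1 + |x|) ^ N * (C * (1 + |x|) ^ M) := by gcongr; exact hC x
    _ = ‖f x‖ * (1 + |x|) ^ (N + M) * C := by ring
    _ ≤ D * C := by gcongr; exact hD x

theorem RapidDecay.comp_sub_left {f : ℝ → ℂ} (hf : RapidDecay f) (x : ℝ) :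
    RapidDecay (fun y => f (x - y)) := by
  intro N
  obtain ⟨C, hC⟩ := hf N
  refine ⟨C * (1 + |x|) ^ N, fun y => ?_⟩
  have h := one_add_abs_le_mul y x
  calc ‖f (x - y)‖ * (1 + |y|) ^ N ≤ ‖f (x - y)‖ * ((1 + |x|) * (1 + |x - y|)) ^ N := by gcongr
    _ = (‖f (x - y)‖ * (1 + |x - y|) ^ N) * (1 + |x|) ^ N := by rw [mul_pow]; ring
    _ ≤ _ := by gcongr; exact hC _

theorem RapidDecay.comp_neg {f : ℝ → ℂ} (hf : RapidDecay f) : RapidDecay (fun y => f (-y)) := by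
  simpa using hf.comp_sub_left 0

theorem RapidDecay.comp_sub_right {f : ℝ → ℂ} (hf : RapidDecay f) (x : ℝ) :
    RapidDecay (fun y => f (y - x)) := by
  simpa using hf.comp_neg.comp_sub_left x

theorem RapidDecay.polyGrowth {f : ℝ → ℂ} (hf : RapidDecay f) : PolyGrowth f := by
  obtain ⟨C, hC⟩ := hf 0
  exact ⟨C, 0, fun x => by simpa using hC x⟩

theorem PolyGrowth.mul {f g : ℝ → ℂ} (hf : PolyGrowth f) (hg : PolyGrowth g) :
    PolyGrowth (fun x => f x * g x) := by
  obtain ⟨C, M, hC⟩ := hf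
  obtain ⟨D, N, hD⟩ := hg
  refine ⟨C * D, M + N, fun x => ?_⟩
  rw [norm_mul]
  calc ‖f x‖ * ‖g x‖ ≤ (C * (1 + |x|) ^ M) * (D * (1 + |x|) ^ N) :=
        mul_le_mul (hC x) (hD x) (norm_nonneg _) ((norm_nonneg _).trans (hC x))
    _ = _ := by ring

theorem integrable_one_add_abs_sq : Integrable fun x : ℝ => ((1 + |x|) ^ 2)⁻¹ := by
  have := integrable_one_add_norm (E := ℝ) (μ := volume) (r := 2) (by simp)
  refine this.congr (Eventually.of_forall fun x => ?_)
  simp only [Real.norm_eq_abs]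
  rw [Real.rpow_neg (by positivity)]
  norm_cast

theorem TemperedFun.aestronglyMeasurable {a : ℝ → ℂ} (h : TemperedFun a) :
    AEStronglyMeasurable a := by
  obtain ⟨N, hN⟩ := h
  have : AEStronglyMeasurable (fun x : ℝ => (((1 + |x|) ^ N : ℝ) : ℂ)) :=
    Continuous.aestronglyMeasurable (by fun_prop)
  refine (this.mul hN.aestronglyMeasurable).congr (Eventually.of_forall fun x => ?_)
  simp only [Pi.mul_apply]
  rw [mul_inv_cancel_left₀]
  exact_mod_cast (by positivity : (1 + |x|) ^ N ≠ 0)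

theorem TemperedFun.exists_integrable_norm {a : ℝ → ℂ} (h : TemperedFun a) :
    ∃ N : ℕ, Integrable (fun x => ((1 + |x|) ^ N)⁻¹ * ‖a x‖) := by
  obtain ⟨N, hN⟩ := h
  refine ⟨N, hN.norm.congr (Eventually.of_forall fun x => ?_)⟩
  simp only [norm_mul, norm_inv, Complex.norm_real, Real.norm_eq_abs]
  rw [abs_of_pos (by positivity)]

theorem temperedFun_of_integrable_norm {a : ℝ → ℂ} (ha : AEStronglyMeasurable a) {N : ℕ}
    (h : Integrable (fun x => ((1 + |x|) ^ N)⁻¹ * ‖a x‖)) : TemperedFun a := by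
  refine ⟨N, h.mono' ?_ (Eventually.of_forall fun x => ?_)⟩
  · refine AEStronglyMeasurable.mul (Measurable.aestronglyMeasurable ?_) ha
    fun_prop
  · simp only [norm_mul, norm_inv, Complex.norm_real, Real.norm_eq_abs]
    rw [abs_of_pos (by positivity)]

theorem TemperedFun.locallyIntegrable {a : ℝ → ℂ} (h : TemperedFun a) : LocallyIntegrable a := by
  obtain ⟨N, hN⟩ := h
  have h1 := hN.locallyIntegrable.continuous_mul
    (g := fun x : ℝ => (((1 + |x|) ^ N : ℝ) : ℂ)) (by fun_prop)
  refine h1.congr (Eventually.of_forall fun x => ?_)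
  simp only
  rw [mul_inv_cancel_left₀]
  exact_mod_cast (by positivity : (1 + |x|) ^ N ≠ 0)

theorem TemperedFun.integrable_mul {a f : ℝ → ℂ} (ha : TemperedFun a) (hf : RapidDecay f)
    (hfm : AEStronglyMeasurable f) : Integrable (fun x => f x * a x) := by
  obtain ⟨N, hN⟩ := ha.exists_integrable_norm
  obtain ⟨C, hC⟩ := hf N
  refine (hN.const_mul C).mono' (hfm.mul ha.aestronglyMeasurable)
    (Eventually.of_forall fun x => ?_)
  rw [norm_mul, ← mul_assoc]
  gcongr
  rw [← div_eq_mul_inv, le_div_iff₀ (by positivity)]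
  exact hC x

theorem PolyGrowth.temperedFun {f : ℝ → ℂ} (hf : PolyGrowth f) (hm : AEStronglyMeasurable f) :
    TemperedFun f := by
  obtain ⟨C, N, hC⟩ := hf
  refine temperedFun_of_integrable_norm hm (N := N + 2)
    ((integrable_one_add_abs_sq.const_mul C).mono' ?_ (Eventually.of_forall fun x => ?_))
  · exact AEStronglyMeasurable.mul (Measurable.aestronglyMeasurable (by fun_prop)) hm.norm
  · rw [Real.norm_of_nonneg (by positivity)]
    calc ((1 + |x|) ^ (N + 2))⁻¹ * ‖f x‖ ≤ ((1 + |x|) ^ (N + 2))⁻¹ * (C * (1 + |x|) ^ N) := by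
          gcongr; exact hC x
      _ = C * ((1 + |x|) ^ 2)⁻¹ := by
        rw [pow_add]
        field_simp

theorem TemperedFun.mul_bounded {a b : ℝ → ℂ} (ha : TemperedFun a) (hb : AEStronglyMeasurable b)
    {C : ℝ} (hC : ∀ᵐ x, ‖b x‖ ≤ C) : TemperedFun (fun x => a x * b x) := by
  obtain ⟨N, hN⟩ := ha
  refine ⟨N, ?_⟩
  have := hN.mul_bdd (c := C) hb hC
  refine this.congr (Eventually.of_forall fun x => ?_)
  simp only
  ring

/-- Convolution with a Schwartz function. -/
def conv (K : 𝓢(ℝ, ℂ)) (a : ℝ → ℂ) (x : ℝ) : ℂ := ∫ y, K (x - y) * a y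

theorem integrable_conv (K : 𝓢(ℝ, ℂ)) {a : ℝ → ℂ} (ha : TemperedFun a) (x : ℝ) :
    Integrable (fun y => K (x - y) * a y) :=
  ha.integrable_mul ((rapidDecay_schwartz K).comp_sub_left x)
    (Continuous.aestronglyMeasurable (by fun_prop))

/-- Peetre's inequality separates the variables: growth in `x` is polynomial and the dependence on
`y` is one fixed integrable function. This majorant serves for the growth and continuity of
convolutions and for Fubini's theorem. -/
theorem exists_conv_bound (K : 𝓢(ℝ, ℂ)) {a : ℝ → ℂ} (ha : TemperedFun a) :
    ∃ (g : ℝ → ℝ) (N : ℕ), Integrable g ∧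
      ∀ x y, ‖K (x - y) * a y‖ ≤ (1 + |x|) ^ N * g y := by
  obtain ⟨N, hN⟩ := ha.exists_integrable_norm
  obtain ⟨C, hC⟩ := rapidDecay_schwartz K N
  refine ⟨fun y => C * (((1 + |y|) ^ N)⁻¹ * ‖a y‖), N, hN.const_mul C, fun x y => ?_⟩
  have h := one_add_abs_le_mul y x
  have h2 : ‖K (x - y)‖ ≤ (1 + |x|) ^ N * (C * ((1 + |y|) ^ N)⁻¹) := by
    rw [← mul_assoc, ← div_eq_mul_inv, le_div_iff₀ (by positivity)]
    calc ‖K (x - y)‖ * (1 + |y|) ^ N ≤ ‖K (x - y)‖ * ((1 + |x|) * (1 + |x - y|)) ^ N := by gcongr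
      _ = (‖K (x - y)‖ * (1 + |x - y|) ^ N) * (1 + |x|) ^ N := by rw [mul_pow]; ring
      _ ≤ C * (1 + |x|) ^ N := by gcongr; exact hC _
      _ = _ := mul_comm _ _
  calc ‖K (x - y) * a y‖ = ‖K (x - y)‖ * ‖a y‖ := norm_mul _ _
    _ ≤ ((1 + |x|) ^ N * (C * ((1 + |y|) ^ N)⁻¹)) * ‖a y‖ := by gcongr
    _ = _ := by ring

theorem polyGrowth_conv (K : 𝓢(ℝ, ℂ)) {a : ℝ → ℂ} (ha : TemperedFun a) : PolyGrowth (conv K a) := by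
  obtain ⟨g, N, hg, hb⟩ := exists_conv_bound K ha
  refine ⟨∫ y, g y, N, fun x => ?_⟩
  calc ‖conv K a x‖ ≤ ∫ y, ‖K (x - y) * a y‖ := norm_integral_le_integral_norm _
    _ ≤ ∫ y, (1 + |x|) ^ N * g y :=
      integral_mono (integrable_conv K ha x).norm (hg.const_mul _) (hb x)
    _ = _ := by rw [integral_const_mul, mul_comm]

theorem continuous_conv (K : 𝓢(ℝ, ℂ)) {a : ℝ → ℂ} (ha : TemperedFun a) : Continuous (conv K a) := by
  obtain ⟨g, N, hg, hb⟩ := exists_conv_bound K ha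
  rw [continuous_iff_continuousAt]
  intro x₀
  have hg0 : ∀ y, 0 ≤ g y := fun y => by
    have := (norm_nonneg _).trans (hb 0 y)
    simpa using this
  refine continuousAt_of_dominated (bound := fun y => (1 + (|x₀| + 1)) ^ N * g y)
    (Eventually.of_forall fun x => (integrable_conv K ha x).aestronglyMeasurable) ?_
    (hg.const_mul _) (Eventually.of_forall fun y => ?_)
  · filter_upwards [Metric.ball_mem_nhds x₀ one_pos] with x hx
    refine Eventually.of_forall fun y => (hb x y).trans ?_
    have hx' : |x| ≤ |x₀| + 1 := by
      rw [Metric.mem_ball, Real.dist_eq] at hx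
      have := abs_sub_abs_le_abs_sub x x₀
      linarith
    have := hg0 y
    gcongr
  · exact Continuous.continuousAt (by fun_prop)

/-- Fubini's theorem for the pairing of a convolution with a rapidly decaying function. -/
theorem integral_mul_conv {f : ℝ → ℂ} (hf : RapidDecay f) (hfc : Continuous f) (K : 𝓢(ℝ, ℂ))
    {a : ℝ → ℂ} (ha : TemperedFun a) :
    ∫ y, f y * conv K a y = ∫ z, (∫ y, f y * K (y - z)) * a z := by
  obtain ⟨g, N, hg, hb⟩ := exists_conv_bound K ha
  obtain ⟨C, hC⟩ := hf (N + 2)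
  have hint : Integrable (fun p : ℝ × ℝ => f p.1 * (K (p.1 - p.2) * a p.2))
      (volume.prod volume) := by
    refine ((integrable_one_add_abs_sq.const_mul C).mul_prod hg).mono' ?_
      (Eventually.of_forall fun p => ?_)
    · refine AEStronglyMeasurable.mul (Continuous.aestronglyMeasurable (by fun_prop)) ?_
      exact AEStronglyMeasurable.mul (Continuous.aestronglyMeasurable (by fun_prop))
        ha.aestronglyMeasurable.comp_snd
    · have hg0 : 0 ≤ g p.2 := by
        have := (norm_nonneg _).trans (hb 0 p.2)
        simpa using this
      rw [norm_mul]
      calc ‖f p.1‖ * ‖K (p.1 - p.2) * a p.2‖ ≤ ‖f p.1‖ * ((1 + |p.1|) ^ N * g p.2) := by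
            gcongr; exact hb _ _
        _ = (‖f p.1‖ * (1 + |p.1|) ^ (N + 2)) * ((1 + |p.1|) ^ 2)⁻¹ * g p.2 := by
          rw [pow_add]
          field_simp
        _ ≤ C * ((1 + |p.1|) ^ 2)⁻¹ * g p.2 := by gcongr; exact hC _
  simp_rw [conv, ← integral_const_mul]
  rw [integral_integral_swap hint]
  congr 1
  ext z
  rw [← integral_mul_const]
  congr 1
  ext y
  ring

theorem conv_conv_of_mul_eq {ψ₁ ψ₂ : 𝓢(ℝ, ℂ)} (h : ∀ ξ, ψ₁ ξ * ψ₂ ξ = ψ₂ ξ) {a : ℝ → ℂ}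
    (ha : TemperedFun a) (x : ℝ) : conv (𝓕⁻ ψ₁) (conv (𝓕⁻ ψ₂) a) x = conv (𝓕⁻ ψ₂) a x := by
  rw [conv, integral_mul_conv ((rapidDecay_schwartz _).comp_sub_left x) (by fun_prop) _ ha, conv]
  simp_rw [integral_fourierInv_mul_fourierInv h]

/-- Two applications of Fubini's theorem move first `a`, then `b`, outside, leaving the integral of
three kernels that vanishes by the support condition. Rapid decay of `𝓕⁻ ψ₁` compensates the
polynomial growth of the other factors. -/
theorem conv_mul_eq_zero {ψ₁ ψ₂ ψ₃ : 𝓢(ℝ, ℂ)} (h : ∀ ξ η, ψ₁ (ξ + η) * (ψ₂ ξ * ψ₃ η) = 0)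
    {a b : ℝ → ℂ} (ha : TemperedFun a) (hb : TemperedFun b) (x : ℝ) :
    conv (𝓕⁻ ψ₁) (fun y => conv (𝓕⁻ ψ₂) a y * conv (𝓕⁻ ψ₃) b y) x = 0 := by
  have hK : RapidDecay fun y => (𝓕⁻ ψ₁) (x - y) := (rapidDecay_schwartz (𝓕⁻ ψ₁)).comp_sub_left x
  have h1 : conv (𝓕⁻ ψ₁) (fun y => conv (𝓕⁻ ψ₂) a y * conv (𝓕⁻ ψ₃) b y) x =
      ∫ y, ((𝓕⁻ ψ₁) (x - y) * conv (𝓕⁻ ψ₃) b y) * conv (𝓕⁻ ψ₂) a y := by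
    rw [conv]
    congr 1
    ext y
    ring
  have hcb := continuous_conv (𝓕⁻ ψ₃) hb
  rw [h1, integral_mul_conv (hK.mul_polyGrowth (polyGrowth_conv _ hb)) (by fun_prop) _ ha]
  refine integral_eq_zero_of_ae (Eventually.of_forall fun z => ?_)
  have h2 : ∫ y, (𝓕⁻ ψ₁) (x - y) * conv (𝓕⁻ ψ₃) b y * (𝓕⁻ ψ₂) (y - z) =
      ∫ y, ((𝓕⁻ ψ₁) (x - y) * (𝓕⁻ ψ₂) (y - z)) * conv (𝓕⁻ ψ₃) b y := by
    congr 1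
    ext y
    ring
  have hR : RapidDecay fun y => (𝓕⁻ ψ₁) (x - y) * (𝓕⁻ ψ₂) (y - z) :=
    hK.mul_polyGrowth ((rapidDecay_schwartz (𝓕⁻ ψ₂)).comp_sub_right z).polyGrowth
  simp only [Pi.zero_apply]
  rw [h2, integral_mul_conv hR (by fun_prop) _ hb]
  simp_rw [mul_assoc]
  simp_rw [integral_fourierInv_mul_fourierInv_mul_fourierInv h]
  simp

/-! ### Littlewood-Paley series of functions and of products. -/

namespace Setup

variable (𝓓 : Setup)

theorem S_eq_conv (j : ℕ) (a : ℝ → ℂ) : 𝓓.S j a = conv (𝓓.ker j) a := by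
  ext x
  rw [S, conv, kernel_eq]

theorem sum_S {a : ℝ → ℂ} (ha : TemperedFun a) (J : ℕ) (x : ℝ) :
    ∑ j ∈ Finset.range (J + 1), 𝓓.S j a x = conv (𝓓.low J) a x := by
  simp_rw [S_eq_conv, conv]
  rw [← integral_finsetSum _ fun j _ => integrable_conv _ ha x]
  congr 1
  ext y
  rw [← Finset.sum_mul, sum_ker]

theorem integral_mul_low (f : ℝ → ℂ) (J : ℕ) (z : ℝ) :
    ∫ y, f y * 𝓓.low J (y - z) = ∫ s, f (z + s / 2 ^ J) * 𝓓.low 0 s := by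
  have h2 : (0 : ℝ) < 2 ^ J := by positivity
  have h := Measure.integral_comp_mul_left (fun s => f (z + s / 2 ^ J) * 𝓓.low 0 s) (2 ^ J : ℝ)
  rw [abs_of_pos (by positivity)] at h
  have h3 : ∫ s, f (z + s / 2 ^ J) * 𝓓.low 0 s =
      (2 ^ J : ℝ) • ∫ x, f (z + 2 ^ J * x / 2 ^ J) * 𝓓.low 0 (2 ^ J * x) := by
    rw [h, smul_smul, mul_inv_cancel₀ h2.ne', one_smul]
  rw [h3, ← integral_smul, ← integral_add_left_eq_self _ z]
  congr 1
  ext y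
  rw [add_sub_cancel_left, low_apply, mul_div_cancel_left₀ _ h2.ne', Complex.real_smul]
  push_cast
  ring

/-- The low frequency projections converge weakly to the identity, for test functions that may vary
with the projection. -/
theorem tendsto_integral_mul_conv_low {a : ℝ → ℂ} (ha : TemperedFun a) {f : ℕ → ℝ → ℂ}
    {g : ℝ → ℂ} (hfc : ∀ J, Continuous (f J)) (hgc : Continuous g)
    (hf : ∀ N : ℕ, ∃ C : ℝ, ∀ J x, ‖f J x‖ * (1 + |x|) ^ N ≤ C)
    (hfg : TendstoUniformly f g atTop) :
    Tendsto (fun J => ∫ y, f J y * conv (𝓓.low J) a y) atTop (𝓝 (∫ y, g y * a y)) := by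
  obtain ⟨N, hN⟩ := ha.exists_integrable_norm
  obtain ⟨C, hC⟩ := hf N
  have hfr : ∀ J, RapidDecay (f J) := fun J N => by
    obtain ⟨C, hC⟩ := hf N
    exact ⟨C, hC J⟩
  have hKint : Integrable fun s => (1 + |s|) ^ N * ‖𝓓.low 0 s‖ := by
    obtain ⟨D, hD⟩ := rapidDecay_schwartz (𝓓.low 0) (N + 2)
    refine (integrable_one_add_abs_sq.const_mul D).mono'
      (Continuous.aestronglyMeasurable (by fun_prop)) (Eventually.of_forall fun s => ?_)
    rw [Real.norm_of_nonneg (by positivity), ← div_eq_mul_inv, le_div_iff₀ (by positivity)]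
    calc _ = ‖𝓓.low 0 s‖ * (1 + |s|) ^ (N + 2) := by ring
      _ ≤ D := hD s
  have hpt : ∀ J z s, ‖f J (z + s / 2 ^ J) * 𝓓.low 0 s‖ ≤
      C * ((1 + |z|) ^ N)⁻¹ * ((1 + |s|) ^ N * ‖𝓓.low 0 s‖) := by
    intro J z s
    have h1 := one_add_abs_le_mul z (z + s / 2 ^ J)
    have h2 : |z + s / 2 ^ J - z| ≤ |s| := by
      rw [add_sub_cancel_left, abs_div, abs_of_pos (by positivity : (0 : ℝ) < 2 ^ J)]
      exact div_le_self (abs_nonneg _) (one_le_pow₀ one_le_two)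
    have h3 : ‖f J (z + s / 2 ^ J)‖ ≤ C * ((1 + |z|) ^ N)⁻¹ * (1 + |s|) ^ N := by
      rw [mul_right_comm, ← div_eq_mul_inv, le_div_iff₀ (by positivity)]
      calc ‖f J (z + s / 2 ^ J)‖ * (1 + |z|) ^ N
          ≤ ‖f J (z + s / 2 ^ J)‖ * ((1 + |z + s / 2 ^ J|) * (1 + |s|)) ^ N := by
            gcongr
            exact h1.trans (by gcongr)
        _ = (‖f J (z + s / 2 ^ J)‖ * (1 + |z + s / 2 ^ J|) ^ N) * (1 + |s|) ^ N := by
            rw [mul_pow]; ring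
        _ ≤ _ := by gcongr; exact hC _ _
    rw [norm_mul]
    calc _ ≤ (C * ((1 + |z|) ^ N)⁻¹ * (1 + |s|) ^ N) * ‖𝓓.low 0 s‖ := by gcongr
      _ = _ := by ring
  -- In the variable `s` the kernel is fixed and the test function is evaluated at `z + s / 2 ^ J`,
  -- which tends to `z`; uniform convergence allows the test function to vary at the same time.
  have hinner : ∀ z, Tendsto (fun J : ℕ => ∫ s, f J (z + s / 2 ^ J) * 𝓓.low 0 s) atTop (𝓝 (g z)) := by
    intro z
    have hlim : ∫ s, g z * 𝓓.low 0 s = g z := by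
      rw [integral_const_mul, integral_low_zero, mul_one]
    rw [← hlim]
    refine tendsto_integral_of_dominated_convergence
      (fun s => C * ((1 + |z|) ^ N)⁻¹ * ((1 + |s|) ^ N * ‖𝓓.low 0 s‖)) (fun J => ?_)
      (hKint.const_mul _) (fun J => Eventually.of_forall fun s => hpt J z s)
      (Eventually.of_forall fun s => ?_)
    · have := hfc J
      exact Continuous.aestronglyMeasurable (by fun_prop)
    · refine Tendsto.mul_const _ (hfg.tendsto_comp hgc.continuousAt ?_)
      have h0 : Tendsto (fun J : ℕ => s / 2 ^ J) atTop (𝓝 0) :=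
        tendsto_const_nhds.div_atTop (tendsto_pow_atTop_atTop_of_one_lt one_lt_two)
      simpa using h0.const_add z
  have heq : ∀ J, ∫ y, f J y * conv (𝓓.low J) a y =
      ∫ z, (∫ s, f J (z + s / 2 ^ J) * 𝓓.low 0 s) * a z := by
    intro J
    rw [integral_mul_conv (hfr J) (hfc J) _ ha]
    simp_rw [integral_mul_low]
  simp_rw [heq]
  refine tendsto_integral_of_dominated_convergence
    (fun z => (C * ∫ s, (1 + |s|) ^ N * ‖𝓓.low 0 s‖) * (((1 + |z|) ^ N)⁻¹ * ‖a z‖)) (fun J => ?_)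
    (hN.const_mul _) (fun J => Eventually.of_forall fun z => ?_)
    (Eventually.of_forall fun z => (hinner z).mul_const _)
  · refine AEStronglyMeasurable.mul ?_ ha.aestronglyMeasurable
    have hc : Continuous fun p : ℝ × ℝ => f J (p.1 + p.2 / 2 ^ J) * 𝓓.low 0 p.2 := by
      have := hfc J
      fun_prop
    exact (hc.stronglyMeasurable.integral_prod_right (ν := volume)).aestronglyMeasurable
  · rw [norm_mul]
    have : ‖∫ s, f J (z + s / 2 ^ J) * 𝓓.low 0 s‖ ≤
        C * ((1 + |z|) ^ N)⁻¹ * ∫ s, (1 + |s|) ^ N * ‖𝓓.low 0 s‖ := by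
      rw [← integral_const_mul]
      exact norm_integral_le_of_norm_le (hKint.const_mul _) (Eventually.of_forall (hpt J z))
    calc _ ≤ (C * ((1 + |z|) ^ N)⁻¹ * ∫ s, (1 + |s|) ^ N * ‖𝓓.low 0 s‖) * ‖a z‖ := by gcongr
      _ = _ := by ring

theorem continuous_S (j : ℕ) {a : ℝ → ℂ} (ha : TemperedFun a) : Continuous (𝓓.S j a) := by
  rw [S_eq_conv]
  exact continuous_conv _ ha

theorem polyGrowth_S (j : ℕ) {a : ℝ → ℂ} (ha : TemperedFun a) : PolyGrowth (𝓓.S j a) := by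
  rw [S_eq_conv]
  exact polyGrowth_conv _ ha

/-- The function represented by a uniformly convergent Littlewood-Paley series is the sum of the
series. -/
theorem ae_eq_tsum_S {b : ℝ → ℂ} (hb : TemperedFun b) {B : ℕ → ℝ} (hB : Summable B)
    (hbB : ∀ k x, ‖𝓓.S k b x‖ ≤ B k) : ∀ᵐ x, b x = ∑' k, 𝓓.S k b x := by
  have hc : Continuous fun x => ∑' k, 𝓓.S k b x :=
    continuous_tsum (fun k => 𝓓.continuous_S k hb) hB hbB
  have hu := tendstoUniformly_tsum_nat hB hbB
  refine ae_eq_of_integral_contDiff_smul_eq hb.locallyIntegrable hc.locallyIntegrable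
    fun g hg hgs => ?_
  have hgc : Continuous fun x => ((g x : ℝ) : ℂ) := by
    have := hg.continuous
    fun_prop
  have hgr : RapidDecay fun x => ((g x : ℝ) : ℂ) := by
    have hs : HasCompactSupport fun x => ((g x : ℝ) : ℂ) :=
      hgs.comp_left (g := fun r : ℝ => (r : ℂ)) Complex.ofReal_zero
    have hd : ContDiff ℝ ∞ fun x => ((g x : ℝ) : ℂ) := Complex.ofRealCLM.contDiff.comp hg
    have h := rapidDecay_schwartz (hs.toSchwartzMap hd)
    exact h
  have h1 : Tendsto (fun J => ∫ y, ((g y : ℝ) : ℂ) * conv (𝓓.low J) b y) atTop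
      (𝓝 (∫ y, ((g y : ℝ) : ℂ) * b y)) := by
    refine 𝓓.tendsto_integral_mul_conv_low hb (fun _ => hgc) hgc (fun N => ?_) ?_
    · obtain ⟨C, hC⟩ := hgr N
      exact ⟨C, fun _ => hC⟩
    · exact Metric.tendstoUniformly_iff.2 fun ε hε => Eventually.of_forall fun _ x => by simpa
  -- The truncations are also the partial sums of the series, which converge uniformly; comparison
  -- with the weak limit in `h1` identifies `b`.
  have h2 : Tendsto (fun J => ∫ y, ((g y : ℝ) : ℂ) * conv (𝓓.low J) b y) atTop
      (𝓝 (∫ y, ((g y : ℝ) : ℂ) * ∑' k, 𝓓.S k b y)) := by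
    refine tendsto_integral_of_dominated_convergence
      (fun x => ‖((g x : ℝ) : ℂ)‖ * ∑' k, B k) (fun J => ?_) ?_ (fun J => ?_) ?_
    · exact (hgc.mul (continuous_conv _ hb)).aestronglyMeasurable
    · exact ((hgc.integrable_of_hasCompactSupport
        (hgs.comp_left (g := fun r : ℝ => (r : ℂ)) Complex.ofReal_zero)).norm).mul_const _
    · refine Eventually.of_forall fun x => ?_
      rw [norm_mul, ← 𝓓.sum_S hb]
      gcongr
      refine (norm_sum_le _ _).trans ((Finset.sum_le_sum fun k _ => hbB k x).trans ?_)
      exact hB.sum_le_tsum _ fun k _ => (norm_nonneg _).trans (hbB k x)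
    · refine Eventually.of_forall fun x => Tendsto.const_mul _ ?_
      simp_rw [← 𝓓.sum_S hb]
      exact (tendsto_add_atTop_iff_nat 1).2 (hu.tendsto_at x)
  simpa [Complex.real_smul] using tendsto_nhds_unique h1 h2

theorem norm_ae_le_tsum {b : ℝ → ℂ} (hb : TemperedFun b) {B : ℕ → ℝ} (hB : Summable B)
    (hbB : ∀ k x, ‖𝓓.S k b x‖ ≤ B k) : ∀ᵐ x, ‖b x‖ ≤ ∑' k, B k := by
  filter_upwards [𝓓.ae_eq_tsum_S hb hB hbB] with x hx
  rw [hx]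
  exact tsum_of_norm_bounded hB.hasSum fun k => hbB k x

/-- The Littlewood-Paley decomposition of a product. -/
theorem tendsto_sum_S_mul {a b : ℝ → ℂ} (ha : TemperedFun a) (hb : TemperedFun b) {B : ℕ → ℝ}
    (hB : Summable B) (hbB : ∀ k x, ‖𝓓.S k b x‖ ≤ B k) (i : ℕ) (x : ℝ) :
    Tendsto (fun J => ∑ p ∈ Finset.range (J + 1) ×ˢ Finset.range (J + 1),
      𝓓.S i (fun y => 𝓓.S p.1 a y * 𝓓.S p.2 b y) x) atTop (𝓝 (𝓓.S i (fun y => a y * b y) x)) := by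
  have hc : Continuous fun x => ∑' k, 𝓓.S k b x :=
    continuous_tsum (fun k => 𝓓.continuous_S k hb) hB hbB
  have hu := tendstoUniformly_tsum_nat hB hbB
  have hu1 : TendstoUniformly (fun J x => ∑ k ∈ Finset.range (J + 1), 𝓓.S k b x)
      (fun x => ∑' k, 𝓓.S k b x) atTop := fun u hu' =>
    (tendsto_add_atTop_nat 1).eventually (hu u hu')
  have hB0 : ∀ k, 0 ≤ B k := fun k => (norm_nonneg _).trans (hbB k 0)
  have hsum : ∀ J x, ‖∑ k ∈ Finset.range (J + 1), 𝓓.S k b x‖ ≤ ∑' k, B k := fun J x =>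
    (norm_sum_le _ _).trans ((Finset.sum_le_sum fun k _ => hbB k x).trans
      (hB.sum_le_tsum _ fun k _ => hB0 k))
  set K : ℝ → ℂ := fun y => 𝓓.ker i (x - y) with hKdef
  have hKr : RapidDecay K := (rapidDecay_schwartz (𝓓.ker i)).comp_sub_left x
  have hKc : Continuous K := by fun_prop
  obtain ⟨M, hM⟩ := hKr 0
  have hM' : ∀ y, ‖K y‖ ≤ M := fun y => by simpa using hM y
  -- The partial sums of `b` are absorbed into the test function, where they converge uniformly, so
  -- that only the weak convergence of the truncations of `a` is needed.
  have key := 𝓓.tendsto_integral_mul_conv_low ha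
    (f := fun J y => K y * ∑ k ∈ Finset.range (J + 1), 𝓓.S k b y)
    (g := fun y => K y * ∑' k, 𝓓.S k b y)
    (fun J => hKc.mul (continuous_finsetSum _ fun k _ => 𝓓.continuous_S k hb)) (hKc.mul hc)
    (fun N => by
      obtain ⟨C, hC⟩ := hKr N
      refine ⟨C * ∑' k, B k, fun J y => ?_⟩
      rw [norm_mul]
      have hC0 : 0 ≤ C := le_trans (by positivity) (hC 0)
      calc _ = (‖K y‖ * (1 + |y|) ^ N) * ‖∑ k ∈ Finset.range (J + 1), 𝓓.S k b y‖ := by ring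
        _ ≤ _ := mul_le_mul (hC y) (hsum J y) (norm_nonneg _) hC0)
    (by
      rw [Metric.tendstoUniformly_iff] at hu1 ⊢
      intro ε hε
      have hM0 : 0 ≤ M := (norm_nonneg _).trans (hM' 0)
      filter_upwards [hu1 (ε / (M + 1)) (by positivity)] with J hJ y
      have := hJ y
      rw [dist_eq_norm] at this ⊢
      rw [← mul_sub, norm_mul]
      calc _ ≤ M * ‖∑' k, 𝓓.S k b y - ∑ k ∈ Finset.range (J + 1), 𝓓.S k b y‖ := by
            gcongr; exact hM' y
        _ ≤ M * (ε / (M + 1)) := by gcongr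
        _ < ε := by
          rw [mul_div_assoc', div_lt_iff₀ (by positivity)]
          nlinarith)
  have hlim : ∫ y, K y * (∑' k, 𝓓.S k b y) * a y = 𝓓.S i (fun y => a y * b y) x := by
    rw [S_eq_conv, conv]
    refine integral_congr_ae ?_
    filter_upwards [𝓓.ae_eq_tsum_S hb hB hbB] with y hy
    rw [← hy]
    ring
  rw [hlim] at key
  refine key.congr fun J => ?_
  have hint : ∀ p ∈ Finset.range (J + 1) ×ˢ Finset.range (J + 1),
      Integrable fun y => K y * (𝓓.S p.1 a y * 𝓓.S p.2 b y) := by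
    intro p _
    have hP := (𝓓.polyGrowth_S p.1 ha).mul (𝓓.polyGrowth_S p.2 hb)
    refine (hP.temperedFun ?_).integrable_mul hKr hKc.aestronglyMeasurable
    exact ((𝓓.continuous_S p.1 ha).mul (𝓓.continuous_S p.2 hb)).aestronglyMeasurable
  have h1 : ∀ p : ℕ × ℕ, 𝓓.S i (fun y => 𝓓.S p.1 a y * 𝓓.S p.2 b y) x =
      ∫ y, K y * (𝓓.S p.1 a y * 𝓓.S p.2 b y) := fun p => by
    rw [S_eq_conv, conv]
  simp_rw [h1]
  rw [← integral_finsetSum _ hint]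
  congr 1
  ext y
  rw [← 𝓓.sum_S ha, ← Finset.mul_sum, mul_assoc, mul_comm (∑ k ∈ _, _), Finset.sum_mul_sum,
    Finset.sum_product]

theorem S_mul_eq_zero {i j k : ℕ} (h : ¬ Interact i j k) {a b : ℝ → ℂ} (ha : TemperedFun a)
    (hb : TemperedFun b) (x : ℝ) : 𝓓.S i (fun y => 𝓓.S j a y * 𝓓.S k b y) x = 0 := by
  simp_rw [S_eq_conv]
  exact conv_mul_eq_zero (𝓓.symbol_triple_eq_zero h) ha hb x

theorem conv_low_S (j : ℕ) {a : ℝ → ℂ} (ha : TemperedFun a) (x : ℝ) :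
    conv (𝓓.low (j + 1)) (𝓓.S j a) x = 𝓓.S j a x := by
  rw [S_eq_conv]
  exact conv_conv_of_mul_eq (𝓓.lowSymbol_succ_mul_symbol j) ha x

/-- A bound that holds almost everywhere holds on a dense set, hence everywhere for a continuous
function. -/
theorem enorm_S_le_eLpNorm_top (j : ℕ) {a : ℝ → ℂ} (ha : TemperedFun a) (x : ℝ) :
    ‖𝓓.S j a x‖ₑ ≤ eLpNorm (𝓓.S j a) ⊤ volume := by
  rw [eLpNorm_exponent_top]
  have hcl : IsClosed {x | ‖𝓓.S j a x‖ₑ ≤ eLpNormEssSup (𝓓.S j a) volume} :=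
    isClosed_le (𝓓.continuous_S j ha).enorm continuous_const
  have hd : Dense {x | ‖𝓓.S j a x‖ₑ ≤ eLpNormEssSup (𝓓.S j a) volume} :=
    Measure.dense_of_ae (enorm_ae_le_eLpNormEssSup (𝓓.S j a) volume)
  have := hd x
  rwa [hcl.closure_eq] at this

end Setup

end BilEst

end

/-! ### Lebesgue norms of functions with values in `[0, ∞]`. -/

noncomputable section

namespace BilEst

open Filter Topology SchwartzMap

section ENNRealValued

variable {α ι : Type*} [MeasurableSpace α] {ν : Measure α} {p : ℝ≥0∞}

theorem eLpNorm_mono_ennreal {f g : α → ℝ≥0∞} (h : ∀ᵐ x ∂ν, f x ≤ g x) :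
    eLpNorm f p ν ≤ eLpNorm g p ν :=
  eLpNorm_mono_enorm_ae (by simpa using h)

theorem eLpNorm_two_eq (f : α → ℝ≥0∞) :
    eLpNorm f 2 ν = (∫⁻ x, f x ^ 2 ∂ν) ^ (1 / 2 : ℝ) := by
  rw [eLpNorm_eq_lintegral_rpow_enorm_toReal two_ne_zero ENNReal.ofNat_ne_top]
  simp

theorem eLpNorm_two_sq (f : α → ℝ≥0∞) : eLpNorm f 2 ν ^ 2 = ∫⁻ x, f x ^ 2 ∂ν := by
  rw [eLpNorm_two_eq, ← ENNReal.rpow_natCast, ← ENNReal.rpow_mul]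
  norm_num

theorem eLpNorm_one_eq (f : α → ℝ≥0∞) : eLpNorm f 1 ν = ∫⁻ x, f x ∂ν := by
  rw [eLpNorm_one_eq_lintegral_enorm]
  simp

theorem le_eLpNorm_top_ae (f : α → ℝ≥0∞) : ∀ᵐ x ∂ν, f x ≤ eLpNorm f ⊤ ν := by
  have := enorm_ae_le_eLpNormEssSup f ν
  simpa using this

theorem eLpNorm_top_le {f : α → ℝ≥0∞} {C : ℝ≥0∞} (h : ∀ᵐ x ∂ν, f x ≤ C) :
    eLpNorm f ⊤ ν ≤ C := by
  rw [eLpNorm_exponent_top]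
  refine essSup_le_of_ae_le C ?_
  filter_upwards [h] with x hx using by simpa using hx

/-- Minkowski's inequality for countable sums. -/
theorem eLpNorm_tsum_le [Countable ι] {f : ι → α → ℝ≥0∞} (hf : ∀ i, AEMeasurable (f i) ν)
    (hp : 1 ≤ p) : eLpNorm (fun x => ∑' i, f i x) p ν ≤ ∑' i, eLpNorm (f i) p ν := by
  by_cases htop : p = ⊤
  · subst htop
    refine eLpNorm_top_le ?_
    have : ∀ᵐ x ∂ν, ∀ i, f i x ≤ eLpNorm (f i) ⊤ ν := ae_all_iff.2 fun i => le_eLpNorm_top_ae _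
    filter_upwards [this] with x hx
    exact ENNReal.tsum_le_tsum hx
  · have hp0 : p ≠ 0 := (zero_lt_one.trans_le hp).ne'
    have hr : 0 < p.toReal := ENNReal.toReal_pos hp0 htop
    have hfin : ∀ s : Finset ι, ∫⁻ x, (∑ i ∈ s, f i x) ^ p.toReal ∂ν ≤
        (∑' i, eLpNorm (f i) p ν) ^ p.toReal := by
      intro s
      have h1 : eLpNorm (∑ i ∈ s, f i) p ν ≤ ∑ i ∈ s, eLpNorm (f i) p ν :=
        eLpNorm_sum_le (fun i _ => (hf i).aestronglyMeasurable) hp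
      have h2 := h1.trans (ENNReal.sum_le_tsum s)
      rw [eLpNorm_eq_lintegral_rpow_enorm_toReal hp0 htop] at h2
      have h3 := ENNReal.rpow_le_rpow h2 hr.le
      rw [← ENNReal.rpow_mul, one_div_mul_cancel hr.ne', ENNReal.rpow_one] at h3
      simpa using h3
    rw [eLpNorm_eq_lintegral_rpow_enorm_toReal hp0 htop, one_div, ENNReal.rpow_inv_le_iff hr]
    -- The power is an order isomorphism, so it commutes with the supremum over finite partial sums;
    -- monotone convergence along the directed family of finite sets then reduces to the finite
    -- Minkowski inequality.
    have h4 : ∀ x, ‖∑' i, f i x‖ₑ ^ p.toReal = ⨆ s : Finset ι, (∑ i ∈ s, f i x) ^ p.toReal := by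
      intro x
      rw [enorm_eq_self, ENNReal.tsum_eq_iSup_sum]
      exact (ENNReal.orderIsoRpow p.toReal hr).map_iSup _
    simp_rw [h4]
    rw [lintegral_iSup_directed]
    · exact iSup_le hfin
    · intro s
      exact (Finset.aemeasurable_fun_sum s fun i _ => hf i).pow_const _
    · refine Monotone.directed_le fun s t hst x => ?_
      simp only
      gcongr

theorem eLpNorm_const_mul_le (c : ℝ≥0∞) (hc : c ≠ ⊤) (f : α → ℝ≥0∞) :
    eLpNorm (fun x => c * f x) p ν ≤ c * eLpNorm f p ν := by
  by_cases hp0 : p = 0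
  · simp [hp0]
  by_cases htop : p = ⊤
  · subst htop
    refine eLpNorm_top_le ?_
    filter_upwards [le_eLpNorm_top_ae (ν := ν) f] with x hx
    gcongr
  · have hr : 0 < p.toReal := ENNReal.toReal_pos hp0 htop
    rw [eLpNorm_eq_lintegral_rpow_enorm_toReal hp0 htop,
      eLpNorm_eq_lintegral_rpow_enorm_toReal hp0 htop]
    simp only [enorm_eq_self]
    simp_rw [ENNReal.mul_rpow_of_nonneg _ _ hr.le]
    rw [lintegral_const_mul' _ _ (by finiteness), ENNReal.mul_rpow_of_nonneg _ _ (by positivity),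
      ← ENNReal.rpow_mul, mul_one_div_cancel hr.ne', ENNReal.rpow_one]

theorem eLpNorm_restrict_iUnion_le [Countable ι] {f : α → ℝ≥0∞} (hf : AEMeasurable f ν)
    {E : ι → Set α} (hE : ∀ i, MeasurableSet (E i)) (hp : 1 ≤ p) :
    eLpNorm f p (ν.restrict (⋃ i, E i)) ≤ ∑' i, eLpNorm f p (ν.restrict (E i)) := by
  simp_rw [← eLpNorm_indicator_eq_eLpNorm_restrict (hE _)]
  rw [← eLpNorm_indicator_eq_eLpNorm_restrict (MeasurableSet.iUnion hE)]
  refine le_trans ?_ (eLpNorm_tsum_le (fun i => hf.indicator (hE i)) hp)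
  refine eLpNorm_mono_ennreal (Eventually.of_forall fun x => ?_)
  by_cases hx : x ∈ ⋃ i, E i
  · obtain ⟨i, hi⟩ := mem_iUnion.1 hx
    rw [indicator_of_mem hx]
    refine le_trans ?_ (ENNReal.le_tsum i)
    rw [indicator_of_mem hi]
  · rw [indicator_of_notMem hx]
    exact zero_le

theorem lintegral_mul_le_eLpNorm_two {f g : α → ℝ≥0∞} (hf : AEMeasurable f ν)
    (hg : AEMeasurable g ν) : ∫⁻ x, f x * g x ∂ν ≤ eLpNorm f 2 ν * eLpNorm g 2 ν := by
  have := ENNReal.lintegral_mul_le_Lp_mul_Lq ν Real.HolderConjugate.two_two hf hg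
  rw [eLpNorm_two_eq, eLpNorm_two_eq]
  simpa using this

end ENNRealValued

/-! ### Mixed norms on the slab. -/

/-- Lebesgue measure on the time interval `[0,1]`. -/
def timeMeasure : Measure ℝ := volume.restrict (Icc (0 : ℝ) 1)

instance : IsProbabilityMeasure timeMeasure := ⟨by simp [timeMeasure]⟩

/-- The measure on the slab. -/
def slabMeasure : Measure (ℝ × ℝ) := timeMeasure.prod volume

theorem restrict_slab : (volume : Measure (ℝ × ℝ)).restrict slab = slabMeasure := by
  rw [slabMeasure, timeMeasure, slab, Measure.volume_eq_prod, ← Measure.prod_restrict,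
    Measure.restrict_univ]

/-- The mixed norm `L^q_t L^p_x` over `[0,1] × E` of a nonnegative function. -/
def mix (q p : ℝ≥0∞) (E : Set ℝ) (F : ℝ × ℝ → ℝ≥0∞) : ℝ≥0∞ :=
  eLpNorm (fun t => eLpNorm (fun x => F (t, x)) p (volume.restrict E)) q timeMeasure

section Mix

variable {q p : ℝ≥0∞} {E : Set ℝ} {F G : ℝ × ℝ → ℝ≥0∞}

theorem slice_aemeasurable (hF : AEMeasurable F slabMeasure) :
    ∀ᵐ t ∂timeMeasure, AEMeasurable (fun x => F (t, x)) := by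
  filter_upwards [hF.aestronglyMeasurable.prodMk_left] with t ht using ht.aemeasurable

/-- For finite `p` the inner norm is a power of an integral, so Tonelli's theorem gives
measurability in time. This route is closed for an essential supremum, which is why the mixed
Minkowski inequalities exclude `p = ⊤`. -/
theorem aemeasurable_slice_norm (hF : AEMeasurable F slabMeasure) (hp0 : p ≠ 0) (hp : p ≠ ⊤)
    (E : Set ℝ) :
    AEMeasurable (fun t => eLpNorm (fun x => F (t, x)) p (volume.restrict E)) timeMeasure := by
  simp_rw [eLpNorm_eq_lintegral_rpow_enorm_toReal hp0 hp, enorm_eq_self]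
  refine AEMeasurable.pow_const ?_ _
  have h1 : AEMeasurable F (timeMeasure.prod (volume.restrict E)) :=
    hF.mono_measure (by
      rw [slabMeasure]
      conv_lhs => rw [← Measure.restrict_univ (μ := timeMeasure), Measure.prod_restrict]
      exact Measure.restrict_le_self)
  exact (h1.pow_const _).lintegral_prod_right'

theorem mix_mono_ae (h : ∀ᵐ t ∂timeMeasure, ∀ᵐ x, F (t, x) ≤ G (t, x)) :
    mix q p E F ≤ mix q p E G := by
  refine eLpNorm_mono_ennreal ?_
  filter_upwards [h] with t ht
  exact eLpNorm_mono_ennreal (ae_restrict_of_ae ht)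

theorem mix_mono (h : ∀ z, F z ≤ G z) : mix q p E F ≤ mix q p E G :=
  mix_mono_ae (Eventually.of_forall fun _ => Eventually.of_forall fun _ => h _)

theorem mix_congr_ae (h : ∀ᵐ z ∂slabMeasure, F z = G z) : mix q p E F = mix q p E G := by
  have := Measure.ae_ae_of_ae_prod h
  refine le_antisymm (mix_mono_ae ?_) (mix_mono_ae ?_)
  · filter_upwards [this] with t ht
    filter_upwards [ht] with x hx using hx.le
  · filter_upwards [this] with t ht
    filter_upwards [ht] with x hx using hx.ge

theorem mix_mono_set {E' : Set ℝ} (h : E ⊆ E') (F : ℝ × ℝ → ℝ≥0∞) :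
    mix q p E F ≤ mix q p E' F :=
  eLpNorm_mono_ennreal (Eventually.of_forall fun _ =>
    eLpNorm_mono_measure _ (Measure.restrict_mono_set _ h))

theorem mix_tsum_le {ι : Type*} [Countable ι] {F : ι → ℝ × ℝ → ℝ≥0∞}
    (hF : ∀ i, AEMeasurable (F i) slabMeasure) (hp1 : 1 ≤ p) (hp : p ≠ ⊤) (hq : 1 ≤ q) :
    mix q p E (fun z => ∑' i, F i z) ≤ ∑' i, mix q p E (F i) := by
  refine le_trans (eLpNorm_mono_ennreal ?_) (eLpNorm_tsum_le
    (fun i => aemeasurable_slice_norm (hF i) (zero_lt_one.trans_le hp1).ne' hp E) hq)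
  filter_upwards [ae_all_iff.2 fun i => slice_aemeasurable (hF i)] with t ht
  exact eLpNorm_tsum_le (fun i => (ht i).restrict) hp1

theorem mix_const_mul_le (c : ℝ≥0∞) (hc : c ≠ ⊤) (F : ℝ × ℝ → ℝ≥0∞) :
    mix q p E (fun z => c * F z) ≤ c * mix q p E F :=
  le_trans (eLpNorm_mono_ennreal (Eventually.of_forall fun _ => eLpNorm_const_mul_le c hc _))
    (eLpNorm_const_mul_le c hc _)

theorem mix_iUnion_le {ι : Type*} [Countable ι] (hF : AEMeasurable F slabMeasure)
    {E : ι → Set ℝ} (hE : ∀ i, MeasurableSet (E i)) (hp1 : 1 ≤ p) (hp : p ≠ ⊤) (hq : 1 ≤ q) :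
    mix q p (⋃ i, E i) F ≤ ∑' i, mix q p (E i) F := by
  refine le_trans (eLpNorm_mono_ennreal ?_) (eLpNorm_tsum_le
    (fun i => aemeasurable_slice_norm hF (zero_lt_one.trans_le hp1).ne' hp (E i)) hq)
  filter_upwards [slice_aemeasurable hF] with t ht
  exact eLpNorm_restrict_iUnion_le ht hE hp1

theorem mix_le_mix_time {q' : ℝ≥0∞} (hq : q ≤ q') (hF : AEMeasurable F slabMeasure) (hp0 : p ≠ 0)
    (hp : p ≠ ⊤) : mix q p E F ≤ mix q' p E F :=
  eLpNorm_le_eLpNorm_of_exponent_le hq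
    (aemeasurable_slice_norm hF hp0 hp E).aestronglyMeasurable

/-- Multiplication by a bounded function. -/
theorem mix_mul_le_top_mul (h : mix ⊤ ⊤ E F ≠ ⊤) :
    mix q p E (fun z => F z * G z) ≤ mix ⊤ ⊤ E F * mix q p E G := by
  refine le_trans (eLpNorm_mono_ennreal ?_) (eLpNorm_const_mul_le _ h _)
  filter_upwards [le_eLpNorm_top_ae (ν := timeMeasure)
    (fun t => eLpNorm (fun x => F (t, x)) ⊤ (volume.restrict E))] with t ht
  refine le_trans (eLpNorm_mono_ennreal ?_) (eLpNorm_const_mul_le _ h _)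
  filter_upwards [le_eLpNorm_top_ae (ν := volume.restrict E) (fun x => F (t, x))] with x hx
  gcongr
  exact hx.trans ht

/-- The Cauchy-Schwarz inequality, uniformly in time. -/
theorem mix_top_one_mul_le (hF : AEMeasurable F slabMeasure) (hG : AEMeasurable G slabMeasure) :
    mix ⊤ 1 E (fun z => F z * G z) ≤ mix ⊤ 2 E F * mix ⊤ 2 E G := by
  refine eLpNorm_top_le ?_
  filter_upwards [slice_aemeasurable hF, slice_aemeasurable hG,
    le_eLpNorm_top_ae (ν := timeMeasure)
      (fun t => eLpNorm (fun x => F (t, x)) 2 (volume.restrict E)),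
    le_eLpNorm_top_ae (ν := timeMeasure)
      (fun t => eLpNorm (fun x => G (t, x)) 2 (volume.restrict E))] with t h1 h2 h3 h4
  rw [eLpNorm_one_eq]
  exact (lintegral_mul_le_eLpNorm_two h1.restrict h2.restrict).trans (mul_le_mul' h3 h4)

theorem mix_two_two_sq (hF : AEMeasurable F slabMeasure) :
    mix 2 2 E F ^ 2 = ∫⁻ z, F z ^ 2 ∂(timeMeasure.prod (volume.restrict E)) := by
  have h1 : AEMeasurable F (timeMeasure.prod (volume.restrict E)) :=
    hF.mono_measure (by
      rw [slabMeasure]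
      conv_lhs => rw [← Measure.restrict_univ (μ := timeMeasure), Measure.prod_restrict]
      exact Measure.restrict_le_self)
  rw [mix, eLpNorm_two_sq, lintegral_prod _ (h1.pow_const _)]
  simp_rw [eLpNorm_two_sq]

theorem timeMeasure_prod_restrict (E : Set ℝ) : timeMeasure.prod (volume.restrict E) =
    (volume : Measure (ℝ × ℝ)).restrict (Icc (0 : ℝ) 1 ×ˢ E) := by
  rw [timeMeasure, Measure.volume_eq_prod, Measure.prod_restrict]

theorem eLpNorm_two_eq_mix {u : ℝ × ℝ → ℂ} (hu : AEStronglyMeasurable u slabMeasure) :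
    eLpNorm u 2 (volume.restrict (Icc (0 : ℝ) 1 ×ˢ E)) = mix 2 2 E (fun z => ‖u z‖ₑ) := by
  rw [← eLpNorm_enorm, eLpNorm_two_eq, ← timeMeasure_prod_restrict, ← mix_two_two_sq hu.enorm,
    ← ENNReal.rpow_natCast, ← ENNReal.rpow_mul]
  norm_num

theorem normLinfL2_eq_mix (u : ℝ × ℝ → ℂ) : normLinfL2 u = mix ⊤ 2 univ (fun z => ‖u z‖ₑ) := by
  rw [normLinfL2, mix, eLpNorm_exponent_top, timeMeasure, eLpNormEssSup]
  simp only [Measure.restrict_univ, enorm_eq_self]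
  rfl

theorem normL1L2_eq_mix (u : ℝ × ℝ → ℂ) : normL1L2 u = mix 1 2 univ (fun z => ‖u z‖ₑ) := by
  rw [normL1L2, mix, eLpNorm_one_eq, timeMeasure]
  simp only [Measure.restrict_univ]
  rfl

/-- Mixed norms of functions that do not depend on time. -/
theorem mix_comp_snd (hq : q ≠ 0) (g : ℝ → ℝ≥0∞) :
    mix q p E (fun z => g z.2) = eLpNorm g p (volume.restrict E) := by
  simp only [mix]
  rw [eLpNorm_const _ hq (IsProbabilityMeasure.ne_zero _)]
  simp

theorem mix_indicator (hE : MeasurableSet E) :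
    mix q p univ (fun z => E.indicator 1 z.2 * F z) = mix q p E F := by
  simp only [mix, Measure.restrict_univ]
  congr 1
  ext t
  rw [← eLpNorm_indicator_eq_eLpNorm_restrict hE]
  congr 1
  ext x
  by_cases hx : x ∈ E <;> simp [hx]

end Mix

end BilEst

end

/-! ### Localised convolution bounds and sums over partitions. -/

noncomputable section

namespace BilEst

open Filter Topology SchwartzMap

open Setup (block)

/-! ### Averages over blocks -/

theorem measurableSet_block (j : ℕ) (r : ℤ) : MeasurableSet (block j r) := measurableSet_Ico

theorem mem_block_floor (j : ℕ) (x : ℝ) : x ∈ block j ⌊2 ^ j * x⌋ := by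
  have h0 : (0 : ℝ) < 2 ^ j := by positivity
  rw [block, mem_Ico, div_le_iff₀ h0, lt_div_iff₀ h0]
  constructor
  · linarith [Int.floor_le (2 ^ j * x), mul_comm x (2 ^ j)]
  · linarith [Int.lt_floor_add_one (2 ^ j * x), mul_comm x (2 ^ j)]

theorem volume_block (j : ℕ) (r : ℤ) : volume (block j r) = ((2 : ℝ≥0∞) ^ j)⁻¹ := by
  rw [block, Real.volume_Ico, ← sub_div, add_sub_cancel_left, one_div,
    ENNReal.ofReal_inv_of_pos (by positivity), ENNReal.ofReal_pow (by norm_num)]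
  simp

/-- The indicator function of a block. -/
def blockInd (j : ℕ) (r : ℤ) : ℝ → ℝ≥0∞ := (block j r).indicator 1

theorem measurable_blockInd (j : ℕ) (r : ℤ) : Measurable (blockInd j r) :=
  measurable_one.indicator (measurableSet_block j r)

theorem blockInd_le_one (j : ℕ) (r : ℤ) (x : ℝ) : blockInd j r x ≤ 1 :=
  indicator_le_self' (fun _ _ => zero_le) x

theorem lintegral_blockInd (j : ℕ) (r : ℤ) : ∫⁻ x, blockInd j r x = ((2 : ℝ≥0∞) ^ j)⁻¹ := by
  rw [blockInd, lintegral_indicator_one (measurableSet_block j r), volume_block]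

theorem lintegral_blockInd_sub_left (j : ℕ) (r : ℤ) (x : ℝ) :
    ∫⁻ y, blockInd j r (x - y) = ((2 : ℝ≥0∞) ^ j)⁻¹ := by
  rw [lintegral_sub_left_eq_self (blockInd j r) x, lintegral_blockInd]

theorem lintegral_blockInd_sub_right (j : ℕ) (r : ℤ) (y : ℝ) :
    ∫⁻ x, blockInd j r (x - y) = ((2 : ℝ≥0∞) ^ j)⁻¹ := by
  rw [lintegral_sub_right_eq_self (blockInd j r) y, lintegral_blockInd]

/-- The average of `g` over the reflected block centred at `x`. -/
def avg (j : ℕ) (r : ℤ) (g : ℝ → ℝ≥0∞) (x : ℝ) : ℝ≥0∞ :=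
  2 ^ j * ∫⁻ y, blockInd j r (x - y) * g y

theorem aemeasurable_blockInd_mul {g : ℝ → ℝ≥0∞} (hg : AEMeasurable g) (j : ℕ) (r : ℤ) (E : Set ℝ) :
    AEMeasurable (fun p : ℝ × ℝ => blockInd j r (p.1 - p.2) * g p.2)
      ((volume.restrict E).prod volume) :=
  AEMeasurable.mul ((measurable_blockInd j r).comp (measurable_fst.sub measurable_snd)).aemeasurable
    hg.comp_snd

theorem aemeasurable_avg {g : ℝ → ℝ≥0∞} (hg : AEMeasurable g) (j : ℕ) (r : ℤ) (E : Set ℝ) :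
    AEMeasurable (avg j r g) (volume.restrict E) :=
  (aemeasurable_blockInd_mul hg j r E).lintegral_prod_right'.const_mul _

theorem two_pow_ne_zero' (j : ℕ) : (2 : ℝ≥0∞) ^ j ≠ 0 := pow_ne_zero _ two_ne_zero

theorem two_pow_ne_top' (j : ℕ) : (2 : ℝ≥0∞) ^ j ≠ ⊤ := ENNReal.pow_ne_top ENNReal.ofNat_ne_top

section Avg

variable {g : ℝ → ℝ≥0∞} {E E' : Set ℝ} {j : ℕ} {r : ℤ}

/-- By Tonelli's theorem the `x`-integral can be taken first; it is at most the length `2^(-j)` of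
the block, which cancels the normalisation of `avg`. Points outside `E'` are never reached from `E`.
-/
theorem lintegral_avg_le (hg : AEMeasurable g) (hE : MeasurableSet E) (hE' : MeasurableSet E')
    (hsub : ∀ x ∈ E, ∀ z ∈ block j r, x - z ∈ E') :
    ∫⁻ x in E, avg j r g x ≤ ∫⁻ y in E', g y := by
  have h1 : ∫⁻ x in E, avg j r g x =
      2 ^ j * ∫⁻ y, ∫⁻ x in E, blockInd j r (x - y) * g y := by
    simp only [avg]
    rw [lintegral_const_mul' _ _ (two_pow_ne_top' j),
      lintegral_lintegral_swap (aemeasurable_blockInd_mul hg j r E)]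
  have h2 : ∀ y, 2 ^ j * ∫⁻ x in E, blockInd j r (x - y) * g y ≤ E'.indicator g y := by
    intro y
    have hb : Measurable fun x => blockInd j r (x - y) :=
      (measurable_blockInd j r).comp (measurable_id.sub_const y)
    rw [lintegral_mul_const _ hb]
    by_cases hy : y ∈ E'
    · rw [indicator_of_mem hy]
      calc 2 ^ j * ((∫⁻ x in E, blockInd j r (x - y)) * g y)
          ≤ 2 ^ j * ((∫⁻ x, blockInd j r (x - y)) * g y) := by
            gcongr
            exact Measure.restrict_le_self
        _ = g y := by
          rw [lintegral_blockInd_sub_right, ← mul_assoc,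
            ENNReal.mul_inv_cancel (two_pow_ne_zero' j) (two_pow_ne_top' j), one_mul]
    · have : ∫⁻ x in E, blockInd j r (x - y) = 0 := by
        rw [setLIntegral_congr_fun hE (g := fun _ => 0) fun x hx => ?_]
        · simp
        · refine indicator_of_notMem (fun hz => hy ?_) _
          simpa using hsub x hx _ hz
      rw [this]
      simp
  rw [h1, ← lintegral_const_mul' _ _ (two_pow_ne_top' j), ← lintegral_indicator hE']
  exact lintegral_mono h2

/-- Jensen's inequality for a normalised average, obtained from Cauchy-Schwarz because an indicator
equals its own square. -/
theorem avg_sq_le (hg : AEMeasurable g) (x : ℝ) :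
    avg j r g x ^ 2 ≤ avg j r (fun y => g y ^ 2) x := by
  have hb : Measurable fun y => blockInd j r (x - y) :=
    (measurable_blockInd j r).comp (measurable_const.sub measurable_id)
  have hsq : ∀ z, blockInd j r z * blockInd j r z = blockInd j r z := by
    intro z
    by_cases hz : z ∈ block j r <;> simp [blockInd, hz]
  have h1 : (∫⁻ y, blockInd j r (x - y) * g y) ^ 2 ≤
      (∫⁻ y, blockInd j r (x - y)) * ∫⁻ y, blockInd j r (x - y) * g y ^ 2 := by
    have h := lintegral_mul_le_eLpNorm_two (f := fun y => blockInd j r (x - y))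
      (g := fun y => blockInd j r (x - y) * g y) hb.aemeasurable (hb.aemeasurable.mul hg)
    have h2 := pow_le_pow_left' h 2
    rw [mul_pow, eLpNorm_two_sq, eLpNorm_two_sq] at h2
    simp_rw [← mul_assoc, hsq, mul_pow, pow_two (blockInd j r _), hsq] at h2
    exact h2
  rw [lintegral_blockInd_sub_left] at h1
  calc avg j r g x ^ 2 = (2 ^ j * 2 ^ j) * (∫⁻ y, blockInd j r (x - y) * g y) ^ 2 := by
        rw [avg]; ring
    _ ≤ (2 ^ j * 2 ^ j) * (((2 : ℝ≥0∞) ^ j)⁻¹ * ∫⁻ y, blockInd j r (x - y) * g y ^ 2) := by gcongr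
    _ = 2 ^ j * (2 ^ j * ((2 : ℝ≥0∞) ^ j)⁻¹) * ∫⁻ y, blockInd j r (x - y) * g y ^ 2 := by ring
    _ = _ := by
      rw [ENNReal.mul_inv_cancel (two_pow_ne_zero' j) (two_pow_ne_top' j), mul_one, avg]

theorem avg_le (hE' : MeasurableSet E')
    (hsub : ∀ x ∈ E, ∀ z ∈ block j r, x - z ∈ E') {x : ℝ} (hx : x ∈ E) :
    avg j r g x ≤ 2 ^ j * ∫⁻ y in E', g y := by
  rw [avg, ← lintegral_indicator hE']
  gcongr with y
  by_cases hy : y ∈ E'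
  · rw [indicator_of_mem hy]
    exact mul_le_of_le_one_left zero_le (blockInd_le_one j r _)
  · have : blockInd j r (x - y) = 0 := by
      refine indicator_of_notMem (fun hz => hy ?_) _
      simpa using hsub x hx _ hz
    rw [this]
    simp

end Avg

/-- Averages over blocks of length `2^(-j)` map `L^p (E - block)` to `L^p' (E)` with norm `κ j`. -/
def AvgBound (p p' : ℝ≥0∞) (κ : ℕ → ℝ≥0∞) : Prop :=
  ∀ (j : ℕ) (r : ℤ) (E E' : Set ℝ) (g : ℝ → ℝ≥0∞), MeasurableSet E → MeasurableSet E' →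
    AEMeasurable g → (∀ x ∈ E, ∀ z ∈ block j r, x - z ∈ E') →
    eLpNorm (avg j r g) p' (volume.restrict E) ≤ κ j * eLpNorm g p (volume.restrict E')

/-- The factor `2^(j/2)`. -/
def sqrtTwoPow (j : ℕ) : ℝ≥0∞ := ((2 : ℝ≥0∞) ^ j) ^ (1 / 2 : ℝ)

theorem sqrtTwoPow_sq (j : ℕ) : sqrtTwoPow j ^ 2 = 2 ^ j := by
  rw [sqrtTwoPow, ← ENNReal.rpow_natCast, ← ENNReal.rpow_mul]
  norm_num

theorem sqrtTwoPow_ne_top (j : ℕ) : sqrtTwoPow j ≠ ⊤ := by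
  have := two_pow_ne_top' j
  rw [sqrtTwoPow]
  finiteness

theorem le_of_sq_le_sq {a b : ℝ≥0∞} (h : a ^ 2 ≤ b ^ 2) : a ≤ b :=
  (ENNReal.pow_le_pow_left_iff (by norm_num)).1 h

theorem avgBound_two_two : AvgBound 2 2 (fun _ => 1) := by
  intro j r E E' g hE hE' hg hsub
  refine le_of_sq_le_sq ?_
  rw [mul_pow, one_pow, one_mul, eLpNorm_two_sq, eLpNorm_two_sq]
  exact (lintegral_mono fun x => avg_sq_le hg x).trans
    (lintegral_avg_le (hg.pow_const 2) hE hE' hsub)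

theorem avgBound_two_top : AvgBound 2 ⊤ sqrtTwoPow := by
  intro j r E E' g hE hE' hg hsub
  refine eLpNorm_top_le ?_
  filter_upwards [ae_restrict_mem hE] with x hx
  refine le_of_sq_le_sq ?_
  rw [mul_pow, eLpNorm_two_sq, sqrtTwoPow_sq]
  exact (avg_sq_le hg x).trans (avg_le hE' hsub hx)

/-- One factor of the square is bounded pointwise by `2 ^ j` times the integral of `g`, the other is
integrated; the root of `2 ^ j` is Bernstein's loss. -/
theorem avgBound_one_two : AvgBound 1 2 sqrtTwoPow := by
  intro j r E E' g hE hE' hg hsub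
  refine le_of_sq_le_sq ?_
  rw [mul_pow, eLpNorm_two_sq, sqrtTwoPow_sq, eLpNorm_one_eq]
  calc ∫⁻ x in E, avg j r g x ^ 2
      ≤ ∫⁻ x in E, (2 ^ j * ∫⁻ y in E', g y) * avg j r g x := by
        refine setLIntegral_mono_ae' hE (Eventually.of_forall fun x hx => ?_)
        rw [pow_two]
        gcongr
        exact avg_le hE' hsub hx
    _ = (2 ^ j * ∫⁻ y in E', g y) * ∫⁻ x in E, avg j r g x :=
        lintegral_const_mul'' _ (aemeasurable_avg hg j r E)
    _ ≤ (2 ^ j * ∫⁻ y in E', g y) * ∫⁻ y in E', g y := by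
        exact mul_le_mul' le_rfl (lintegral_avg_le hg hE hE' hsub)
    _ = _ := by ring

/-- A kernel is dominated by `c r 2^j` on the `r`-th block of scale `2^(-j)`. -/
def BlockBound (c : ℤ → ℝ≥0∞) (j : ℕ) (K : 𝓢(ℝ, ℂ)) : Prop :=
  ∀ r, ∀ x ∈ block j r, ‖K x‖ₑ ≤ c r * 2 ^ j

/-- The kernel is cut into blocks, and `c r * 2 ^ j` is its size on a block times the normalisation
of `avg`. The floor selects the block containing `x - y`. -/
theorem enorm_conv_le {c : ℤ → ℝ≥0∞} {j : ℕ} {K : 𝓢(ℝ, ℂ)} (hK : BlockBound c j K) {a : ℝ → ℂ}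
    (ha : AEMeasurable (fun y => ‖a y‖ₑ)) (x : ℝ) :
    ‖conv K a x‖ₑ ≤ ∑' r, c r * avg j r (fun y => ‖a y‖ₑ) x := by
  have hb : ∀ r, Measurable fun y => blockInd j r (x - y) := fun r =>
    (measurable_blockInd j r).comp (measurable_const.sub measurable_id)
  calc ‖conv K a x‖ₑ ≤ ∫⁻ y, ‖K (x - y) * a y‖ₑ := enorm_integral_le_lintegral_enorm _
    _ ≤ ∫⁻ y, ∑' r, (c r * 2 ^ j) * (blockInd j r (x - y) * ‖a y‖ₑ) := by
      refine lintegral_mono fun y => ?_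
      rw [enorm_mul]
      have hm := mem_block_floor j (x - y)
      refine le_trans ?_ (ENNReal.le_tsum ⌊2 ^ j * (x - y)⌋)
      rw [blockInd, indicator_of_mem hm]
      simp only [Pi.one_apply, one_mul]
      gcongr
      exact hK _ _ hm
    _ = ∑' r, ∫⁻ y, (c r * 2 ^ j) * (blockInd j r (x - y) * ‖a y‖ₑ) :=
      lintegral_tsum fun r => ((hb r).aemeasurable.mul ha).const_mul _
    _ = _ := by
      congr 1
      ext r
      have hm : AEMeasurable fun y => blockInd j r (x - y) * ‖a y‖ₑ := (hb r).aemeasurable.mul ha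
      rw [lintegral_const_mul'' _ hm, avg, mul_assoc]

/-- Convolution in the space variable. -/
def convt (K : 𝓢(ℝ, ℂ)) (u : ℝ × ℝ → ℂ) (z : ℝ × ℝ) : ℂ := conv K (fun y => u (z.1, y)) z.2

theorem Setup.St_eq_convt (𝓓 : Setup) (j : ℕ) (u : ℝ × ℝ → ℂ) : 𝓓.St j u = convt (𝓓.ker j) u := by
  ext z
  rw [Setup.St, 𝓓.S_eq_conv, convt]

theorem ae_slab_of_ae_time {P : ℝ → Prop} (h : ∀ᵐ t ∂timeMeasure, P t) :
    ∀ᵐ z ∂slabMeasure, P z.1 :=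
  Measure.quasiMeasurePreserving_fst.ae h

theorem convt_congr_ae (K : 𝓢(ℝ, ℂ)) {u v : ℝ × ℝ → ℂ} (h : u =ᵐ[slabMeasure] v) :
    ∀ᵐ t ∂timeMeasure, ∀ x, convt K u (t, x) = convt K v (t, x) := by
  filter_upwards [Measure.ae_ae_of_ae_prod h] with t ht x
  refine integral_congr_ae ?_
  filter_upwards [ht] with y hy
  rw [hy]

theorem aestronglyMeasurable_convt (K : 𝓢(ℝ, ℂ)) {u : ℝ × ℝ → ℂ}
    (hu : AEStronglyMeasurable u slabMeasure) : AEStronglyMeasurable (convt K u) slabMeasure := by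
  have hm : StronglyMeasurable (convt K (hu.mk u)) := by
    have h1 : StronglyMeasurable fun w : (ℝ × ℝ) × ℝ =>
        K (w.1.2 - w.2) * hu.mk u (w.1.1, w.2) := by
      refine StronglyMeasurable.mul ?_ ?_
      · exact Continuous.stronglyMeasurable (by fun_prop)
      · exact hu.stronglyMeasurable_mk.comp_measurable (by fun_prop)
    exact h1.integral_prod_right (ν := volume)
  refine ⟨_, hm, ?_⟩
  have := ae_slab_of_ae_time (convt_congr_ae K hu.ae_eq_mk)
  filter_upwards [this] with z hz using hz z.2

/-- The `r`-th block of the kernel only sees `u` on `E` minus that block, so every `r` may carry its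
own set `E' r`. Minkowski's inequality passes the sum over blocks through both norms. -/
theorem mix_convt_le {p p' q : ℝ≥0∞} {κ : ℕ → ℝ≥0∞} (hA : AvgBound p p' κ) (hp1 : 1 ≤ p)
    (hp : p ≠ ⊤) (hp' : 1 ≤ p') (hq : 1 ≤ q) {c : ℤ → ℝ≥0∞} (hc : ∀ r, c r ≠ ⊤) {j : ℕ}
    (hκ : κ j ≠ ⊤) {K : 𝓢(ℝ, ℂ)} (hK : BlockBound c j K) {u : ℝ × ℝ → ℂ}
    (hu : AEStronglyMeasurable u slabMeasure) {E : Set ℝ} {E' : ℤ → Set ℝ} (hE : MeasurableSet E)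
    (hE' : ∀ r, MeasurableSet (E' r)) (hsub : ∀ r, ∀ x ∈ E, ∀ z ∈ block j r, x - z ∈ E' r) :
    mix q p' E (fun z => ‖convt K u z‖ₑ) ≤ κ j * ∑' r, c r * mix q p (E' r) (fun z => ‖u z‖ₑ) := by
  have h1 : ∀ᵐ t ∂timeMeasure, eLpNorm (fun x => ‖convt K u (t, x)‖ₑ) p' (volume.restrict E) ≤
      ∑' r, (κ j * c r) * eLpNorm (fun x => ‖u (t, x)‖ₑ) p (volume.restrict (E' r)) := by
    filter_upwards [slice_aemeasurable hu.enorm] with t ht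
    calc _ ≤ eLpNorm (fun x => ∑' r, c r * avg j r (fun y => ‖u (t, y)‖ₑ) x) p'
          (volume.restrict E) :=
          eLpNorm_mono_ennreal (Eventually.of_forall fun x => enorm_conv_le hK ht x)
      _ ≤ ∑' r, eLpNorm (fun x => c r * avg j r (fun y => ‖u (t, y)‖ₑ) x) p'
          (volume.restrict E) :=
          eLpNorm_tsum_le (fun r => (aemeasurable_avg ht j r E).const_mul _) hp'
      _ ≤ _ := by
        refine ENNReal.tsum_le_tsum fun r => ?_
        refine (eLpNorm_const_mul_le _ (hc r) _).trans ?_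
        rw [mul_comm (κ j), mul_assoc]
        gcongr
        exact hA j r E (E' r) _ hE (hE' r) ht (hsub r)
  have hm := fun r => aemeasurable_slice_norm hu.enorm (zero_lt_one.trans_le hp1).ne' hp (E' r)
  calc _ ≤ eLpNorm (fun t => ∑' r, (κ j * c r) *
        eLpNorm (fun x => ‖u (t, x)‖ₑ) p (volume.restrict (E' r))) q timeMeasure :=
        eLpNorm_mono_ennreal h1
    _ ≤ ∑' r, eLpNorm (fun t => (κ j * c r) *
        eLpNorm (fun x => ‖u (t, x)‖ₑ) p (volume.restrict (E' r))) q timeMeasure :=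
        eLpNorm_tsum_le (fun r => (hm r).const_mul _) hq
    _ ≤ ∑' r, (κ j * c r) * mix q p (E' r) (fun z => ‖u z‖ₑ) :=
        ENNReal.tsum_le_tsum fun r => eLpNorm_const_mul_le _ (ENNReal.mul_ne_top hκ (hc r)) _
    _ = _ := by
      simp_rw [mul_assoc]
      rw [ENNReal.tsum_mul_left]

/-! ### Set functions on the partitions -/

/-- Monotone, countably subadditive set functions. -/
structure SubadditiveSetFn (Φ : Set ℝ → ℝ≥0∞) : Prop where
  mono : ∀ {E E' : Set ℝ}, E ⊆ E' → Φ E ≤ Φ E'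
  iUnion_le : ∀ {ι : Type} [Countable ι] {E : ι → Set ℝ}, (∀ i, MeasurableSet (E i)) →
    Φ (⋃ i, E i) ≤ ∑' i, Φ (E i)

theorem SubadditiveSetFn.empty {Φ : Set ℝ → ℝ≥0∞} (h : SubadditiveSetFn Φ) : Φ ∅ = 0 := by
  have := h.iUnion_le (ι := Empty) (E := fun _ => ∅) (fun _ => MeasurableSet.empty)
  simpa using this

theorem SubadditiveSetFn.const_mul {Φ : Set ℝ → ℝ≥0∞} (h : SubadditiveSetFn Φ) (c : ℝ≥0∞) :
    SubadditiveSetFn (fun E => c * Φ E) where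
  mono hE := by
    have := h.mono hE
    gcongr
  iUnion_le hE := by
    rw [ENNReal.tsum_mul_left]
    gcongr
    exact h.iUnion_le hE

theorem subadditiveSetFn_mix {p q : ℝ≥0∞} {F : ℝ × ℝ → ℝ≥0∞} (hF : AEMeasurable F slabMeasure)
    (hp1 : 1 ≤ p) (hp : p ≠ ⊤) (hq : 1 ≤ q) : SubadditiveSetFn (fun E => mix q p E F) where
  mono hE := mix_mono_set hE F
  iUnion_le hE := mix_iUnion_le hF hE hp1 hp hq

namespace Setup

variable (𝓓 : Setup)

theorem measurableSet_Q (l : ℕ) (m : ℤ) : MeasurableSet (𝓓.Q l m) := measurableSet_Ico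

theorem mem_Q_iff {l : ℕ} {m : ℤ} {x : ℝ} :
    x ∈ 𝓓.Q l m ↔ ⌊(x - 𝓓.offset l) / 2 ^ l⌋ = m := by
  have h0 : (0 : ℝ) < 2 ^ l := by positivity
  rw [Int.floor_eq_iff, le_div_iff₀ h0, div_lt_iff₀ h0, Q, interval, mem_Ico]
  constructor <;> rintro ⟨h1, h2⟩ <;> constructor <;> linarith

theorem exists_mem_Q (l : ℕ) (x : ℝ) : ∃ m, x ∈ 𝓓.Q l m := ⟨_, 𝓓.mem_Q_iff.2 rfl⟩

theorem iUnion_Q (l : ℕ) : ⋃ m, 𝓓.Q l m = univ :=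
  eq_univ_of_forall fun x => mem_iUnion.2 (𝓓.exists_mem_Q l x)

theorem pairwise_disjoint_Q (l : ℕ) : Pairwise (fun m n => Disjoint (𝓓.Q l m) (𝓓.Q l n)) := by
  intro m n hmn
  rw [Set.disjoint_left]
  intro x hx hx'
  exact hmn ((𝓓.mem_Q_iff.1 hx).symm.trans (𝓓.mem_Q_iff.1 hx'))

/-- Three consecutive intervals of a partition, starting with the `n`-th. -/
def Q₃ (l : ℕ) (n : ℤ) : Set ℝ := ⋃ d : Fin 3, 𝓓.Q l (n + (d : ℕ))

theorem measurableSet_Q₃ (l : ℕ) (n : ℤ) : MeasurableSet (𝓓.Q₃ l n) :=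
  MeasurableSet.iUnion fun _ => 𝓓.measurableSet_Q _ _

theorem mem_Q₃ {l : ℕ} {n : ℤ} {x : ℝ} (h1 : 𝓓.offset l + n * 2 ^ l ≤ x)
    (h2 : x < 𝓓.offset l + (n + 3) * 2 ^ l) : x ∈ 𝓓.Q₃ l n := by
  have h0 : (0 : ℝ) < 2 ^ l := by positivity
  have h3 : n ≤ ⌊(x - 𝓓.offset l) / 2 ^ l⌋ := by
    rw [Int.le_floor, le_div_iff₀ h0]
    linarith
  have h4 : ⌊(x - 𝓓.offset l) / 2 ^ l⌋ < n + 3 := by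
    rw [Int.floor_lt, div_lt_iff₀ h0]
    push_cast
    linarith
  refine mem_iUnion.2 ⟨⟨(⌊(x - 𝓓.offset l) / 2 ^ l⌋ - n).toNat, by omega⟩, ?_⟩
  rw [mem_Q_iff]
  simp only
  omega

/-- The shift of the partition caused by subtracting elements of a block. -/
def shift (l j : ℕ) (r : ℤ) : ℤ := ⌊-(((r : ℝ) + 1) / 2 ^ j) / 2 ^ l⌋

/-- Blocks have length at most 1 and partition intervals at least 1. An interval minus a block is
therefore at most twice as long as an interval, and three consecutive intervals cover it. -/
theorem sub_mem_Q₃ {l j : ℕ} {r m : ℤ} {x z : ℝ} (hx : x ∈ 𝓓.Q l m) (hz : z ∈ block j r) :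
    x - z ∈ 𝓓.Q₃ l (m + shift l j r) := by
  have h0 : (1 : ℝ) ≤ 2 ^ l := one_le_pow₀ one_le_two
  have h0' : (0 : ℝ) < 2 ^ l := by positivity
  set b : ℝ := -(((r : ℝ) + 1) / 2 ^ j) with hb
  have h1 : (shift l j r : ℝ) * 2 ^ l ≤ b := by
    have := Int.floor_le (b / 2 ^ l)
    rwa [le_div_iff₀ h0'] at this
  have h2 : b < (shift l j r + 1) * 2 ^ l := by
    have := Int.lt_floor_add_one (b / 2 ^ l)
    rwa [div_lt_iff₀ h0'] at this
  have h3 : -((r : ℝ) / 2 ^ j) ≤ b + 1 := by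
    rw [hb, add_div]
    have : 1 / (2 : ℝ) ^ j ≤ 1 := by
      rw [div_le_one (by positivity)]
      exact one_le_pow₀ one_le_two
    linarith
  obtain ⟨hx1, hx2⟩ := hx
  obtain ⟨hz1, hz2⟩ := hz
  refine 𝓓.mem_Q₃ ?_ ?_
  · push_cast
    nlinarith
  · push_cast
    nlinarith

variable {𝓓}

theorem tsum_Q₃_le {Φ : Set ℝ → ℝ≥0∞} (h : SubadditiveSetFn Φ) (l : ℕ) (q : ℤ) :
    ∑' m, Φ (𝓓.Q₃ l (m + q)) ≤ 3 * ∑' m, Φ (𝓓.Q l m) := by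
  calc ∑' m, Φ (𝓓.Q₃ l (m + q)) ≤ ∑' m : ℤ, ∑ d : Fin 3, Φ (𝓓.Q l (m + q + (d : ℕ))) := by
        refine ENNReal.tsum_le_tsum fun m => ?_
        refine (h.iUnion_le fun d => 𝓓.measurableSet_Q _ _).trans ?_
        rw [tsum_fintype]
    _ = ∑ d : Fin 3, ∑' m : ℤ, Φ (𝓓.Q l (m + q + (d : ℕ))) :=
        Summable.tsum_finsetSum fun _ _ => ENNReal.summable
    _ = ∑ d : Fin 3, ∑' m : ℤ, Φ (𝓓.Q l m) := by
        refine Finset.sum_congr rfl fun d _ => ?_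
        have := (Equiv.addRight (q + (d : ℕ))).tsum_eq fun m => Φ (𝓓.Q l m)
        simpa [add_assoc] using this
    _ = _ := by simp

/-- After exchanging the sums, the translated sum over the partition is again the full sum. A
distant block costs only its coefficient, so summability of `c` is all the decay that is needed. -/
theorem tsum_le_of_shift {Φ : Set ℝ → ℝ≥0∞} (h : SubadditiveSetFn Φ) {Ψ : ℤ → ℝ≥0∞} {l j : ℕ}
    {κ : ℝ≥0∞} {c : ℤ → ℝ≥0∞}
    (hΨ : ∀ m, Ψ m ≤ κ * ∑' r, c r * Φ (𝓓.Q₃ l (m + shift l j r))) :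
    ∑' m, Ψ m ≤ 3 * κ * (∑' r, c r) * ∑' m, Φ (𝓓.Q l m) := by
  calc ∑' m, Ψ m ≤ ∑' m, κ * ∑' r, c r * Φ (𝓓.Q₃ l (m + shift l j r)) := ENNReal.tsum_le_tsum hΨ
    _ = κ * ∑' r, c r * ∑' m, Φ (𝓓.Q₃ l (m + shift l j r)) := by
        rw [ENNReal.tsum_mul_left, ENNReal.tsum_comm]
        simp_rw [ENNReal.tsum_mul_left]
    _ ≤ κ * ∑' r, c r * (3 * ∑' m, Φ (𝓓.Q l m)) := by
        gcongr with r
        exact tsum_Q₃_le h l _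
    _ = _ := by
        rw [ENNReal.tsum_mul_right]
        ring

/-- The number of intervals of length `2^l` that meet an interval of length `2^l'`. -/
def count (l l' : ℕ) : ℝ≥0∞ := 2 ^ l' / 2 ^ l + 2

theorem exists_finset_meet (l l' : ℕ) (n : ℤ) : ∃ s : Finset ℤ, (s.card : ℝ≥0∞) ≤ count l l' ∧
    ∀ m ∉ s, 𝓓.Q l' n ∩ 𝓓.Q l m = ∅ := by
  set A : ℝ := (𝓓.offset l' + n * 2 ^ l' - 𝓓.offset l) / 2 ^ l with hA
  set B : ℝ := (𝓓.offset l' + (n + 1) * 2 ^ l' - 𝓓.offset l) / 2 ^ l with hB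
  have hl : (0 : ℝ) < 2 ^ l := by positivity
  have hl' : (0 : ℝ) < 2 ^ l' := by positivity
  have hBA : B = A + 2 ^ l' / 2 ^ l := by
    rw [hA, hB, ← add_div]
    ring
  have hAB : ⌊A⌋ ≤ ⌊B⌋ := Int.floor_mono (by rw [hBA]; linarith [div_pos hl' hl])
  refine ⟨Finset.Icc ⌊A⌋ ⌊B⌋, ?_, fun m hm => ?_⟩
  · have h1 : ((Finset.Icc ⌊A⌋ ⌊B⌋).card : ℝ) ≤ 2 ^ l' / 2 ^ l + 2 := by
      rw [Int.card_Icc]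
      have : (((⌊B⌋ + 1 - ⌊A⌋).toNat : ℤ) : ℝ) = ⌊B⌋ + 1 - ⌊A⌋ := by
        rw [Int.toNat_of_nonneg (by omega)]
        push_cast
        ring
      rw [Int.cast_natCast] at this
      rw [this]
      linarith [Int.floor_le B, Int.lt_floor_add_one A]
    have h2 := ENNReal.ofReal_le_ofReal h1
    rw [ENNReal.ofReal_natCast, ENNReal.ofReal_add (by positivity) (by norm_num),
      ENNReal.ofReal_div_of_pos hl, ENNReal.ofReal_pow (by norm_num),
      ENNReal.ofReal_pow (by norm_num)] at h2
    simpa [count] using h2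
  · rw [Set.eq_empty_iff_forall_notMem]
    rintro x ⟨hx, hx'⟩
    refine hm ?_
    rw [mem_Q_iff] at hx'
    rw [← hx', Finset.mem_Icc]
    constructor
    · refine Int.floor_mono ?_
      rw [hA]
      gcongr
      exact hx.1
    · refine Int.floor_mono ?_
      rw [hB]
      gcongr
      exact hx.2.le

theorem tsum_inter_le {Φ : Set ℝ → ℝ≥0∞} (h : SubadditiveSetFn Φ) (l l' : ℕ) (n : ℤ) :
    ∑' m, Φ (𝓓.Q l' n ∩ 𝓓.Q l m) ≤ count l l' * Φ (𝓓.Q l' n) := by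
  obtain ⟨s, hs, hs'⟩ := exists_finset_meet (𝓓 := 𝓓) l l' n
  rw [tsum_eq_sum (s := s) fun m hm => by rw [hs' m hm, h.empty]]
  calc ∑ m ∈ s, Φ (𝓓.Q l' n ∩ 𝓓.Q l m) ≤ ∑ m ∈ s, Φ (𝓓.Q l' n) :=
        Finset.sum_le_sum fun m _ => h.mono inter_subset_left
    _ = s.card * Φ (𝓓.Q l' n) := by simp
    _ ≤ _ := by gcongr

theorem le_tsum_inter {Φ : Set ℝ → ℝ≥0∞} (h : SubadditiveSetFn Φ) {E : Set ℝ}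
    (hE : MeasurableSet E) (l : ℕ) : Φ E ≤ ∑' n, Φ (E ∩ 𝓓.Q l n) := by
  calc Φ E = Φ (⋃ n, E ∩ 𝓓.Q l n) := by rw [← inter_iUnion, iUnion_Q, inter_univ]
    _ ≤ _ := h.iUnion_le fun n => hE.inter (𝓓.measurableSet_Q _ _)

/-- Both partitions are refined to their common intersections, and an interval of length `2^l'`
falls into at most `count l l'` pieces. Only monotonicity and subadditivity enter, so `X` and
`L^∞L^2` are covered, at the full price of the count. -/
theorem tsum_Q_le {Φ : Set ℝ → ℝ≥0∞} (h : SubadditiveSetFn Φ) (l l' : ℕ) :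
    ∑' m, Φ (𝓓.Q l m) ≤ count l l' * ∑' n, Φ (𝓓.Q l' n) := by
  calc ∑' m, Φ (𝓓.Q l m) ≤ ∑' m, ∑' n, Φ (𝓓.Q l m ∩ 𝓓.Q l' n) :=
        ENNReal.tsum_le_tsum fun m => le_tsum_inter h (𝓓.measurableSet_Q _ _) l'
    _ = ∑' n, ∑' m, Φ (𝓓.Q l' n ∩ 𝓓.Q l m) := by
        rw [ENNReal.tsum_comm]
        simp_rw [inter_comm]
    _ ≤ ∑' n, count l l' * Φ (𝓓.Q l' n) := ENNReal.tsum_le_tsum fun n => tsum_inter_le h l l' n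
    _ = _ := ENNReal.tsum_mul_left

theorem le_tsum_Q {Φ : Set ℝ → ℝ≥0∞} (h : SubadditiveSetFn Φ) (l : ℕ) :
    Φ univ ≤ ∑' n, Φ (𝓓.Q l n) := by
  simpa using le_tsum_inter (𝓓 := 𝓓) h MeasurableSet.univ l

/-! ### Square summability over the pieces of an interval -/

theorem sum_le_sqrt_card {ι : Type*} (s : Finset ι) (f : ι → ℝ≥0∞) {N A : ℝ≥0∞}
    (hN : (s.card : ℝ≥0∞) ≤ N) (h : ∑ i ∈ s, f i ^ 2 ≤ A ^ 2) :
    ∑ i ∈ s, f i ≤ N ^ (1 / 2 : ℝ) * A := by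
  have h1 := ENNReal.inner_le_Lp_mul_Lq s (fun _ => 1) f Real.HolderConjugate.two_two
  simp only [one_mul, ENNReal.one_rpow, Finset.sum_const, nsmul_eq_mul, mul_one] at h1
  refine h1.trans ?_
  gcongr
  rw [one_div, ENNReal.rpow_inv_le_iff (by norm_num)]
  simpa using h

/-- Squares of `L^2` norms add up over disjoint pieces, so Cauchy-Schwarz over the pieces replaces
the count by its square root. -/
theorem tsum_eLpNorm_inter_le (l l' : ℕ) (n : ℤ) (g : ℝ → ℝ≥0∞) :
    ∑' m, eLpNorm g 2 (volume.restrict (𝓓.Q l' n ∩ 𝓓.Q l m)) ≤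
      count l l' ^ (1 / 2 : ℝ) * eLpNorm g 2 (volume.restrict (𝓓.Q l' n)) := by
  obtain ⟨s, hs, hs'⟩ := exists_finset_meet (𝓓 := 𝓓) l l' n
  rw [tsum_eq_sum (s := s) fun m hm => by rw [hs' m hm]; simp]
  refine sum_le_sqrt_card s _ hs ?_
  simp_rw [eLpNorm_two_sq]
  rw [← lintegral_biUnion_finset]
  · exact lintegral_mono_set (iUnion₂_subset fun m _ => inter_subset_left)
  · intro m _ m' _ hmm
    exact ((𝓓.pairwise_disjoint_Q l hmm).mono inter_subset_right inter_subset_right)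
  · exact fun m _ => (𝓓.measurableSet_Q _ _).inter (𝓓.measurableSet_Q _ _)

theorem tsum_mix_one_two_inter_le {F : ℝ × ℝ → ℝ≥0∞} (hF : AEMeasurable F slabMeasure)
    (l l' : ℕ) (n : ℤ) : ∑' m, mix 1 2 (𝓓.Q l' n ∩ 𝓓.Q l m) F ≤
      count l l' ^ (1 / 2 : ℝ) * mix 1 2 (𝓓.Q l' n) F := by
  have hm := fun m => aemeasurable_slice_norm hF two_ne_zero ENNReal.ofNat_ne_top
    (𝓓.Q l' n ∩ 𝓓.Q l m)
  simp only [mix, eLpNorm_one_eq]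
  rw [← lintegral_tsum hm, ← lintegral_const_mul'' _
    (aemeasurable_slice_norm hF two_ne_zero ENNReal.ofNat_ne_top _)]
  exact lintegral_mono fun t => tsum_eLpNorm_inter_le l l' n _

theorem tsum_mix_two_two_inter_le {F : ℝ × ℝ → ℝ≥0∞} (hF : AEMeasurable F slabMeasure)
    (l l' : ℕ) (n : ℤ) : ∑' m, mix 2 2 (𝓓.Q l' n ∩ 𝓓.Q l m) F ≤
      count l l' ^ (1 / 2 : ℝ) * mix 2 2 (𝓓.Q l' n) F := by
  obtain ⟨s, hs, hs'⟩ := exists_finset_meet (𝓓 := 𝓓) l l' n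
  rw [tsum_eq_sum (s := s) fun m hm => by
    rw [hs' m hm, (subadditiveSetFn_mix hF one_le_two ENNReal.ofNat_ne_top one_le_two).empty]]
  refine sum_le_sqrt_card s _ hs ?_
  simp_rw [mix_two_two_sq hF, timeMeasure_prod_restrict]
  rw [← lintegral_biUnion_finset]
  · refine lintegral_mono_set (iUnion₂_subset fun m _ => ?_)
    exact prod_mono le_rfl inter_subset_left
  · intro m _ m' _ hmm
    exact Disjoint.set_prod_right
      ((𝓓.pairwise_disjoint_Q l hmm).mono inter_subset_right inter_subset_right) _ _
  · exact fun m _ => measurableSet_Icc.prod ((𝓓.measurableSet_Q _ _).inter (𝓓.measurableSet_Q _ _))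

/-- With `L^1` in time the sum over pieces passes inside the time integral and the square root gain
is available at each time. With `L^∞` in time there is no such exchange, hence the different losses
for `Y_j` and `X_j` when the output frequency drops. -/
theorem tsum_mix_one_two_le {F : ℝ × ℝ → ℝ≥0∞} (hF : AEMeasurable F slabMeasure) (l l' : ℕ) :
    ∑' m, mix 1 2 (𝓓.Q l m) F ≤ count l l' ^ (1 / 2 : ℝ) * ∑' n, mix 1 2 (𝓓.Q l' n) F := by
  have h := subadditiveSetFn_mix hF one_le_two ENNReal.ofNat_ne_top (le_refl 1)
  calc ∑' m, mix 1 2 (𝓓.Q l m) F ≤ ∑' m, ∑' n, mix 1 2 (𝓓.Q l m ∩ 𝓓.Q l' n) F :=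
        ENNReal.tsum_le_tsum fun m => le_tsum_inter h (𝓓.measurableSet_Q _ _) l'
    _ = ∑' n, ∑' m, mix 1 2 (𝓓.Q l' n ∩ 𝓓.Q l m) F := by
        rw [ENNReal.tsum_comm]
        simp_rw [inter_comm]
    _ ≤ ∑' n, count l l' ^ (1 / 2 : ℝ) * mix 1 2 (𝓓.Q l' n) F :=
        ENNReal.tsum_le_tsum fun n => tsum_mix_one_two_inter_le hF l l' n
    _ = _ := ENNReal.tsum_mul_left

end Setup

end BilEst

end

/-! ### The local energy norm, convolutions, and smooth against sharp cutoffs. -/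

noncomputable section

namespace BilEst

open Filter Topology SchwartzMap

namespace Setup

variable (𝓓 : Setup)

/-- The coefficients dominating the Littlewood-Paley kernels on blocks. -/
def blockCoeff : ℤ → ℝ≥0∞ := 𝓓.exists_block_bound.choose

/-- The sum of the coefficients dominating the Littlewood-Paley kernels. -/
def kerConst : ℝ≥0∞ := ∑' r, 𝓓.blockCoeff r

theorem kerConst_ne_top : 𝓓.kerConst ≠ ⊤ := 𝓓.exists_block_bound.choose_spec.1

theorem blockCoeff_ne_top (r : ℤ) : 𝓓.blockCoeff r ≠ ⊤ :=
  ne_top_of_le_ne_top 𝓓.kerConst_ne_top (ENNReal.le_tsum r)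

theorem blockBound_low (j : ℕ) : BlockBound 𝓓.blockCoeff j (𝓓.low j) :=
  𝓓.exists_block_bound.choose_spec.2.1 j

theorem blockBound_ker (j : ℕ) : BlockBound 𝓓.blockCoeff j (𝓓.ker j) :=
  𝓓.exists_block_bound.choose_spec.2.2 j

/-- The local energy norm of `F` over `[0,1] × E`. -/
def xn (E : Set ℝ) (F : ℝ × ℝ → ℝ≥0∞) : ℝ≥0∞ :=
  ⨆ (l : ℕ) (m : ℤ), (2 : ℝ≥0∞) ^ (-(l : ℝ) / 2) * mix 2 2 (E ∩ 𝓓.Q l m) F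

variable {𝓓}

theorem le_xn (E : Set ℝ) (F : ℝ × ℝ → ℝ≥0∞) (l : ℕ) (m : ℤ) :
    (2 : ℝ≥0∞) ^ (-(l : ℝ) / 2) * mix 2 2 (E ∩ 𝓓.Q l m) F ≤ 𝓓.xn E F :=
  le_iSup₂ (f := fun (l : ℕ) (m : ℤ) =>
    (2 : ℝ≥0∞) ^ (-(l : ℝ) / 2) * mix 2 2 (E ∩ 𝓓.Q l m) F) l m

theorem normX_eq_xn {u : ℝ × ℝ → ℂ} (hu : AEStronglyMeasurable u slabMeasure) :
    𝓓.normX u = 𝓓.xn univ (fun z => ‖u z‖ₑ) := by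
  simp only [normX, xn, univ_inter, eLpNorm_two_eq_mix hu]

theorem xn_mono {E : Set ℝ} {F G : ℝ × ℝ → ℝ≥0∞} (h : ∀ z, F z ≤ G z) :
    𝓓.xn E F ≤ 𝓓.xn E G :=
  iSup₂_mono fun l m => by
    have := mix_mono (q := 2) (p := 2) (E := E ∩ 𝓓.Q l m) h
    gcongr

theorem xn_congr_ae {E : Set ℝ} {F G : ℝ × ℝ → ℝ≥0∞} (h : ∀ᵐ z ∂slabMeasure, F z = G z) :
    𝓓.xn E F = 𝓓.xn E G := by
  simp only [xn, mix_congr_ae h]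

theorem subadditiveSetFn_xn {F : ℝ × ℝ → ℝ≥0∞} (hF : AEMeasurable F slabMeasure) :
    SubadditiveSetFn (fun E => 𝓓.xn E F) where
  mono {E E'} hE := iSup₂_mono fun l m => by
    have := mix_mono_set (q := 2) (p := 2) (inter_subset_inter_left (𝓓.Q l m) hE) F
    gcongr
  iUnion_le {ι _ E} hE := by
    refine iSup₂_le fun l m => ?_
    rw [iUnion_inter]
    calc _ ≤ (2 : ℝ≥0∞) ^ (-(l : ℝ) / 2) * ∑' i, mix 2 2 (E i ∩ 𝓓.Q l m) F := by
          gcongr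
          exact mix_iUnion_le hF (fun i => (hE i).inter (𝓓.measurableSet_Q _ _)) one_le_two
            ENNReal.ofNat_ne_top one_le_two
      _ = ∑' i, (2 : ℝ≥0∞) ^ (-(l : ℝ) / 2) * mix 2 2 (E i ∩ 𝓓.Q l m) F :=
          ENNReal.tsum_mul_left.symm
      _ ≤ _ := ENNReal.tsum_le_tsum fun i => le_xn _ _ l m

theorem xn_tsum_le {ι : Type*} [Countable ι] {E : Set ℝ} {F : ι → ℝ × ℝ → ℝ≥0∞}
    (hF : ∀ i, AEMeasurable (F i) slabMeasure) :
    𝓓.xn E (fun z => ∑' i, F i z) ≤ ∑' i, 𝓓.xn E (F i) := by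
  refine iSup₂_le fun l m => ?_
  calc _ ≤ (2 : ℝ≥0∞) ^ (-(l : ℝ) / 2) * ∑' i, mix 2 2 (E ∩ 𝓓.Q l m) (F i) := by
        gcongr
        exact mix_tsum_le hF one_le_two ENNReal.ofNat_ne_top one_le_two
    _ = ∑' i, (2 : ℝ≥0∞) ^ (-(l : ℝ) / 2) * mix 2 2 (E ∩ 𝓓.Q l m) (F i) :=
        ENNReal.tsum_mul_left.symm
    _ ≤ _ := ENNReal.tsum_le_tsum fun i => le_xn _ _ l m

theorem xn_mul_le_top_mul {E : Set ℝ} {F G : ℝ × ℝ → ℝ≥0∞} (h : mix ⊤ ⊤ E F ≠ ⊤) :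
    𝓓.xn E (fun z => F z * G z) ≤ mix ⊤ ⊤ E F * 𝓓.xn E G := by
  refine iSup₂_le fun l m => ?_
  have hm : mix ⊤ ⊤ (E ∩ 𝓓.Q l m) F ≤ mix ⊤ ⊤ E F := mix_mono_set inter_subset_left F
  calc _ ≤ (2 : ℝ≥0∞) ^ (-(l : ℝ) / 2) *
        (mix ⊤ ⊤ (E ∩ 𝓓.Q l m) F * mix 2 2 (E ∩ 𝓓.Q l m) G) := by
        gcongr
        exact mix_mul_le_top_mul (ne_top_of_le_ne_top h hm)
    _ ≤ (2 : ℝ≥0∞) ^ (-(l : ℝ) / 2) * (mix ⊤ ⊤ E F * mix 2 2 (E ∩ 𝓓.Q l m) G) := by gcongr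
    _ = mix ⊤ ⊤ E F * ((2 : ℝ≥0∞) ^ (-(l : ℝ) / 2) * mix 2 2 (E ∩ 𝓓.Q l m) G) := by ring
    _ ≤ _ := by
        gcongr
        exact le_xn _ _ l m

/-! ### Convolutions -/

theorem tsum_mix_convt_le {p p' q : ℝ≥0∞} {κ : ℕ → ℝ≥0∞} (hA : AvgBound p p' κ) (hp1 : 1 ≤ p)
    (hp : p ≠ ⊤) (hp' : 1 ≤ p') (hq : 1 ≤ q) {j : ℕ} (hκ : κ j ≠ ⊤) {K : 𝓢(ℝ, ℂ)}
    (hK : BlockBound 𝓓.blockCoeff j K) {u : ℝ × ℝ → ℂ} (hu : AEStronglyMeasurable u slabMeasure)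
    (l : ℕ) : ∑' m, mix q p' (𝓓.Q l m) (fun z => ‖convt K u z‖ₑ) ≤
      3 * κ j * 𝓓.kerConst * ∑' m, mix q p (𝓓.Q l m) (fun z => ‖u z‖ₑ) :=
  tsum_le_of_shift (subadditiveSetFn_mix hu.enorm hp1 hp hq) fun m =>
    mix_convt_le hA hp1 hp hp' hq 𝓓.blockCoeff_ne_top hκ hK hu (𝓓.measurableSet_Q l m)
      (fun _ => 𝓓.measurableSet_Q₃ l _) fun _ _ hx _ hz => 𝓓.sub_mem_Q₃ hx hz

/-- The partition interval and the test interval of the `X` norm are moved by the same block, so the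
convolution sees the intersection of their two enlargements. Splitting the enlarged test interval
into its three parts gives the factor 3. -/
theorem xn_convt_le {j : ℕ} {K : 𝓢(ℝ, ℂ)} (hK : BlockBound 𝓓.blockCoeff j K) {u : ℝ × ℝ → ℂ}
    (hu : AEStronglyMeasurable u slabMeasure) (l : ℕ) (m : ℤ) :
    𝓓.xn (𝓓.Q l m) (fun z => ‖convt K u z‖ₑ) ≤ 1 * ∑' r, 𝓓.blockCoeff r *
      (3 * 𝓓.xn (𝓓.Q₃ l (m + shift l j r)) (fun z => ‖u z‖ₑ)) := by
  refine iSup₂_le fun l' m' => ?_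
  have h1 := mix_convt_le (q := 2) avgBound_two_two one_le_two ENNReal.ofNat_ne_top one_le_two
    one_le_two 𝓓.blockCoeff_ne_top ENNReal.one_ne_top hK hu
    (E := 𝓓.Q l m ∩ 𝓓.Q l' m')
    (E' := fun r => 𝓓.Q₃ l (m + shift l j r) ∩ 𝓓.Q₃ l' (m' + shift l' j r))
    ((𝓓.measurableSet_Q l m).inter (𝓓.measurableSet_Q l' m'))
    (fun _ => (𝓓.measurableSet_Q₃ l _).inter (𝓓.measurableSet_Q₃ l' _))
    fun _ _ hx _ hz => ⟨𝓓.sub_mem_Q₃ hx.1 hz, 𝓓.sub_mem_Q₃ hx.2 hz⟩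
  have h2 : ∀ (E : Set ℝ) (n : ℤ), MeasurableSet E → (2 : ℝ≥0∞) ^ (-(l' : ℝ) / 2) *
      mix 2 2 (E ∩ 𝓓.Q₃ l' n) (fun z => ‖u z‖ₑ) ≤ 3 * 𝓓.xn E (fun z => ‖u z‖ₑ) := by
    intro E n hE
    calc _ ≤ (2 : ℝ≥0∞) ^ (-(l' : ℝ) / 2) *
          ∑' d : Fin 3, mix 2 2 (E ∩ 𝓓.Q l' (n + (d : ℕ))) (fun z => ‖u z‖ₑ) := by
          gcongr
          rw [Q₃, inter_iUnion]
          exact mix_iUnion_le hu.enorm (fun i => hE.inter (𝓓.measurableSet_Q _ _)) one_le_two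
            ENNReal.ofNat_ne_top one_le_two
      _ = ∑' d : Fin 3, (2 : ℝ≥0∞) ^ (-(l' : ℝ) / 2) *
          mix 2 2 (E ∩ 𝓓.Q l' (n + (d : ℕ))) (fun z => ‖u z‖ₑ) := ENNReal.tsum_mul_left.symm
      _ ≤ ∑' d : Fin 3, 𝓓.xn E (fun z => ‖u z‖ₑ) :=
          ENNReal.tsum_le_tsum fun d => le_xn _ _ _ _
      _ = _ := by simp
  calc _ ≤ (2 : ℝ≥0∞) ^ (-(l' : ℝ) / 2) * (1 * ∑' r, 𝓓.blockCoeff r *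
        mix 2 2 (𝓓.Q₃ l (m + shift l j r) ∩ 𝓓.Q₃ l' (m' + shift l' j r)) (fun z => ‖u z‖ₑ)) := by
        gcongr
    _ = 1 * ∑' r, 𝓓.blockCoeff r * ((2 : ℝ≥0∞) ^ (-(l' : ℝ) / 2) *
        mix 2 2 (𝓓.Q₃ l (m + shift l j r) ∩ 𝓓.Q₃ l' (m' + shift l' j r)) (fun z => ‖u z‖ₑ)) := by
        rw [mul_left_comm, ← ENNReal.tsum_mul_left]
        congr 2
        ext r
        ring
    _ ≤ _ := by
        refine mul_le_mul' le_rfl (ENNReal.tsum_le_tsum fun r => mul_le_mul' le_rfl ?_)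
        exact h2 _ _ (𝓓.measurableSet_Q₃ l _)

theorem tsum_xn_convt_le {j : ℕ} {K : 𝓢(ℝ, ℂ)} (hK : BlockBound 𝓓.blockCoeff j K) {u : ℝ × ℝ → ℂ}
    (hu : AEStronglyMeasurable u slabMeasure) (l : ℕ) :
    ∑' m, 𝓓.xn (𝓓.Q l m) (fun z => ‖convt K u z‖ₑ) ≤
      9 * 𝓓.kerConst * ∑' m, 𝓓.xn (𝓓.Q l m) (fun z => ‖u z‖ₑ) := by
  refine (tsum_le_of_shift ((subadditiveSetFn_xn hu.enorm).const_mul 3)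
    fun m => xn_convt_le hK hu l m).trans ?_
  rw [ENNReal.tsum_mul_left, ← kerConst]
  apply le_of_eq
  ring

/-! ### Smooth and sharp cutoffs -/

theorem χ_le_one (j : ℕ) (m : ℤ) (x : ℝ) : 𝓓.χ j m x ≤ 1 :=
  le_hasSum (𝓓.χ_sum j x) m fun n _ => 𝓓.χ_nonneg j n x

/-- The cutoff reaches at most `1/2` beyond an interval of length at least 1, hence only into its
two neighbours; this explains the index `m - 1`. -/
theorem mem_Q₃_of_χ_ne_zero {j : ℕ} {m : ℤ} {x : ℝ} (h : 𝓓.χ j m x ≠ 0) :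
    x ∈ 𝓓.Q₃ (2 * j) (m - 1) := by
  have h1 := 𝓓.χ_supp j m (subset_tsupport _ h)
  obtain ⟨y, hy, hxy⟩ := Metric.mem_thickening_iff.1 h1
  rw [Real.dist_eq, abs_lt] at hxy
  have h0 : (1 : ℝ) ≤ 2 ^ (2 * j) := one_le_pow₀ one_le_two
  obtain ⟨hy1, hy2⟩ := hy
  refine 𝓓.mem_Q₃ ?_ ?_ <;> push_cast <;> nlinarith

theorem enorm_χ_mul_le (j : ℕ) (m : ℤ) (x : ℝ) (w : ℂ) :
    ‖(𝓓.χ j m x : ℂ) * w‖ₑ ≤ (𝓓.Q₃ (2 * j) (m - 1)).indicator 1 x * ‖w‖ₑ := by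
  by_cases h : 𝓓.χ j m x = 0
  · simp [h]
  · rw [indicator_of_mem (mem_Q₃_of_χ_ne_zero h), enorm_mul]
    gcongr
    rw [← ofReal_norm, Complex.norm_real, Real.norm_of_nonneg (𝓓.χ_nonneg _ _ _)]
    simpa using χ_le_one j m x

theorem measurable_χ (j : ℕ) (m : ℤ) : Measurable fun x => (𝓓.χ j m x : ℂ) :=
  Complex.measurable_ofReal.comp (𝓓.χ_smooth j m).continuous.measurable

theorem aestronglyMeasurable_χ_mul {u : ℝ × ℝ → ℂ} (hu : AEStronglyMeasurable u slabMeasure)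
    (j : ℕ) (m : ℤ) : AEStronglyMeasurable (fun z => (𝓓.χ j m z.2 : ℂ) * u z) slabMeasure :=
  ((measurable_χ j m).comp measurable_snd).aestronglyMeasurable.mul hu

theorem xn_indicator_le {E E' : Set ℝ} (hE : MeasurableSet E) (F : ℝ × ℝ → ℝ≥0∞) :
    𝓓.xn E' (fun z => E.indicator 1 z.2 * F z) ≤ 𝓓.xn (E' ∩ E) F := by
  refine iSup₂_mono fun l m => ?_
  gcongr
  have h : ∀ t, eLpNorm (fun x => E.indicator (1 : ℝ → ℝ≥0∞) x * F (t, x)) 2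
      (volume.restrict (E' ∩ 𝓓.Q l m)) =
      eLpNorm (fun x => F (t, x)) 2 (volume.restrict (E' ∩ E ∩ 𝓓.Q l m)) := by
    intro t
    have h1 : (fun x => E.indicator (1 : ℝ → ℝ≥0∞) x * F (t, x)) =
        E.indicator fun x => F (t, x) := by
      ext x
      by_cases hx : x ∈ E <;> simp [hx]
    rw [h1, eLpNorm_indicator_eq_eLpNorm_restrict hE, Measure.restrict_restrict hE]
    congr 2
    ext x
    simp only [mem_inter_iff]
    tauto
  simp only [mix, h]
  exact le_rfl

theorem tsum_mix_χ_le {p q : ℝ≥0∞} (hp1 : 1 ≤ p) (hp : p ≠ ⊤) (hq : 1 ≤ q) {u : ℝ × ℝ → ℂ}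
    (hu : AEStronglyMeasurable u slabMeasure) (j : ℕ) :
    ∑' m, mix q p univ (fun z => ‖(𝓓.χ j m z.2 : ℂ) * u z‖ₑ) ≤
      3 * ∑' m, mix q p (𝓓.Q (2 * j) m) (fun z => ‖u z‖ₑ) := by
  refine le_trans (ENNReal.tsum_le_tsum fun m => ?_)
    (tsum_Q₃_le (subadditiveSetFn_mix hu.enorm hp1 hp hq) (2 * j) (-1))
  rw [← mix_indicator (𝓓.measurableSet_Q₃ _ _)]
  exact mix_mono fun z => enorm_χ_mul_le j m z.2 (u z)

theorem tsum_xn_χ_le {u : ℝ × ℝ → ℂ} (hu : AEStronglyMeasurable u slabMeasure) (j : ℕ) :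
    ∑' m, 𝓓.xn univ (fun z => ‖(𝓓.χ j m z.2 : ℂ) * u z‖ₑ) ≤
      3 * ∑' m, 𝓓.xn (𝓓.Q (2 * j) m) (fun z => ‖u z‖ₑ) := by
  refine le_trans (ENNReal.tsum_le_tsum fun m => ?_)
    (tsum_Q₃_le (subadditiveSetFn_xn hu.enorm) (2 * j) (-1))
  have h := xn_indicator_le (𝓓 := 𝓓) (E' := univ) (𝓓.measurableSet_Q₃ (2 * j) (m - 1))
    (fun z => ‖u z‖ₑ)
  rw [univ_inter] at h
  exact (xn_mono fun z => enorm_χ_mul_le j m z.2 (u z)).trans h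

theorem l1_normXj_le {u : ℝ × ℝ → ℂ} (hu : AEStronglyMeasurable u slabMeasure) (j : ℕ) :
    𝓓.l1 j (𝓓.normXj j) u ≤ 3 * (2 ^ j * ∑' m, 𝓓.xn (𝓓.Q (2 * j) m) (fun z => ‖u z‖ₑ) +
      ∑' m, mix ⊤ 2 (𝓓.Q (2 * j) m) (fun z => ‖u z‖ₑ)) := by
  have h : ∀ m, 𝓓.normXj j (fun z => (𝓓.χ j m z.2 : ℂ) * u z) =
      2 ^ j * 𝓓.xn univ (fun z => ‖(𝓓.χ j m z.2 : ℂ) * u z‖ₑ) +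
        mix ⊤ 2 univ (fun z => ‖(𝓓.χ j m z.2 : ℂ) * u z‖ₑ) := fun m => by
    rw [normXj, normX_eq_xn (aestronglyMeasurable_χ_mul hu j m), normLinfL2_eq_mix]
  simp only [l1, h]
  rw [ENNReal.tsum_add, ENNReal.tsum_mul_left, mul_add, mul_left_comm]
  gcongr
  · exact tsum_xn_χ_le hu j
  · exact tsum_mix_χ_le one_le_two ENNReal.ofNat_ne_top le_top hu j

theorem l1_normL1L2_le {u : ℝ × ℝ → ℂ} (hu : AEStronglyMeasurable u slabMeasure) (j : ℕ) :
    𝓓.l1 j normL1L2 u ≤ 3 * ∑' m, mix 1 2 (𝓓.Q (2 * j) m) (fun z => ‖u z‖ₑ) := by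
  simp only [l1, normL1L2_eq_mix]
  exact tsum_mix_χ_le one_le_two ENNReal.ofNat_ne_top le_rfl hu j

variable (𝓓)

/-- The inverse of the lower bound for the cutoffs. -/
def cutoffConst : ℝ := (𝓓.χ_lower.choose)⁻¹

theorem cutoffConst_pos : 0 < 𝓓.cutoffConst := inv_pos.2 𝓓.χ_lower.choose_spec.1

variable {𝓓}

theorem one_le_cutoffConst_mul_χ {j : ℕ} {m : ℤ} {x : ℝ} (hx : x ∈ 𝓓.Q (2 * j) m) :
    1 ≤ 𝓓.cutoffConst * 𝓓.χ j m x := by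
  have h := 𝓓.χ_lower.choose_spec.2 j m x hx
  rw [cutoffConst, inv_mul_eq_div, one_le_div 𝓓.χ_lower.choose_spec.1]
  exact h

theorem indicator_mul_le (j : ℕ) (m : ℤ) (x : ℝ) (w : ℂ) :
    (𝓓.Q (2 * j) m).indicator 1 x * ‖w‖ₑ ≤
      ENNReal.ofReal 𝓓.cutoffConst * ‖(𝓓.χ j m x : ℂ) * w‖ₑ := by
  by_cases hx : x ∈ 𝓓.Q (2 * j) m
  · rw [indicator_of_mem hx, enorm_mul, ← mul_assoc]
    gcongr
    rw [← ofReal_norm, Complex.norm_real, Real.norm_of_nonneg (𝓓.χ_nonneg _ _ _),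
      ← ENNReal.ofReal_mul 𝓓.cutoffConst_pos.le]
    simpa using one_le_cutoffConst_mul_χ hx
  · simp [hx]

theorem mix_Q_le_χ {p q : ℝ≥0∞} (u : ℝ × ℝ → ℂ) (j : ℕ) (m : ℤ) :
    mix q p (𝓓.Q (2 * j) m) (fun z => ‖u z‖ₑ) ≤ ENNReal.ofReal 𝓓.cutoffConst *
      mix q p univ (fun z => ‖(𝓓.χ j m z.2 : ℂ) * u z‖ₑ) := by
  rw [← mix_indicator (𝓓.measurableSet_Q _ _)]
  exact (mix_mono fun z => indicator_mul_le j m z.2 (u z)).trans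
    (mix_const_mul_le _ ENNReal.ofReal_ne_top _)

theorem xn_Q_le_χ (u : ℝ × ℝ → ℂ) (j : ℕ) (m : ℤ) :
    𝓓.xn (𝓓.Q (2 * j) m) (fun z => ‖u z‖ₑ) ≤ ENNReal.ofReal 𝓓.cutoffConst *
      𝓓.xn univ (fun z => ‖(𝓓.χ j m z.2 : ℂ) * u z‖ₑ) := by
  refine iSup₂_le fun l n => ?_
  calc _ ≤ (2 : ℝ≥0∞) ^ (-(l : ℝ) / 2) * (ENNReal.ofReal 𝓓.cutoffConst *
        mix 2 2 (univ ∩ 𝓓.Q l n) (fun z => ‖(𝓓.χ j m z.2 : ℂ) * u z‖ₑ)) := by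
        gcongr
        refine le_trans ?_ (mix_const_mul_le _ ENNReal.ofReal_ne_top _)
        have h1 : mix 2 2 (𝓓.Q (2 * j) m ∩ 𝓓.Q l n) (fun z => ‖u z‖ₑ) ≤
            mix 2 2 (univ ∩ 𝓓.Q l n)
              (fun z => (𝓓.Q (2 * j) m).indicator 1 z.2 * ‖u z‖ₑ) := by
          rw [← mix_indicator ((𝓓.measurableSet_Q _ _).inter (𝓓.measurableSet_Q _ _)),
            ← mix_indicator (MeasurableSet.univ.inter (𝓓.measurableSet_Q _ _))]
          refine mix_mono fun z => ?_
          by_cases h2 : z.2 ∈ 𝓓.Q (2 * j) m <;> by_cases h3 : z.2 ∈ 𝓓.Q l n <;> simp [h2, h3]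
        exact h1.trans (mix_mono fun z => indicator_mul_le j m z.2 (u z))
    _ = ENNReal.ofReal 𝓓.cutoffConst * ((2 : ℝ≥0∞) ^ (-(l : ℝ) / 2) *
        mix 2 2 (univ ∩ 𝓓.Q l n) (fun z => ‖(𝓓.χ j m z.2 : ℂ) * u z‖ₑ)) := by ring
    _ ≤ _ := by
        gcongr
        exact le_xn _ _ l n

theorem sharp_le_l1_normXj {u : ℝ × ℝ → ℂ} (hu : AEStronglyMeasurable u slabMeasure) (j : ℕ) :
    2 ^ j * ∑' m, 𝓓.xn (𝓓.Q (2 * j) m) (fun z => ‖u z‖ₑ) +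
      ∑' m, mix ⊤ 2 (𝓓.Q (2 * j) m) (fun z => ‖u z‖ₑ) ≤
    ENNReal.ofReal 𝓓.cutoffConst * 𝓓.l1 j (𝓓.normXj j) u := by
  rw [l1, ← ENNReal.tsum_mul_left, ← ENNReal.tsum_add, ← ENNReal.tsum_mul_left]
  refine ENNReal.tsum_le_tsum fun m => ?_
  rw [normXj, normX_eq_xn (aestronglyMeasurable_χ_mul hu j m), normLinfL2_eq_mix, mul_add,
    mul_left_comm]
  gcongr
  · exact xn_Q_le_χ u j m
  · exact mix_Q_le_χ u j m

theorem sharp_le_l1_normL1L2 (u : ℝ × ℝ → ℂ) (j : ℕ) :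
    ∑' m, mix 1 2 (𝓓.Q (2 * j) m) (fun z => ‖u z‖ₑ) ≤
    ENNReal.ofReal 𝓓.cutoffConst * 𝓓.l1 j normL1L2 u := by
  rw [l1, ← ENNReal.tsum_mul_left]
  refine ENNReal.tsum_le_tsum fun m => ?_
  rw [normL1L2_eq_mix]
  exact mix_Q_le_χ u j m

/-- The time interval has measure one, so integrating a constant over it changes nothing. This lets
`l^1 H^s` be handled by the space-time estimates. -/
theorem l1L2_eq_l1 (j : ℕ) (a : ℝ → ℂ) : 𝓓.l1L2 j a = 𝓓.l1 j normL1L2 (fun z => a z.2) := by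
  simp only [l1L2, l1, normL1L2_eq_mix]
  congr 1
  ext m
  have := mix_comp_snd (q := 1) (p := 2) (E := univ) one_ne_zero
    (fun x => ‖(𝓓.χ j m x : ℂ) * a x‖ₑ)
  rw [this, Measure.restrict_univ, eLpNorm_enorm (fun x => (𝓓.χ j m x : ℂ) * a x)]

end Setup

end BilEst

end

/-! ### Almost everywhere convergence and the atomic norm. -/

noncomputable section

namespace BilEst

open Filter Topology SchwartzMap

theorem two_rpow_add (x y : ℝ) : (2 : ℝ≥0∞) ^ (x + y) = 2 ^ x * 2 ^ y :=
  ENNReal.rpow_add x y two_ne_zero ENNReal.ofNat_ne_top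

theorem two_rpow_le_two_rpow {x y : ℝ} (h : x ≤ y) : (2 : ℝ≥0∞) ^ x ≤ 2 ^ y :=
  ENNReal.rpow_le_rpow_of_exponent_le one_le_two h

theorem two_rpow_ne_top (x : ℝ) : (2 : ℝ≥0∞) ^ x ≠ ⊤ :=
  ENNReal.rpow_ne_top_of_ne_zero two_ne_zero ENNReal.ofNat_ne_top

theorem two_rpow_ne_zero (x : ℝ) : (2 : ℝ≥0∞) ^ x ≠ 0 :=
  (ENNReal.rpow_pos two_pos ENNReal.ofNat_ne_top).ne'

theorem two_pow_eq_rpow (n : ℕ) : (2 : ℝ≥0∞) ^ n = 2 ^ (n : ℝ) := (ENNReal.rpow_natCast 2 n).symm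

theorem two_rpow_neg_mul_self (x : ℝ) : (2 : ℝ≥0∞) ^ (-x) * 2 ^ x = 1 := by
  rw [← two_rpow_add, neg_add_cancel, ENNReal.rpow_zero]

/-! ### Almost everywhere convergence -/

theorem ae_lt_top_of_mix {G : ℝ × ℝ → ℝ≥0∞} (hG : AEMeasurable G slabMeasure) {E : Set ℝ}
    (hE : MeasurableSet E) (h : mix 1 2 E G ≠ ⊤) :
    ∀ᵐ z ∂slabMeasure, z.2 ∈ E → G z < ⊤ := by
  have h1 : ∀ᵐ t ∂timeMeasure, eLpNorm (fun x => G (t, x)) 2 (volume.restrict E) < ⊤ := by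
    rw [mix, eLpNorm_one_eq] at h
    exact ae_lt_top' (aemeasurable_slice_norm hG two_ne_zero ENNReal.ofNat_ne_top E) h
  have h2 : ∀ᵐ t ∂timeMeasure, ∀ᵐ x, x ∈ E → G (t, x) < ⊤ := by
    filter_upwards [h1, slice_aemeasurable hG] with t ht hm
    rw [← ae_restrict_iff'₀ hE.nullMeasurableSet]
    have h3 : ∫⁻ x in E, G (t, x) ^ 2 ≠ ⊤ := by
      rw [← eLpNorm_two_sq]
      exact ENNReal.pow_ne_top ht.ne
    filter_upwards [ae_lt_top' (hm.restrict.pow_const 2) h3] with x hx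
    by_contra hcon
    rw [not_lt, top_le_iff] at hcon
    simp [hcon] at hx
  -- An iterated almost everywhere statement gives one for the product measure only for a measurable
  -- set, hence the passage to a measurable representative.
  have hmk := hG.ae_eq_mk
  have h3 : ∀ᵐ t ∂timeMeasure, ∀ᵐ x, (t, x) ∈ {z : ℝ × ℝ | z.2 ∈ E → hG.mk G z < ⊤} := by
    filter_upwards [h2, Measure.ae_ae_of_ae_prod hmk] with t ht ht'
    filter_upwards [ht, ht'] with x hx hx' hxE
    rw [← hx']
    exact hx hxE
  have hms : MeasurableSet {z : ℝ × ℝ | z.2 ∈ E → hG.mk G z < ⊤} := by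
    have hA : MeasurableSet {z : ℝ × ℝ | z.2 ∈ E} := measurable_snd hE
    have hB : MeasurableSet {z : ℝ × ℝ | hG.mk G z < ⊤} := hG.measurable_mk measurableSet_Iio
    exact hA.imp hB
  have h4 := (Measure.ae_prod_mem_iff_ae_ae_mem (μ := timeMeasure) (ν := volume) hms).2 h3
  filter_upwards [h4, hmk] with z hz hz' hzE
  rw [hz']
  exact hz hzE

theorem ae_tsum_lt_top {ι : Type*} [Countable ι] {F : ι → ℝ × ℝ → ℝ≥0∞}
    (hF : ∀ i, AEMeasurable (F i) slabMeasure) {E : Set ℝ} (hE : MeasurableSet E)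
    (h : ∑' i, mix 1 2 E (F i) ≠ ⊤) : ∀ᵐ z ∂slabMeasure, z.2 ∈ E → ∑' i, F i z < ⊤ :=
  ae_lt_top_of_mix (AEMeasurable.tsum hF) hE (ne_top_of_le_ne_top h
    (mix_tsum_le hF one_le_two ENNReal.ofNat_ne_top le_rfl))

theorem summable_of_tsum_enorm_lt_top {ι : Type*} {f : ι → ℂ} (h : ∑' i, ‖f i‖ₑ < ⊤) :
    Summable f := by
  refine Summable.of_nnnorm ?_
  rw [← ENNReal.tsum_coe_ne_top_iff_summable]
  exact h.ne

theorem slabMeasure_le : slabMeasure ≤ volume := by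
  rw [← restrict_slab]
  exact Measure.restrict_le_self

theorem measurableSet_slab : MeasurableSet slab := measurableSet_Icc.prod MeasurableSet.univ

namespace Setup

variable {𝓓 : Setup}

/-! ### Atoms -/

theorem IsAtom.aestronglyMeasurable {A : ℝ × ℝ → ℂ} (hA : 𝓓.IsAtom A) :
    AEStronglyMeasurable A slabMeasure := by
  obtain ⟨_, _, h, -, -⟩ := hA
  exact h.mono_measure slabMeasure_le

theorem IsAtom.eq_zero_of_notMem {A : ℝ × ℝ → ℂ} (hA : 𝓓.IsAtom A) {z : ℝ × ℝ} (hz : z ∉ slab) :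
    A z = 0 := by
  obtain ⟨_, _, -, h, -⟩ := hA
  by_contra hne
  exact hz ⟨(h hne).1, mem_univ _⟩

theorem isAtom_zero : 𝓓.IsAtom (fun _ => 0) :=
  ⟨0, 0, aestronglyMeasurable_const, by simp, by simp⟩

/-- All scales `l` are nonnegative, so the normalisation `2^(-l/2)` never exceeds 1. Consequently
`Y` embeds into `L^2` of the slab, which supplies the convergence of atomic series. -/
theorem mix_atom_le {A : ℝ × ℝ → ℂ} (hA : 𝓓.IsAtom A) :
    mix 2 2 univ (fun z => ‖A z‖ₑ) ≤ 1 := by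
  obtain ⟨l, m, hm, -, hn⟩ := id hA
  rw [← eLpNorm_two_eq_mix hA.aestronglyMeasurable]
  refine (eLpNorm_mono_measure _ Measure.restrict_le_self).trans (hn.trans ?_)
  rw [← ENNReal.rpow_zero (x := 2)]
  refine two_rpow_le_two_rpow ?_
  have : (0 : ℝ) ≤ l := l.cast_nonneg
  linarith

theorem IsAtom.mul {A θ : ℝ × ℝ → ℂ} (hA : 𝓓.IsAtom A) (hθ : AEStronglyMeasurable θ slabMeasure)
    (hb : ∀ᵐ z ∂slabMeasure, ‖θ z‖ₑ ≤ 1) : 𝓓.IsAtom (fun z => θ z * A z) := by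
  have hzero := fun {z} => hA.eq_zero_of_notMem (z := z)
  -- Atoms must be measurable on the whole plane, whereas `θ` is controlled on the slab only; since
  -- `A` vanishes off the slab, the product is its own restriction.
  have hind : (fun z => θ z * A z) = slab.indicator (fun z => θ z * A z) := by
    ext z
    by_cases hz : z ∈ slab
    · rw [indicator_of_mem hz]
    · rw [indicator_of_notMem hz, hzero hz, mul_zero]
  have hindA : A = slab.indicator A := by
    ext z
    by_cases hz : z ∈ slab
    · rw [indicator_of_mem hz]
    · rw [indicator_of_notMem hz, hzero hz]
  obtain ⟨l, m, hm, hs, hn⟩ := id hA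
  refine ⟨l, m, ?_, ?_, ?_⟩
  · rw [hind, aestronglyMeasurable_indicator_iff measurableSet_slab, restrict_slab]
    exact hθ.mul hA.aestronglyMeasurable
  · intro z hz
    exact hs fun h => hz (by simp [h])
  · refine le_trans ?_ hn
    rw [hind, hindA, eLpNorm_indicator_eq_eLpNorm_restrict measurableSet_slab,
      eLpNorm_indicator_eq_eLpNorm_restrict measurableSet_slab, restrict_slab, ← hindA]
    refine eLpNorm_mono_enorm_ae ?_
    filter_upwards [hb] with z hz
    rw [enorm_mul]
    exact mul_le_of_le_one_left zero_le hz

theorem normY_le_of_hasSum {ι : Type*} [Denumerable ι] {f : ℝ × ℝ → ℂ} {c : ι → ℂ}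
    {A : ι → ℝ × ℝ → ℂ} (hA : ∀ k, 𝓓.IsAtom (A k))
    (h : ∀ᵐ z ∂slabMeasure, HasSum (fun k => c k * A k z) (f z)) :
    𝓓.normY f ≤ ∑' k, ‖c k‖ₑ := by
  let e : ℕ ≃ ι := (Denumerable.eqv ι).symm
  rw [← e.tsum_eq]
  refine iInf₂_le_of_le (fun n => c (e n)) (fun n => A (e n))
    (iInf₂_le_of_le (fun n => hA _) ?_ le_rfl)
  rw [restrict_slab]
  filter_upwards [h] with z hz
  exact e.hasSum_iff.2 hz

theorem exists_atoms_of_normY_lt {f : ℝ × ℝ → ℂ} {b : ℝ≥0∞} (h : 𝓓.normY f < b) :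
    ∃ (c : ℕ → ℂ) (A : ℕ → ℝ × ℝ → ℂ), (∀ k, 𝓓.IsAtom (A k)) ∧
      (∀ᵐ z ∂slabMeasure, HasSum (fun k => c k * A k z) (f z)) ∧ ∑' k, ‖c k‖ₑ < b := by
  simp only [normY, iInf_lt_iff, restrict_slab] at h
  obtain ⟨c, A, h1, h2, h3⟩ := h
  exact ⟨c, A, h1, h2, h3⟩

theorem normY_zero {f : ℝ × ℝ → ℂ} (h : ∀ᵐ z ∂slabMeasure, f z = 0) : 𝓓.normY f = 0 := by
  have := normY_le_of_hasSum (𝓓 := 𝓓) (ι := ℕ) (f := f) (c := fun _ => 0) (A := fun _ _ => 0)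
    (fun _ => isAtom_zero) (by
      filter_upwards [h] with z hz
      rw [hz]
      simp)
  simpa using this

theorem tsum_mix_atoms_le {ι : Type*} {c : ι → ℂ} {A : ι → ℝ × ℝ → ℂ}
    (hA : ∀ k, 𝓓.IsAtom (A k)) : ∑' k, mix 2 2 univ (fun z => ‖c k * A k z‖ₑ) ≤ ∑' k, ‖c k‖ₑ := by
  refine ENNReal.tsum_le_tsum fun k => ?_
  simp only [enorm_mul]
  refine (mix_const_mul_le _ enorm_ne_top _).trans ?_
  exact mul_le_of_le_one_right zero_le (mix_atom_le (hA k))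

theorem aestronglyMeasurable_mul_atom {A : ℝ × ℝ → ℂ} (hA : 𝓓.IsAtom A) (c : ℂ) :
    AEStronglyMeasurable (fun z => c * A z) slabMeasure :=
  hA.aestronglyMeasurable.const_mul c

theorem ae_tsum_atoms_lt_top {ι : Type*} [Countable ι] {c : ι → ℂ} {A : ι → ℝ × ℝ → ℂ}
    (hA : ∀ k, 𝓓.IsAtom (A k)) (hc : ∑' k, ‖c k‖ₑ ≠ ⊤) :
    ∀ᵐ z ∂slabMeasure, ∑' k, ‖c k * A k z‖ₑ < ⊤ := by
  have h := ae_tsum_lt_top (fun k => (aestronglyMeasurable_mul_atom (hA k) (c k)).enorm)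
    MeasurableSet.univ (ne_top_of_le_ne_top hc ((ENNReal.tsum_le_tsum fun k =>
      mix_le_mix_time one_le_two (aestronglyMeasurable_mul_atom (hA k) (c k)).enorm two_ne_zero
        ENNReal.ofNat_ne_top).trans (tsum_mix_atoms_le hA)))
  filter_upwards [h] with z hz using hz (mem_univ _)

theorem mix_le_normY (f : ℝ × ℝ → ℂ) : mix 2 2 univ (fun z => ‖f z‖ₑ) ≤ 𝓓.normY f := by
  refine le_of_forall_gt fun b hb => ?_
  obtain ⟨c, A, h1, h2, h3⟩ := exists_atoms_of_normY_lt hb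
  refine lt_of_le_of_lt ?_ h3
  refine le_trans ?_ (tsum_mix_atoms_le h1)
  refine le_trans (mix_mono_ae ?_) (mix_tsum_le
    (fun k => (aestronglyMeasurable_mul_atom (h1 k) (c k)).enorm) one_le_two
    ENNReal.ofNat_ne_top one_le_two)
  filter_upwards [Measure.ae_ae_of_ae_prod h2] with t ht
  filter_upwards [ht] with x hx
  rw [← hx.tsum_eq]
  exact enorm_tsum_le_tsum_enorm

/-- Divided by `B`, the product with an atom is again an atom, and the factor `B` moves into the
coefficients. -/
theorem normY_mul_le {f θ : ℝ × ℝ → ℂ} (hθ : AEStronglyMeasurable θ slabMeasure) {B : ℝ≥0}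
    (hb : ∀ᵐ z ∂slabMeasure, ‖θ z‖ₑ ≤ B) : 𝓓.normY (fun z => θ z * f z) ≤ B * 𝓓.normY f := by
  by_cases hB : B = 0
  · rw [normY_zero]
    · exact zero_le
    · filter_upwards [hb] with z hz
      rw [hB] at hz
      simp only [ENNReal.coe_zero, nonpos_iff_eq_zero, enorm_eq_zero] at hz
      rw [hz, zero_mul]
  have hB' : (B : ℝ≥0∞) ≠ 0 := by simpa using hB
  rw [mul_comm, ← ENNReal.div_le_iff hB' ENNReal.coe_ne_top]
  refine le_of_forall_gt fun b hbb => ?_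
  obtain ⟨c, A, h1, h2, h3⟩ := exists_atoms_of_normY_lt hbb
  refine lt_of_le_of_lt ?_ h3
  rw [ENNReal.div_le_iff hB' ENNReal.coe_ne_top]
  have hBn : ‖((B : ℝ) : ℂ)‖ₑ = B := by
    rw [← ofReal_norm, Complex.norm_real, Real.norm_of_nonneg B.coe_nonneg,
      ENNReal.ofReal_coe_nnreal]
  have hBc : ((B : ℝ) : ℂ) ≠ 0 := by exact_mod_cast hB
  have h4 : 𝓓.normY (fun z => θ z * f z) ≤ ∑' k, ‖((B : ℝ) : ℂ) * c k‖ₑ := by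
    refine normY_le_of_hasSum (A := fun k z => (((B : ℝ) : ℂ)⁻¹ * θ z) * A k z)
      (fun k => (h1 k).mul (hθ.const_mul _) ?_) ?_
    · filter_upwards [hb] with z hz
      rw [enorm_mul, enorm_inv hBc, hBn, mul_comm, ← div_eq_mul_inv]
      exact ENNReal.div_le_of_le_mul (by simpa using hz)
    · filter_upwards [h2] with z hz
      have h5 := hz.mul_left (θ z)
      have h6 : (fun k => ((B : ℝ) : ℂ) * c k * ((((B : ℝ) : ℂ)⁻¹ * θ z) * A k z)) =
          fun k => θ z * (c k * A k z) := by
        ext k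
        field_simp
      rwa [h6]
  simp only [enorm_mul, hBn] at h4
  rwa [ENNReal.tsum_mul_left, mul_comm] at h4

/-- Nearly optimal decompositions, with errors of total size at most `ε`, are concatenated. Atoms
are bounded in `L^2`, so a finite sum of coefficients makes the double series converge absolutely
almost everywhere, and it may be summed by rows. -/
theorem normY_tsum_le {ι : Type*} [Denumerable ι] {f : ℝ × ℝ → ℂ} {g : ι → ℝ × ℝ → ℂ}
    (h : ∀ᵐ z ∂slabMeasure, HasSum (fun i => g i z) (f z)) :
    𝓓.normY f ≤ ∑' i, 𝓓.normY (g i) := by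
  by_cases htop : ∑' i, 𝓓.normY (g i) = ⊤
  · rw [htop]
    exact le_top
  refine ENNReal.le_of_forall_pos_le_add fun ε hε _ => ?_
  obtain ⟨ε', hε', hε''⟩ := ENNReal.exists_pos_sum_of_countable (ENNReal.coe_pos.2 hε).ne' ι
  have h1 : ∀ i, 𝓓.normY (g i) < 𝓓.normY (g i) + ε' i := fun i =>
    ENNReal.lt_add_right (ne_top_of_le_ne_top htop (ENNReal.le_tsum i))
      (ENNReal.coe_pos.2 (hε' i)).ne'
  choose c A hA hsum hlt using fun i => exists_atoms_of_normY_lt (h1 i)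
  have htot : ∑' p : ι × ℕ, ‖c p.1 p.2‖ₑ ≤ ∑' i, 𝓓.normY (g i) + ε := by
    rw [ENNReal.tsum_prod (f := fun i k => ‖c i k‖ₑ)]
    calc _ ≤ ∑' i, (𝓓.normY (g i) + ε' i) := ENNReal.tsum_le_tsum fun i => (hlt i).le
      _ = ∑' i, 𝓓.normY (g i) + ∑' i, (ε' i : ℝ≥0∞) := ENNReal.tsum_add
      _ ≤ _ := by gcongr
  refine le_trans (normY_le_of_hasSum (c := fun p : ι × ℕ => c p.1 p.2)
    (A := fun p => A p.1 p.2) (fun p => hA p.1 p.2) ?_) htot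
  have hfin := ae_tsum_atoms_lt_top (c := fun p : ι × ℕ => c p.1 p.2)
    (A := fun p => A p.1 p.2) (fun p => hA p.1 p.2)
    (ne_top_of_le_ne_top (ENNReal.add_ne_top.2 ⟨htop, ENNReal.coe_ne_top⟩) htot)
  filter_upwards [h, ae_all_iff.2 hsum, hfin] with z hz hz' hz''
  have hs := (summable_of_tsum_enorm_lt_top hz'').hasSum
  have := hs.prod_fiberwise fun i => hz' i
  rwa [this.unique hz] at hs

/-- Functions are superpositions of atoms of a fixed scale. -/
theorem normY_le_tsum_mix {g : ℝ × ℝ → ℂ} (hg : AEStronglyMeasurable g slabMeasure) (l : ℕ) :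
    𝓓.normY g ≤ ∑' n, (2 : ℝ≥0∞) ^ ((l : ℝ) / 2) * mix 2 2 (𝓓.Q l n) (fun z => ‖g z‖ₑ) := by
  set C : ℤ → ℝ≥0∞ := fun n => (2 : ℝ≥0∞) ^ ((l : ℝ) / 2) * mix 2 2 (𝓓.Q l n) (fun z => ‖g z‖ₑ)
  by_cases htop : ∑' n, C n = ⊤
  · rw [htop]
    exact le_top
  have hC : ∀ n, C n ≠ ⊤ := fun n => ne_top_of_le_ne_top htop (ENNReal.le_tsum n)
  have hen : ∀ n, ‖(((C n).toReal : ℝ) : ℂ)‖ₑ = C n := fun n => by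
    rw [← ofReal_norm, Complex.norm_real, Real.norm_of_nonneg ENNReal.toReal_nonneg,
      ENNReal.ofReal_toReal (hC n)]
  have hmeas : ∀ n, MeasurableSet (Icc (0 : ℝ) 1 ×ˢ 𝓓.Q l n) := fun n =>
    measurableSet_Icc.prod (𝓓.measurableSet_Q l n)
  have hres : ∀ n, (volume : Measure (ℝ × ℝ)).restrict (Icc (0 : ℝ) 1 ×ˢ 𝓓.Q l n) ≤
      slabMeasure := fun n => by
    rw [← restrict_slab]
    exact Measure.restrict_mono_set _ (prod_mono le_rfl (subset_univ _))
  -- Where a coefficient vanishes, the normalised atom below degenerates to zero through `0⁻¹ = 0`;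
  -- this is harmless because `g` vanishes almost everywhere on that interval.
  have hzero : ∀ᵐ z ∂slabMeasure, ∀ n, C n = 0 → z.2 ∈ 𝓓.Q l n → g z = 0 := by
    rw [ae_all_iff]
    intro n
    by_cases hn : C n = 0
    · have h1 : mix 2 2 (𝓓.Q l n) (fun z => ‖g z‖ₑ) = 0 := by
        rcases mul_eq_zero.1 hn with h | h
        · exact absurd h (two_rpow_ne_zero _)
        · exact h
      rw [← eLpNorm_two_eq_mix hg, eLpNorm_eq_zero_iff (hg.mono_measure (hres n)) two_ne_zero,
        EventuallyEq, ae_restrict_iff'₀ (hmeas n).nullMeasurableSet] at h1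
      rw [← restrict_slab, ae_restrict_iff'₀ measurableSet_slab.nullMeasurableSet]
      filter_upwards [h1] with z hz hz1 _ hz2
      exact hz ⟨hz1.1, hz2⟩
    · exact Eventually.of_forall fun z h => absurd h hn
  have key : 𝓓.normY g ≤ ∑' n, ‖(((C n).toReal : ℝ) : ℂ)‖ₑ := by
    refine normY_le_of_hasSum (A := fun n => (Icc (0 : ℝ) 1 ×ˢ 𝓓.Q l n).indicator
      fun z => (((C n).toReal : ℝ) : ℂ)⁻¹ * g z) (fun n => ⟨l, n, ?_, ?_, ?_⟩) ?_
    · rw [aestronglyMeasurable_indicator_iff (hmeas n)]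
      exact (hg.mono_measure (hres n)).const_mul _
    · exact support_indicator_subset
    · rw [eLpNorm_indicator_eq_eLpNorm_restrict (hmeas n)]
      have h1 := eLpNorm_const_smul ((((C n).toReal : ℝ) : ℂ)⁻¹) g 2
        ((volume : Measure (ℝ × ℝ)).restrict (Icc (0 : ℝ) 1 ×ˢ 𝓓.Q l n))
      have h2 : ((((C n).toReal : ℝ) : ℂ)⁻¹ • g) = fun z => (((C n).toReal : ℝ) : ℂ)⁻¹ * g z := rfl
      rw [h2] at h1
      rw [h1, eLpNorm_two_eq_mix hg]
      by_cases hn : C n = 0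
      · simp [hn]
      · rw [enorm_inv (by
          have := ENNReal.toReal_ne_zero.2 ⟨hn, hC n⟩
          exact_mod_cast this), hen]
        have h3 : mix 2 2 (𝓓.Q l n) (fun z => ‖g z‖ₑ) = 2 ^ (-(l : ℝ) / 2) * C n := by
          simp only [C]
          rw [← mul_assoc, neg_div, two_rpow_neg_mul_self, one_mul]
        rw [h3, mul_left_comm, ENNReal.inv_mul_cancel hn (hC n), mul_one]
    · have hmem : ∀ᵐ z ∂slabMeasure, z ∈ slab := by
        rw [← restrict_slab]
        exact ae_restrict_mem measurableSet_slab
      filter_upwards [hzero, hmem] with z hz hz'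
      obtain ⟨n, hn⟩ := 𝓓.exists_mem_Q l z.2
      have hv : (((C n).toReal : ℝ) : ℂ) * (Icc (0 : ℝ) 1 ×ˢ 𝓓.Q l n).indicator
          (fun z => (((C n).toReal : ℝ) : ℂ)⁻¹ * g z) z = g z := by
        rw [indicator_of_mem (show z ∈ Icc (0 : ℝ) 1 ×ˢ 𝓓.Q l n from ⟨hz'.1, hn⟩)]
        by_cases hn0 : C n = 0
        · rw [hz n hn0 hn]
          simp
        · rw [mul_inv_cancel_left₀]
          have := ENNReal.toReal_ne_zero.2 ⟨hn0, hC n⟩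
          exact_mod_cast this
      rw [← hv]
      refine hasSum_single n fun m hm => ?_
      rw [indicator_of_notMem, mul_zero]
      intro h
      exact hm ((𝓓.mem_Q_iff.1 h.2).symm.trans (𝓓.mem_Q_iff.1 hn))
  simp only [hen] at key
  exact key

theorem count_le_three {l l' : ℕ} (h : l' ≤ l) : count l l' ≤ 3 := by
  have : (2 : ℝ≥0∞) ^ l' / 2 ^ l ≤ 1 := by
    refine ENNReal.div_le_of_le_mul ?_
    rw [one_mul]
    exact pow_le_pow_right₀ one_le_two h
  calc count l l' ≤ 1 + 2 := by
        rw [count]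
        gcongr
    _ = 3 := by norm_num

/-- An interval of length `2^l` with `l ≤ 2 * i` meets at most three intervals of length `2^(2i)`,
so atoms of scale `l` survive the cutoffs and the sum over `m` at bounded cost. The scale stays free
so that it can be fitted to the support of an atom or to the lower of two frequencies. -/
theorem tsum_normY_χ_le {g : ℝ × ℝ → ℂ} (hg : AEStronglyMeasurable g slabMeasure) {i l : ℕ}
    (hl : l ≤ 2 * i) : ∑' m, 𝓓.normY (fun z => (𝓓.χ i m z.2 : ℂ) * g z) ≤
      9 * ((2 : ℝ≥0∞) ^ ((l : ℝ) / 2) * ∑' n, mix 2 2 (𝓓.Q l n) (fun z => ‖g z‖ₑ)) := by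
  have hS := fun n => subadditiveSetFn_mix (q := 2) (p := 2)
    (F := fun z => (𝓓.Q l n).indicator 1 z.2 * ‖g z‖ₑ)
    (((measurable_one.indicator (𝓓.measurableSet_Q l n)).comp measurable_snd).aemeasurable.mul
      hg.enorm) one_le_two ENNReal.ofNat_ne_top one_le_two
  have h1 : ∀ m n, mix 2 2 (𝓓.Q l n) (fun z => ‖(𝓓.χ i m z.2 : ℂ) * g z‖ₑ) ≤
      mix 2 2 (𝓓.Q₃ (2 * i) (m + -1)) (fun z => (𝓓.Q l n).indicator 1 z.2 * ‖g z‖ₑ) := by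
    intro m n
    rw [← mix_indicator (𝓓.measurableSet_Q _ _), ← mix_indicator (𝓓.measurableSet_Q₃ _ _)]
    refine mix_mono fun z => ?_
    rw [mul_left_comm]
    gcongr
    exact enorm_χ_mul_le i m z.2 (g z)
  have h2 : ∀ n, ∑' m, mix 2 2 (𝓓.Q (2 * i) m)
      (fun z => (𝓓.Q l n).indicator 1 z.2 * ‖g z‖ₑ) ≤
      3 * mix 2 2 (𝓓.Q l n) (fun z => ‖g z‖ₑ) := by
    intro n
    have h3 : ∀ m, mix 2 2 (𝓓.Q (2 * i) m) (fun z => (𝓓.Q l n).indicator 1 z.2 * ‖g z‖ₑ) =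
        mix 2 2 (𝓓.Q l n ∩ 𝓓.Q (2 * i) m) (fun z => ‖g z‖ₑ) := by
      intro m
      rw [← mix_indicator (𝓓.measurableSet_Q _ _),
        ← mix_indicator ((𝓓.measurableSet_Q _ _).inter (𝓓.measurableSet_Q _ _))]
      congr 1
      ext z
      by_cases h2 : z.2 ∈ 𝓓.Q (2 * i) m <;> by_cases h3 : z.2 ∈ 𝓓.Q l n <;> simp [h2, h3]
    simp only [h3]
    refine (tsum_inter_le (subadditiveSetFn_mix hg.enorm one_le_two ENNReal.ofNat_ne_top
      one_le_two) (2 * i) l n).trans ?_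
    gcongr
    exact count_le_three hl
  calc _ ≤ ∑' m, ∑' n, (2 : ℝ≥0∞) ^ ((l : ℝ) / 2) *
        mix 2 2 (𝓓.Q₃ (2 * i) (m + -1)) (fun z => (𝓓.Q l n).indicator 1 z.2 * ‖g z‖ₑ) := by
        refine ENNReal.tsum_le_tsum fun m => ?_
        refine (normY_le_tsum_mix (aestronglyMeasurable_χ_mul hg i m) l).trans ?_
        exact ENNReal.tsum_le_tsum fun n => mul_le_mul' le_rfl (h1 m n)
    _ = (2 : ℝ≥0∞) ^ ((l : ℝ) / 2) * ∑' n, ∑' m,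
        mix 2 2 (𝓓.Q₃ (2 * i) (m + -1)) (fun z => (𝓓.Q l n).indicator 1 z.2 * ‖g z‖ₑ) := by
        simp_rw [ENNReal.tsum_mul_left]
        rw [ENNReal.tsum_comm]
    _ ≤ (2 : ℝ≥0∞) ^ ((l : ℝ) / 2) * ∑' n, 3 * (3 * mix 2 2 (𝓓.Q l n) (fun z => ‖g z‖ₑ)) := by
        refine mul_le_mul' le_rfl (ENNReal.tsum_le_tsum fun n => ?_)
        exact (tsum_Q₃_le (hS n) (2 * i) (-1)).trans (mul_le_mul' le_rfl (h2 n))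
    _ = _ := by
        simp_rw [ENNReal.tsum_mul_left]
        ring

end Setup

end BilEst

end

/-! ### Projections in `Y` and the norms `Y_j`. -/

noncomputable section

namespace BilEst

open Filter Topology SchwartzMap

/-! ### Convolutions of square integrable slices -/

theorem lintegral_conv_le (K : 𝓢(ℝ, ℂ)) {a : ℝ → ℂ} (ha : AEStronglyMeasurable a) (x : ℝ) :
    ∫⁻ y, ‖K (x - y) * a y‖ₑ ≤ eLpNorm (fun y => K (x - y)) 2 volume *
      eLpNorm (fun y => ‖a y‖ₑ) 2 volume := by
  have hK : Measurable fun y => ‖K (x - y)‖ₑ := by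
    have : Continuous fun y => K (x - y) := by fun_prop
    exact this.measurable.enorm
  have := lintegral_mul_le_eLpNorm_two hK.aemeasurable ha.enorm
  simp only [enorm_mul]
  rwa [eLpNorm_enorm (fun y => K (x - y))] at this

theorem eLpNorm_kernel_ne_top (K : 𝓢(ℝ, ℂ)) (x : ℝ) :
    eLpNorm (fun y => K (x - y)) 2 volume ≠ ⊤ := by
  have h : MemLp (fun y => K (x - y)) 2 volume :=
    (K.memLp 2 volume).comp_measurePreserving (Measure.measurePreserving_sub_left volume x)
  exact h.eLpNorm_ne_top

theorem integrable_conv_of_eLpNorm (K : 𝓢(ℝ, ℂ)) {a : ℝ → ℂ} (ha : AEStronglyMeasurable a)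
    (h : eLpNorm (fun y => ‖a y‖ₑ) 2 volume ≠ ⊤) (x : ℝ) :
    Integrable fun y => K (x - y) * a y := by
  refine ⟨AEStronglyMeasurable.mul (Continuous.aestronglyMeasurable (by fun_prop)) ha, ?_⟩
  exact (lintegral_conv_le K ha x).trans_lt
    (ENNReal.mul_lt_top (eLpNorm_kernel_ne_top K x).lt_top h.lt_top)

/-- Translates of the kernel are square integrable, so Cauchy-Schwarz dominates the convolutions by
the summable `L^2` norms and the sum may be exchanged with the integral. -/
theorem hasSum_conv (K : 𝓢(ℝ, ℂ)) {ι : Type*} [Countable ι] {f : ι → ℝ → ℂ} {g : ℝ → ℂ}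
    (hf : ∀ i, AEStronglyMeasurable (f i)) (h : ∑' i, eLpNorm (fun y => ‖f i y‖ₑ) 2 volume ≠ ⊤)
    (hg : ∀ᵐ y, HasSum (fun i => f i y) (g y)) (x : ℝ) :
    HasSum (fun i => conv K (f i) x) (conv K g x) := by
  have hm : ∀ i, AEStronglyMeasurable fun y => K (x - y) * f i y := fun i =>
    AEStronglyMeasurable.mul (Continuous.aestronglyMeasurable (by fun_prop)) (hf i)
  have h1 : ∑' i, ∫⁻ y, ‖K (x - y) * f i y‖ₑ ≠ ⊤ := by
    refine ne_top_of_le_ne_top (ENNReal.mul_ne_top (eLpNorm_kernel_ne_top K x) h) ?_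
    rw [← ENNReal.tsum_mul_left]
    exact ENNReal.tsum_le_tsum fun i => lintegral_conv_le K (hf i) x
  have h2 : conv K g x = ∑' i, conv K (f i) x := by
    simp only [conv]
    rw [← integral_tsum hm h1]
    refine integral_congr_ae ?_
    filter_upwards [hg] with y hy
    rw [tsum_mul_left, hy.tsum_eq]
  rw [h2]
  refine (summable_of_tsum_enorm_lt_top (lt_of_le_of_lt ?_ h1.lt_top)).hasSum
  exact ENNReal.tsum_le_tsum fun i => enorm_integral_le_lintegral_enorm _

theorem ae_slice_norm_lt_top {F : ℝ × ℝ → ℝ≥0∞} (hF : AEMeasurable F slabMeasure)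
    (h : mix 1 2 univ F ≠ ⊤) : ∀ᵐ t ∂timeMeasure, eLpNorm (fun x => F (t, x)) 2 volume < ⊤ := by
  rw [mix, eLpNorm_one_eq] at h
  have := ae_lt_top' (aemeasurable_slice_norm hF two_ne_zero ENNReal.ofNat_ne_top univ) h
  simpa using this

theorem slice_aestronglyMeasurable {u : ℝ × ℝ → ℂ} (hu : AEStronglyMeasurable u slabMeasure) :
    ∀ᵐ t ∂timeMeasure, AEStronglyMeasurable fun x => u (t, x) :=
  hu.prodMk_left

theorem hasSum_convt (K : 𝓢(ℝ, ℂ)) {ι : Type*} [Countable ι] {f : ι → ℝ × ℝ → ℂ} {g : ℝ × ℝ → ℂ}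
    (hf : ∀ i, AEStronglyMeasurable (f i) slabMeasure)
    (h : ∑' i, mix 1 2 univ (fun z => ‖f i z‖ₑ) ≠ ⊤)
    (hg : ∀ᵐ z ∂slabMeasure, HasSum (fun i => f i z) (g z)) :
    ∀ᵐ z ∂slabMeasure, HasSum (fun i => convt K (f i) z) (convt K g z) := by
  have h1 : ∀ᵐ t ∂timeMeasure, ∑' i, eLpNorm (fun x => ‖f i (t, x)‖ₑ) 2 volume < ⊤ := by
    have hm := fun i => aemeasurable_slice_norm (hf i).enorm two_ne_zero ENNReal.ofNat_ne_top univ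
    simp only [mix, eLpNorm_one_eq] at h
    rw [← lintegral_tsum hm] at h
    simpa using ae_lt_top' (AEMeasurable.tsum hm) h
  have h2 : ∀ᵐ t ∂timeMeasure, ∀ x, HasSum (fun i => convt K (f i) (t, x)) (convt K g (t, x)) := by
    filter_upwards [h1, Measure.ae_ae_of_ae_prod hg,
      ae_all_iff.2 fun i => slice_aestronglyMeasurable (hf i)] with t ht ht' hm x
    exact hasSum_conv K hm ht.ne ht' x
  filter_upwards [ae_slab_of_ae_time h2] with z hz using hz z.2

theorem convt_add (K : 𝓢(ℝ, ℂ)) {f g h : ℝ × ℝ → ℂ} (hf : AEStronglyMeasurable f slabMeasure)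
    (hg : AEStronglyMeasurable g slabMeasure) (hf' : mix 1 2 univ (fun z => ‖f z‖ₑ) ≠ ⊤)
    (hg' : mix 1 2 univ (fun z => ‖g z‖ₑ) ≠ ⊤) (hh : ∀ᵐ z ∂slabMeasure, h z = f z + g z) :
    ∀ᵐ z ∂slabMeasure, convt K h z = convt K f z + convt K g z := by
  have h2 : ∀ᵐ t ∂timeMeasure, ∀ x, convt K h (t, x) = convt K f (t, x) + convt K g (t, x) := by
    filter_upwards [ae_slice_norm_lt_top hf.enorm hf', ae_slice_norm_lt_top hg.enorm hg',
      slice_aestronglyMeasurable hf, slice_aestronglyMeasurable hg,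
      Measure.ae_ae_of_ae_prod hh] with t h1 h2 h3 h4 h5 x
    simp only [convt, conv]
    rw [← integral_add (integrable_conv_of_eLpNorm K h3 h1.ne x)
      (integrable_conv_of_eLpNorm K h4 h2.ne x)]
    refine integral_congr_ae ?_
    filter_upwards [h5] with y hy
    rw [hy]
    ring
  filter_upwards [ae_slab_of_ae_time h2] with z hz using hz z.2

theorem convt_const_mul (K : 𝓢(ℝ, ℂ)) (c : ℂ) (f : ℝ × ℝ → ℂ) (z : ℝ × ℝ) :
    convt K (fun z => c * f z) z = c * convt K f z := by
  simp only [convt, conv]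
  rw [← integral_const_mul]
  congr 1
  ext y
  ring

namespace Setup

variable {𝓓 : Setup}

/-! ### The atomic norm of projections -/

/-- Cutting an interval of length `2^l` into pieces of length `2^k` costs about `2^((l-k)/2)` by
Cauchy-Schwarz, which is the ratio of the two atomic normalisations. The constant 2 is the root of
the 4 in `count k l ≤ 4 * 2^(l-k)`. -/
theorem tsum_mix_atom_le {A : ℝ × ℝ → ℂ} (hA : 𝓓.IsAtom A) {l : ℕ} {m : ℤ}
    (hs : Function.support A ⊆ Icc (0 : ℝ) 1 ×ˢ 𝓓.Q l m)
    (hn : eLpNorm A 2 volume ≤ (2 : ℝ≥0∞) ^ (-(l : ℝ) / 2)) {k : ℕ} (hk : k ≤ l) :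
    (2 : ℝ≥0∞) ^ ((k : ℝ) / 2) * ∑' n, mix 2 2 (𝓓.Q k n) (fun z => ‖A z‖ₑ) ≤ 2 := by
  have h1 : ∀ n, mix 2 2 (𝓓.Q k n) (fun z => ‖A z‖ₑ) ≤
      mix 2 2 (𝓓.Q l m ∩ 𝓓.Q k n) (fun z => ‖A z‖ₑ) := by
    intro n
    rw [← mix_indicator (𝓓.measurableSet_Q _ _),
      ← mix_indicator ((𝓓.measurableSet_Q _ _).inter (𝓓.measurableSet_Q _ _))]
    refine mix_mono fun z => ?_
    by_cases hz : A z = 0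
    · simp [hz]
    · have : z.2 ∈ 𝓓.Q l m := (hs hz).2
      by_cases hz' : z.2 ∈ 𝓓.Q k n <;> simp [this, hz']
  have h2 : ∑' n, mix 2 2 (𝓓.Q k n) (fun z => ‖A z‖ₑ) ≤
      count k l ^ (1 / 2 : ℝ) * 2 ^ (-(l : ℝ) / 2) := by
    refine (ENNReal.tsum_le_tsum h1).trans
      ((tsum_mix_two_two_inter_le hA.aestronglyMeasurable.enorm k l m).trans ?_)
    gcongr
    rw [← eLpNorm_two_eq_mix hA.aestronglyMeasurable]
    exact (eLpNorm_mono_measure _ Measure.restrict_le_self).trans hn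
  have h3 : count k l ≤ 2 ^ (2 + (l : ℝ) - k) := by
    have e1 : (2 : ℝ≥0∞) ^ l / 2 ^ k = 2 ^ ((l : ℝ) - k) := by
      rw [two_pow_eq_rpow, two_pow_eq_rpow,
        ENNReal.rpow_sub _ _ two_ne_zero ENNReal.ofNat_ne_top]
    have e2 : (2 : ℝ≥0∞) ^ (2 + (l : ℝ) - k) = 4 * 2 ^ ((l : ℝ) - k) := by
      rw [add_sub_assoc, two_rpow_add]
      congr 1
      norm_num
    have e3 : (1 : ℝ≥0∞) ≤ 2 ^ ((l : ℝ) - k) := by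
      rw [← ENNReal.rpow_zero (x := 2)]
      refine two_rpow_le_two_rpow ?_
      have : (k : ℝ) ≤ l := by exact_mod_cast hk
      linarith
    rw [count, e1, e2]
    calc (2 : ℝ≥0∞) ^ ((l : ℝ) - k) + 2 = 2 ^ ((l : ℝ) - k) + 2 * 1 := by rw [mul_one]
      _ ≤ 2 ^ ((l : ℝ) - k) + 2 * 2 ^ ((l : ℝ) - k) := by gcongr
      _ = 3 * 2 ^ ((l : ℝ) - k) := by ring
      _ ≤ _ := by
        gcongr
        norm_num
  calc _ ≤ (2 : ℝ≥0∞) ^ ((k : ℝ) / 2) * ((2 ^ (2 + (l : ℝ) - k)) ^ (1 / 2 : ℝ) *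
        2 ^ (-(l : ℝ) / 2)) := by
        refine mul_le_mul' le_rfl (h2.trans ?_)
        gcongr
    _ = 2 ^ ((k : ℝ) / 2 + ((2 + (l : ℝ) - k) * (1 / 2) + -(l : ℝ) / 2)) := by
        rw [← ENNReal.rpow_mul, ← two_rpow_add, ← two_rpow_add]
    _ = 2 := by
        rw [show (k : ℝ) / 2 + ((2 + (l : ℝ) - k) * (1 / 2) + -(l : ℝ) / 2) = 1 by ring,
          ENNReal.rpow_one]

/-- The projection spreads the atom beyond its support, so it is decomposed anew at scale `min l (2
* i)`: not above `2 * i`, to respect the cutoffs, and not above `l`, so that `tsum_mix_atom_le`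
applies. -/
theorem tsum_normY_χ_St_atom_le {A : ℝ × ℝ → ℂ} (hA : 𝓓.IsAtom A) (i : ℕ) :
    ∑' m, 𝓓.normY (fun z => (𝓓.χ i m z.2 : ℂ) * 𝓓.St i A z) ≤ 54 * 𝓓.kerConst := by
  obtain ⟨l, m, -, hs, hn⟩ := id hA
  rw [St_eq_convt]
  have hAm := hA.aestronglyMeasurable
  refine (tsum_normY_χ_le (aestronglyMeasurable_convt _ hAm) (min_le_right l (2 * i))).trans ?_
  calc _ ≤ 9 * ((2 : ℝ≥0∞) ^ (((min l (2 * i) : ℕ) : ℝ) / 2) *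
        (3 * 1 * 𝓓.kerConst * ∑' n, mix 2 2 (𝓓.Q (min l (2 * i)) n) (fun z => ‖A z‖ₑ))) := by
        gcongr
        exact tsum_mix_convt_le avgBound_two_two one_le_two ENNReal.ofNat_ne_top one_le_two
          one_le_two ENNReal.one_ne_top (𝓓.blockBound_ker i) hAm _
    _ = 27 * 𝓓.kerConst * ((2 : ℝ≥0∞) ^ (((min l (2 * i) : ℕ) : ℝ) / 2) *
        ∑' n, mix 2 2 (𝓓.Q (min l (2 * i)) n) (fun z => ‖A z‖ₑ)) := by ring
    _ ≤ 27 * 𝓓.kerConst * 2 := by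
        gcongr
        exact tsum_mix_atom_le hA hs hn (min_le_left _ _)
    _ = _ := by ring

theorem tsum_normY_χ_St_le (g : ℝ × ℝ → ℂ) (i : ℕ) :
    ∑' m, 𝓓.normY (fun z => (𝓓.χ i m z.2 : ℂ) * 𝓓.St i g z) ≤ 54 * 𝓓.kerConst * 𝓓.normY g := by
  by_cases htop : 𝓓.normY g = ⊤
  · by_cases h0 : 𝓓.kerConst = 0
    · have hz : ∀ z, 𝓓.St i g z = 0 := by
        intro z
        have hk : ∀ x, 𝓓.ker i x = 0 := by
          intro x
          have h1 := 𝓓.blockBound_ker i _ x (mem_block_floor i x)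
          have h2 : 𝓓.blockCoeff ⌊2 ^ i * x⌋ = 0 := by
            have := ENNReal.le_tsum (f := 𝓓.blockCoeff) ⌊2 ^ i * x⌋
            rw [← kerConst, h0] at this
            simpa using this
          rw [h2, zero_mul] at h1
          simpa using h1
        rw [St_eq_convt, convt, conv]
        simp [hk]
      have : ∀ m, 𝓓.normY (fun z => (𝓓.χ i m z.2 : ℂ) * 𝓓.St i g z) = 0 := fun m =>
        normY_zero (Eventually.of_forall fun z => by rw [hz, mul_zero])
      simp [this]
    · rw [htop, ENNReal.mul_top (by simp [h0])]
      exact le_top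
  refine ENNReal.le_of_forall_pos_le_add fun ε hε _ => ?_
  have hC : 54 * 𝓓.kerConst ≠ ⊤ := ENNReal.mul_ne_top (by norm_num) 𝓓.kerConst_ne_top
  obtain ⟨δ, hδ, hδε⟩ : ∃ δ : ℝ≥0, 0 < δ ∧ 54 * 𝓓.kerConst * δ ≤ ε := by
    refine ⟨ε / ((54 * 𝓓.kerConst).toNNReal + 1), by positivity, ?_⟩
    rw [← ENNReal.coe_toNNReal hC]
    norm_cast
    rw [mul_div_assoc', div_le_iff₀ (by positivity), mul_comm]
    gcongr
    exact le_self_add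
  have hlt : 𝓓.normY g < 𝓓.normY g + δ :=
    ENNReal.lt_add_right htop (ENNReal.coe_pos.2 hδ).ne'
  obtain ⟨c, A, hA, hsum, hc⟩ := exists_atoms_of_normY_lt hlt
  have hsum2 : ∀ᵐ z ∂slabMeasure, HasSum (fun k => c k * 𝓓.St i (A k) z) (𝓓.St i g z) := by
    have h1 := hasSum_convt (𝓓.ker i) (fun k => aestronglyMeasurable_mul_atom (hA k) (c k))
      (ne_top_of_le_ne_top (hc.trans_le le_top).ne ((ENNReal.tsum_le_tsum fun k =>
        mix_le_mix_time one_le_two (aestronglyMeasurable_mul_atom (hA k) (c k)).enorm two_ne_zero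
          ENNReal.ofNat_ne_top).trans (tsum_mix_atoms_le hA))) hsum
    simpa only [convt_const_mul, ← St_eq_convt] using h1
  calc _ ≤ ∑' m, ∑' k, ‖c k‖ₑ * 𝓓.normY (fun z => (𝓓.χ i m z.2 : ℂ) * 𝓓.St i (A k) z) := by
        refine ENNReal.tsum_le_tsum fun m => ?_
        refine (normY_tsum_le (g := fun k z => c k * ((𝓓.χ i m z.2 : ℂ) * 𝓓.St i (A k) z))
          ?_).trans (ENNReal.tsum_le_tsum fun k => ?_)
        · filter_upwards [hsum2] with z hz
          have := hz.mul_left (𝓓.χ i m z.2 : ℂ)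
          simpa only [mul_left_comm] using this
        · exact normY_mul_le (B := ‖c k‖₊) aestronglyMeasurable_const
            (Eventually.of_forall fun z => le_rfl)
    _ = ∑' k, ‖c k‖ₑ * ∑' m, 𝓓.normY (fun z => (𝓓.χ i m z.2 : ℂ) * 𝓓.St i (A k) z) := by
        rw [ENNReal.tsum_comm]
        simp_rw [ENNReal.tsum_mul_left]
    _ ≤ ∑' k, ‖c k‖ₑ * (54 * 𝓓.kerConst) :=
        ENNReal.tsum_le_tsum fun k => mul_le_mul' le_rfl (tsum_normY_χ_St_atom_le (hA k) i)
    _ = 54 * 𝓓.kerConst * ∑' k, ‖c k‖ₑ := by rw [ENNReal.tsum_mul_right, mul_comm]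
    _ ≤ 54 * 𝓓.kerConst * (𝓓.normY g + δ) := by gcongr
    _ ≤ _ := by
        rw [mul_add]
        gcongr

/-! ### The norms `Y_j` -/

theorem normYj_le {j : ℕ} {f f₁ f₂ : ℝ × ℝ → ℂ} (h₁ : AEStronglyMeasurable f₁ slabMeasure)
    (h₂ : AEStronglyMeasurable f₂ slabMeasure) (h : ∀ᵐ z ∂slabMeasure, f z = f₁ z + f₂ z) :
    𝓓.normYj j f ≤ ((2 : ℝ≥0∞) ^ j)⁻¹ * 𝓓.normY f₁ + normL1L2 f₂ := by
  rw [normYj]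
  simp only [restrict_slab]
  exact iInf₂_le_of_le f₁ f₂ (iInf_le_of_le ⟨h₁, h₂, h⟩ le_rfl)

theorem exists_decomp_of_normYj_lt {j : ℕ} {f : ℝ × ℝ → ℂ} {b : ℝ≥0∞} (h : 𝓓.normYj j f < b) :
    ∃ f₁ f₂ : ℝ × ℝ → ℂ, AEStronglyMeasurable f₁ slabMeasure ∧
      AEStronglyMeasurable f₂ slabMeasure ∧ (∀ᵐ z ∂slabMeasure, f z = f₁ z + f₂ z) ∧
      ((2 : ℝ≥0∞) ^ j)⁻¹ * 𝓓.normY f₁ + normL1L2 f₂ < b := by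
  simp only [normYj, iInf_lt_iff, restrict_slab] at h
  obtain ⟨f₁, f₂, ⟨h1, h2, h3⟩, h4⟩ := h
  exact ⟨f₁, f₂, h1, h2, h3, h4⟩

theorem normL1L2_zero : normL1L2 (fun _ => 0) = 0 := by simp [normL1L2]

theorem normYj_le_normY (j : ℕ) {f : ℝ × ℝ → ℂ} (hf : AEStronglyMeasurable f slabMeasure) :
    𝓓.normYj j f ≤ ((2 : ℝ≥0∞) ^ j)⁻¹ * 𝓓.normY f := by
  have := normYj_le (𝓓 := 𝓓) (j := j) (f := f) hf
    (aestronglyMeasurable_const (b := (0 : ℂ))) (Eventually.of_forall fun z => by simp)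
  rwa [normL1L2_zero, add_zero] at this

theorem normYj_le_normL1L2 (j : ℕ) {f : ℝ × ℝ → ℂ} (hf : AEStronglyMeasurable f slabMeasure) :
    𝓓.normYj j f ≤ normL1L2 f := by
  have := normYj_le (𝓓 := 𝓓) (j := j) (f := f) (aestronglyMeasurable_const (b := (0 : ℂ))) hf
    (Eventually.of_forall fun z => by simp)
  rwa [normY_zero (Eventually.of_forall fun _ => rfl), mul_zero, zero_add] at this

/-- A crude embedding, with a constant that depends on `j`. It serves only to derive almost
everywhere convergence of series from convergence in norm. -/
theorem mix_le_normYj (j : ℕ) (f : ℝ × ℝ → ℂ) :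
    mix 1 2 univ (fun z => ‖f z‖ₑ) ≤ 2 ^ j * 𝓓.normYj j f := by
  have h0 := two_pow_ne_zero' j
  have h0' := two_pow_ne_top' j
  rw [mul_comm, ← ENNReal.div_le_iff h0 h0']
  refine le_of_forall_gt fun b hb => ?_
  obtain ⟨f₁, f₂, h1, h2, h3, h4⟩ := exists_decomp_of_normYj_lt hb
  refine lt_of_le_of_lt ?_ h4
  rw [ENNReal.div_le_iff h0 h0', add_mul, mul_right_comm, ENNReal.inv_mul_cancel h0 h0', one_mul]
  have h5 : mix 1 2 univ (fun z => ‖f z‖ₑ) ≤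
      ∑' d : Bool, mix 1 2 univ (fun z => ‖(if d then f₁ else f₂) z‖ₑ) := by
    refine le_trans (mix_mono_ae ?_) (mix_tsum_le (fun d => ?_) one_le_two ENNReal.ofNat_ne_top
      le_rfl)
    · filter_upwards [Measure.ae_ae_of_ae_prod h3] with t ht
      filter_upwards [ht] with x hx
      rw [hx, tsum_fintype]
      simpa using enorm_add_le _ _
    · cases d
      · simpa using h2.enorm
      · simpa using h1.enorm
  rw [tsum_fintype] at h5
  simp only [Fintype.univ_bool, Finset.mem_singleton, Bool.true_eq_false, not_false_eq_true,
    Finset.sum_insert, if_true, Finset.sum_singleton, Bool.false_eq_true, if_false] at h5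
  refine h5.trans (add_le_add ?_ ?_)
  · exact (mix_le_mix_time one_le_two h1.enorm two_ne_zero ENNReal.ofNat_ne_top).trans
      (mix_le_normY f₁)
  · rw [← normL1L2_eq_mix]
    exact le_mul_of_one_le_right zero_le (one_le_pow₀ one_le_two)

theorem aestronglyMeasurable_of_hasSum {f : ℝ × ℝ → ℂ} {g : ℕ → ℝ × ℝ → ℂ}
    (hg : ∀ n, AEStronglyMeasurable (g n) slabMeasure)
    (h : ∀ᵐ z ∂slabMeasure, HasSum (fun n => g n z) (f z)) :
    AEStronglyMeasurable f slabMeasure := by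
  refine aestronglyMeasurable_of_tendsto_ae atTop
    (f := fun N z => ∑ n ∈ Finset.range N, g n z) (fun N => ?_) ?_
  · exact Finset.aestronglyMeasurable_fun_sum _ fun n _ => hg n
  · filter_upwards [h] with z hz using hz.tendsto_sum_nat

theorem ae_summable_of_tsum_mix {ι : Type*} [Countable ι] {g : ι → ℝ × ℝ → ℂ}
    (hg : ∀ n, AEStronglyMeasurable (g n) slabMeasure)
    (h : ∑' n, mix 1 2 univ (fun z => ‖g n z‖ₑ) ≠ ⊤) :
    ∀ᵐ z ∂slabMeasure, Summable fun n => g n z := by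
  filter_upwards [ae_tsum_lt_top (fun n => (hg n).enorm) MeasurableSet.univ h] with z hz
  exact summable_of_tsum_enorm_lt_top (hz (mem_univ _))

theorem normYj_tsum_le {j : ℕ} {f : ℝ × ℝ → ℂ} {g : ℕ → ℝ × ℝ → ℂ}
    (h : ∀ᵐ z ∂slabMeasure, HasSum (fun n => g n z) (f z)) :
    𝓓.normYj j f ≤ ∑' n, 𝓓.normYj j (g n) := by
  by_cases htop : ∑' n, 𝓓.normYj j (g n) = ⊤
  · rw [htop]
    exact le_top
  refine ENNReal.le_of_forall_pos_le_add fun ε hε _ => ?_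
  obtain ⟨ε', hε', hε''⟩ := ENNReal.exists_pos_sum_of_countable (ENNReal.coe_pos.2 hε).ne' ℕ
  have h1 : ∀ n, 𝓓.normYj j (g n) < 𝓓.normYj j (g n) + ε' n := fun n =>
    ENNReal.lt_add_right (ne_top_of_le_ne_top htop (ENNReal.le_tsum n))
      (ENNReal.coe_pos.2 (hε' n)).ne'
  choose f₁ f₂ hm₁ hm₂ hsum hlt using fun n => exists_decomp_of_normYj_lt (h1 n)
  have htot : ∑' n, (((2 : ℝ≥0∞) ^ j)⁻¹ * 𝓓.normY (f₁ n) + normL1L2 (f₂ n)) ≤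
      ∑' n, 𝓓.normYj j (g n) + ε := by
    calc _ ≤ ∑' n, (𝓓.normYj j (g n) + ε' n) := ENNReal.tsum_le_tsum fun n => (hlt n).le
      _ = ∑' n, 𝓓.normYj j (g n) + ∑' n, (ε' n : ℝ≥0∞) := ENNReal.tsum_add
      _ ≤ _ := by gcongr
  have hfin := ne_top_of_le_ne_top (ENNReal.add_ne_top.2 ⟨htop, ENNReal.coe_ne_top⟩) htot
  rw [ENNReal.tsum_add, ENNReal.tsum_mul_left] at htot hfin
  obtain ⟨hfin1, hfin2⟩ := ENNReal.add_ne_top.1 hfin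
  have hfin1' : ∑' n, 𝓓.normY (f₁ n) ≠ ⊤ := by
    intro hcon
    rw [hcon, ENNReal.mul_top (ENNReal.inv_ne_zero.2 (two_pow_ne_top' j))] at hfin1
    exact hfin1 rfl
  have hs₁ := ae_summable_of_tsum_mix hm₁ (ne_top_of_le_ne_top hfin1'
    (ENNReal.tsum_le_tsum fun n => (mix_le_mix_time one_le_two (hm₁ n).enorm two_ne_zero
      ENNReal.ofNat_ne_top).trans (mix_le_normY (f₁ n))))
  have hs₂ := ae_summable_of_tsum_mix hm₂ (by simpa only [normL1L2_eq_mix] using hfin2)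
  have hh₁ : ∀ᵐ z ∂slabMeasure, HasSum (fun n => f₁ n z) (∑' n, f₁ n z) :=
    hs₁.mono fun z hz => hz.hasSum
  have hh₂ : ∀ᵐ z ∂slabMeasure, HasSum (fun n => f₂ n z) (∑' n, f₂ n z) :=
    hs₂.mono fun z hz => hz.hasSum
  refine le_trans (normYj_le (f₁ := fun z => ∑' n, f₁ n z) (f₂ := fun z => ∑' n, f₂ n z)
    (aestronglyMeasurable_of_hasSum hm₁ hh₁) (aestronglyMeasurable_of_hasSum hm₂ hh₂) ?_)
    (le_trans (add_le_add ?_ ?_) htot)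
  · filter_upwards [h, ae_all_iff.2 hsum, hh₁, hh₂] with z hz hz' hz₁ hz₂
    have := hz₁.add hz₂
    simp only [← hz'] at this
    exact hz.unique this
  · gcongr
    exact normY_tsum_le hh₁
  · simp only [normL1L2_eq_mix]
    refine le_trans (mix_mono fun z => ?_) (mix_tsum_le (fun n => (hm₂ n).enorm) one_le_two
      ENNReal.ofNat_ne_top le_rfl)
    exact enorm_tsum_le_tsum_enorm

/-- A decomposition of a function in `l^1_{2j} Y_j`, without cutoffs. -/
theorem exists_decomp_of_l1_normYj {j : ℕ} {g : ℝ × ℝ → ℂ} (h : 𝓓.l1 j (𝓓.normYj j) g ≠ ⊤)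
    {ε : ℝ≥0} (hε : 0 < ε) :
    ∃ g₁ g₂ : ℝ × ℝ → ℂ, AEStronglyMeasurable g₁ slabMeasure ∧
      AEStronglyMeasurable g₂ slabMeasure ∧ (∀ᵐ z ∂slabMeasure, g z = g₁ z + g₂ z) ∧
      ((2 : ℝ≥0∞) ^ j)⁻¹ * 𝓓.normY g₁ + ∑' m, mix 1 2 (𝓓.Q (2 * j) m) (fun z => ‖g₂ z‖ₑ) ≤
        ENNReal.ofReal 𝓓.cutoffConst * (𝓓.l1 j (𝓓.normYj j) g + ε) := by
  obtain ⟨ε', hε', hε''⟩ := ENNReal.exists_pos_sum_of_countable (ENNReal.coe_pos.2 hε).ne' ℤ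
  have h1 : ∀ m, 𝓓.normYj j (fun z => (𝓓.χ j m z.2 : ℂ) * g z) <
      𝓓.normYj j (fun z => (𝓓.χ j m z.2 : ℂ) * g z) + ε' m := fun m =>
    ENNReal.lt_add_right (ne_top_of_le_ne_top h (ENNReal.le_tsum m))
      (ENNReal.coe_pos.2 (hε' m)).ne'
  choose f₁ f₂ hm₁ hm₂ hsum hlt using fun m => exists_decomp_of_normYj_lt (h1 m)
  -- Division by `χ` on `Q` undoes the smooth cutoff, and the lower bound for `χ` keeps `θ` bounded.
  -- The resulting pieces have disjoint supports, so the decompositions of the `χ_Q g` glue together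
  -- to one of `g`.
  let θ : ℤ → ℝ → ℂ := fun m => (𝓓.Q (2 * j) m).indicator fun x => ((𝓓.χ j m x : ℝ) : ℂ)⁻¹
  have hθm : ∀ m, Measurable (θ m) := fun m =>
    (measurable_χ j m).inv.indicator (𝓓.measurableSet_Q _ _)
  have hθb : ∀ m x, ‖θ m x‖ₑ ≤ ENNReal.ofReal 𝓓.cutoffConst * (𝓓.Q (2 * j) m).indicator 1 x := by
    intro m x
    by_cases hx : x ∈ 𝓓.Q (2 * j) m
    · have hc := one_le_cutoffConst_mul_χ hx
      have hpos : 0 < 𝓓.χ j m x := by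
        by_contra! hcon
        nlinarith [𝓓.cutoffConst_pos]
      simp only [θ, indicator_of_mem hx, Pi.one_apply, mul_one]
      rw [← ofReal_norm, norm_inv, Complex.norm_real, Real.norm_of_nonneg hpos.le]
      refine ENNReal.ofReal_le_ofReal ?_
      rw [inv_le_iff_one_le_mul₀ hpos]
      exact hc
    · simp [θ, hx]
  have hθχ : ∀ m x, x ∈ 𝓓.Q (2 * j) m → θ m x * (𝓓.χ j m x : ℂ) = 1 := by
    intro m x hx
    have hc := one_le_cutoffConst_mul_χ hx
    have hpos : 𝓓.χ j m x ≠ 0 := by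
      intro h
      rw [h] at hc
      linarith
    simp only [θ, indicator_of_mem hx]
    exact inv_mul_cancel₀ (by exact_mod_cast hpos)
  let idx : ℝ → ℤ := fun x => ⌊(x - 𝓓.offset (2 * j)) / 2 ^ (2 * j)⌋
  have hidx : ∀ x, x ∈ 𝓓.Q (2 * j) (idx x) := fun x => 𝓓.mem_Q_iff.2 rfl
  have hsingle : ∀ (F : ℤ → ℝ × ℝ → ℂ) (z : ℝ × ℝ),
      HasSum (fun m => θ m z.2 * F m z) (θ (idx z.2) z.2 * F (idx z.2) z) := by
    intro F z
    refine hasSum_single (idx z.2) fun m hm => ?_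
    have : z.2 ∉ 𝓓.Q (2 * j) m := fun h => hm (𝓓.mem_Q_iff.1 h).symm
    simp [θ, this]
  have hmeas : ∀ {F : ℤ → ℝ × ℝ → ℂ}, (∀ m, AEStronglyMeasurable (F m) slabMeasure) →
      AEStronglyMeasurable (fun z => θ (idx z.2) z.2 * F (idx z.2) z) slabMeasure := by
    intro F hF
    obtain ⟨e⟩ : Nonempty (ℕ ≃ ℤ) := ⟨(Denumerable.eqv ℤ).symm⟩
    have hs : ∀ z : ℝ × ℝ, HasSum (fun n => θ (e n) z.2 * F (e n) z)
        (θ (idx z.2) z.2 * F (idx z.2) z) := fun z =>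
      (e.hasSum_iff (f := fun m => θ m z.2 * F m z)).2 (hsingle F z)
    refine aestronglyMeasurable_of_hasSum (g := fun n z => θ (e n) z.2 * F (e n) z) (fun n => ?_)
      (Eventually.of_forall hs)
    exact ((hθm _).comp measurable_snd).aestronglyMeasurable.mul (hF _)
  refine ⟨fun z => θ (idx z.2) z.2 * f₁ (idx z.2) z, fun z => θ (idx z.2) z.2 * f₂ (idx z.2) z,
    hmeas hm₁, hmeas hm₂, ?_, ?_⟩
  · filter_upwards [ae_all_iff.2 hsum] with z hz
    rw [← mul_add, ← hz, ← mul_assoc, hθχ _ _ (hidx _), one_mul]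
  · have hB : (ENNReal.ofReal 𝓓.cutoffConst) = (𝓓.cutoffConst.toNNReal : ℝ≥0∞) := rfl
    have e1 : 𝓓.normY (fun z => θ (idx z.2) z.2 * f₁ (idx z.2) z) ≤
        ENNReal.ofReal 𝓓.cutoffConst * ∑' m, 𝓓.normY (f₁ m) := by
      refine (normY_tsum_le (Eventually.of_forall fun z => hsingle f₁ z)).trans ?_
      rw [← ENNReal.tsum_mul_left]
      refine ENNReal.tsum_le_tsum fun m => ?_
      refine normY_mul_le ((hθm _).comp measurable_snd).aestronglyMeasurable
        (Eventually.of_forall fun z => (hθb m z.2).trans ?_)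
      rw [← hB]
      refine mul_le_of_le_one_right zero_le ?_
      exact indicator_le_self' (fun _ _ => zero_le) _
    have e2 : ∀ m, mix 1 2 (𝓓.Q (2 * j) m) (fun z => ‖θ (idx z.2) z.2 * f₂ (idx z.2) z‖ₑ) ≤
        ENNReal.ofReal 𝓓.cutoffConst * normL1L2 (f₂ m) := by
      intro m
      rw [normL1L2_eq_mix, ← mix_indicator (𝓓.measurableSet_Q _ _)]
      refine le_trans (mix_mono fun z => ?_) (mix_const_mul_le _ ENNReal.ofReal_ne_top _)
      by_cases hz : z.2 ∈ 𝓓.Q (2 * j) m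
      · have : idx z.2 = m := 𝓓.mem_Q_iff.1 hz
        rw [indicator_of_mem hz, this, enorm_mul]
        simp only [Pi.one_apply, one_mul]
        gcongr
        have := hθb m z.2
        rwa [indicator_of_mem hz, Pi.one_apply, mul_one] at this
      · simp [hz]
    calc _ ≤ ((2 : ℝ≥0∞) ^ j)⁻¹ * (ENNReal.ofReal 𝓓.cutoffConst * ∑' m, 𝓓.normY (f₁ m)) +
          ∑' m, ENNReal.ofReal 𝓓.cutoffConst * normL1L2 (f₂ m) := by
          gcongr with m
          exact e2 m
      _ = ENNReal.ofReal 𝓓.cutoffConst *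
          ∑' m, (((2 : ℝ≥0∞) ^ j)⁻¹ * 𝓓.normY (f₁ m) + normL1L2 (f₂ m)) := by
          rw [ENNReal.tsum_mul_left, ENNReal.tsum_add, ENNReal.tsum_mul_left]
          ring
      _ ≤ ENNReal.ofReal 𝓓.cutoffConst *
          ∑' m, (𝓓.normYj j (fun z => (𝓓.χ j m z.2 : ℂ) * g z) + ε' m) := by
          refine mul_le_mul' le_rfl (ENNReal.tsum_le_tsum fun m => (hlt m).le)
      _ ≤ _ := by
          rw [ENNReal.tsum_add, l1]
          gcongr

end Setup

end BilEst

end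

/-! ### Summation over frequencies and reduction to Littlewood-Paley pieces. -/

noncomputable section

namespace BilEst

open Filter Topology SchwartzMap

/-! ### Square summable sequences -/

/-- The `ℓ²` norm of a sequence. -/
def l2 (f : ℕ → ℝ≥0∞) : ℝ≥0∞ := (∑' i, f i ^ 2) ^ (1 / 2 : ℝ)

theorem l2_eq_eLpNorm (f : ℕ → ℝ≥0∞) : l2 f = eLpNorm f 2 Measure.count := by
  rw [eLpNorm_two_eq, lintegral_count, l2]

theorem l2_mono {f g : ℕ → ℝ≥0∞} (h : ∀ i, f i ≤ g i) : l2 f ≤ l2 g := by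
  unfold l2
  gcongr with i
  exact h i

theorem l2_const_mul (c : ℝ≥0∞) (f : ℕ → ℝ≥0∞) : l2 (fun i => c * f i) = c * l2 f := by
  unfold l2
  simp_rw [mul_pow]
  rw [ENNReal.tsum_mul_left, ENNReal.mul_rpow_of_nonneg _ _ (by norm_num), ← ENNReal.rpow_two,
    ← ENNReal.rpow_mul]
  norm_num

theorem l2_add_le (f g : ℕ → ℝ≥0∞) : l2 (fun i => f i + g i) ≤ l2 f + l2 g := by
  simp only [l2_eq_eLpNorm]
  exact eLpNorm_add_le (measurable_of_countable f).aestronglyMeasurable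
    (measurable_of_countable g).aestronglyMeasurable one_le_two

theorem le_l2 (f : ℕ → ℝ≥0∞) (i : ℕ) : f i ≤ l2 f := by
  calc f i = (f i ^ 2) ^ (1 / 2 : ℝ) := by
        rw [← ENNReal.rpow_two, ← ENNReal.rpow_mul]
        norm_num
    _ ≤ l2 f := by
        unfold l2
        gcongr
        exact ENNReal.le_tsum (f := fun i => f i ^ 2) i

theorem l2_le_of_sq_le {f : ℕ → ℝ≥0∞} {C : ℝ≥0∞} (h : ∑' i, f i ^ 2 ≤ C ^ 2) : l2 f ≤ C := by
  calc l2 f ≤ (C ^ 2) ^ (1 / 2 : ℝ) := by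
        unfold l2
        gcongr
    _ = C := by
        rw [← ENNReal.rpow_two, ← ENNReal.rpow_mul]
        norm_num

theorem l2_le_tsum (f : ℕ → ℝ≥0∞) : l2 f ≤ ∑' i, f i := by
  refine l2_le_of_sq_le ?_
  rw [sq, ← ENNReal.tsum_mul_right]
  refine ENNReal.tsum_le_tsum fun i => ?_
  rw [sq]
  gcongr
  exact ENNReal.le_tsum i

theorem tsum_ite_Icc (i : ℕ) (f : ℕ → ℝ≥0∞) :
    ∑' j, (if j ∈ Finset.Icc (i - 2) (i + 2) then f j else 0) =
      ∑ j ∈ Finset.Icc (i - 2) (i + 2), f j := by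
  rw [tsum_eq_sum (s := Finset.Icc (i - 2) (i + 2)) fun j hj => if_neg hj]
  exact Finset.sum_congr rfl fun j hj => if_pos hj

theorem card_Icc_le (i : ℕ) : ((Finset.Icc (i - 2) (i + 2)).card : ℝ≥0∞) ≤ 5 := by
  rw [Nat.card_Icc]
  exact_mod_cast (by omega : i + 2 + 1 - (i - 2) ≤ 5)

/-- A window has at most five entries and an index lies in at most five windows; Cauchy-Schwarz
inside the windows and an exchange of sums cost `5 * 5`. -/
theorem l2_window_le (a : ℕ → ℝ≥0∞) :
    l2 (fun i => ∑' j, if j ∈ Finset.Icc (i - 2) (i + 2) then a j else 0) ≤ 5 * l2 a := by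
  refine l2_le_of_sq_le ?_
  have hsq : (5 * l2 a) ^ 2 = 5 * ∑' j, 5 * a j ^ 2 := by
    rw [mul_pow, l2, ← ENNReal.rpow_two (_ ^ (1 / 2 : ℝ)), ← ENNReal.rpow_mul,
      ENNReal.tsum_mul_left, ← mul_assoc]
    norm_num
  calc ∑' i, (∑' j, if j ∈ Finset.Icc (i - 2) (i + 2) then a j else 0) ^ 2
      ≤ ∑' i, 5 * ∑' j, (if j ∈ Finset.Icc (i - 2) (i + 2) then a j ^ 2 else 0) := by
        refine ENNReal.tsum_le_tsum fun i => ?_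
        rw [tsum_ite_Icc, tsum_ite_Icc, ← ENNReal.rpow_two]
        refine (ENNReal.rpow_sum_le_const_mul_sum_rpow _ _ (by norm_num)).trans ?_
        norm_num only
        simp only [ENNReal.rpow_one, ENNReal.rpow_two]
        gcongr
        exact card_Icc_le i
    _ = 5 * ∑' j, ∑' i, (if j ∈ Finset.Icc (i - 2) (i + 2) then a j ^ 2 else 0) := by
        rw [ENNReal.tsum_mul_left, ENNReal.tsum_comm]
    _ ≤ 5 * ∑' j, 5 * a j ^ 2 := by
        gcongr with j
        have hc : ∀ i, (j ∈ Finset.Icc (i - 2) (i + 2)) ↔ i ∈ Finset.Icc (j - 2) (j + 2) := by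
          intro i
          simp only [Finset.mem_Icc]
          omega
        simp only [hc]
        rw [tsum_ite_Icc, Finset.sum_const, nsmul_eq_mul]
        gcongr
        exact card_Icc_le j
    _ = _ := hsq.symm

/-- A geometric weight. -/
def geo (ε : ℝ) (k : ℕ) : ℝ≥0∞ := 2 ^ (-(ε * k))

theorem tsum_geo_ne_top {ε : ℝ} (hε : 0 < ε) : ∑' k, geo ε k ≠ ⊤ := by
  have h : ∀ k, geo ε k = (2 ^ (-ε)) ^ k := fun k => by
    rw [geo, ← ENNReal.rpow_natCast, ← ENNReal.rpow_mul, neg_mul]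
  simp_rw [h, ENNReal.tsum_geometric]
  refine ENNReal.inv_ne_top.2 (tsub_pos_of_lt ?_).ne'
  exact ENNReal.rpow_lt_one_of_one_lt_of_neg (by norm_num) (by linarith)

theorem geo_le_geo {ε ε' : ℝ} {k k' : ℕ} (h : ε' * k' ≤ ε * k) : geo ε k ≤ geo ε' k' :=
  two_rpow_le_two_rpow (by linarith)

theorem tsum_geo_mul_le (ε : ℝ) (b : ℕ → ℝ≥0∞) :
    ∑' k, geo ε k * b k ≤ (∑' k, geo ε k) * l2 b := by
  rw [← ENNReal.tsum_mul_right]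
  exact ENNReal.tsum_le_tsum fun k => mul_le_mul' le_rfl (le_l2 b k)

/-- The three types of interacting frequencies: one of them is the smallest and the other two are
comparable. -/
theorem Setup.Interact.cases {i j k : ℕ} (h : Setup.Interact i j k) :
    (k ≤ i ∧ k ≤ j ∧ i ≤ j + 2 ∧ j ≤ i + 2) ∨ (j ≤ i ∧ j ≤ k ∧ i ≤ k + 2 ∧ k ≤ i + 2) ∨
      (i ≤ j ∧ i ≤ k ∧ j ≤ k + 2 ∧ k ≤ j + 2) := by
  unfold Setup.Interact at h
  omega

theorem Setup.Interact.symm {i j k : ℕ} (h : Setup.Interact i j k) : Setup.Interact i k j := by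
  unfold Setup.Interact at *
  omega

/-- The constant in `l2_bilinear_le`. -/
def bilinearConst (ε : ℝ) : ℝ≥0∞ :=
  10 * (∑' k, geo (ε / 2) k) + 5 * 2 ^ (2 * ε) * (∑' k, geo (ε / 2) k) ^ 2

theorem bilinearConst_ne_top {ε : ℝ} (hε : 0 < ε) : bilinearConst ε ≠ ⊤ := by
  have := tsum_geo_ne_top (half_pos hε)
  have h2 := two_rpow_ne_top (2 * ε)
  unfold bilinearConst
  finiteness

/-- Each summand on the right serves one regime. If the output frequency is among the high ones, the
decay falls on the low frequency factor. In the high-high regime half of the decay is spent on the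
output index `i` and half on the sum over `j`; the factor `2^(2ε)` pays for `j ≤ min j k + 2`. -/
theorem geo_mul_le {ε : ℝ} (hε : 0 < ε) {i j k : ℕ} (h : Setup.Interact i j k) (a b : ℕ → ℝ≥0∞) :
    geo ε (min j k) * (a j * b k) ≤
      (if j ∈ Finset.Icc (i - 2) (i + 2) then a j else 0) * (geo (ε / 2) k * b k) +
      (geo (ε / 2) j * a j) * (if k ∈ Finset.Icc (i - 2) (i + 2) then b k else 0) +
      (2 ^ (2 * ε) * (l2 a * l2 b) * geo (ε / 2) i) *
        (geo (ε / 2) j * (if k ∈ Finset.Icc (j - 2) (j + 2) then 1 else 0)) := by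
  rcases h.cases with h | h | h
  · refine le_add_right (le_add_right ?_)
    rw [if_pos (Finset.mem_Icc.2 (by omega)), min_eq_right h.2.1, mul_left_comm]
    gcongr
    exact geo_le_geo (by nlinarith [(Nat.cast_nonneg k : (0 : ℝ) ≤ k)])
  · refine le_add_right (le_add_left ?_)
    rw [if_pos (Finset.mem_Icc.2 (by omega)), min_eq_left h.2.1, mul_assoc]
    gcongr
    exact geo_le_geo (by nlinarith [(Nat.cast_nonneg j : (0 : ℝ) ≤ j)])
  · refine le_add_left ?_
    rw [if_pos (Finset.mem_Icc.2 (by omega)), mul_one]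
    have hg : geo ε (min j k) ≤ 2 ^ (2 * ε) * (geo (ε / 2) i * geo (ε / 2) j) := by
      unfold geo
      rw [← two_rpow_add, ← two_rpow_add]
      refine two_rpow_le_two_rpow ?_
      have h1 : (j : ℝ) ≤ (min j k : ℕ) + 2 := by exact_mod_cast (by omega : j ≤ min j k + 2)
      have h2 : (i : ℝ) ≤ j := by exact_mod_cast h.1
      nlinarith
    calc geo ε (min j k) * (a j * b k)
        ≤ 2 ^ (2 * ε) * (geo (ε / 2) i * geo (ε / 2) j) * (l2 a * l2 b) := by
          gcongr
          · exact le_l2 a j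
          · exact le_l2 b k
      _ = _ := by ring

/-- Summation of trilinear bounds with off-diagonal decay. -/
theorem l2_bilinear_le {ε : ℝ} (hε : 0 < ε) {a b : ℕ → ℝ≥0∞} {T : ℕ → ℕ → ℕ → ℝ≥0∞}
    (h : ∀ i j k, Setup.Interact i j k → T i j k ≤ geo ε (min j k) * (a j * b k))
    (h0 : ∀ i j k, ¬ Setup.Interact i j k → T i j k = 0) :
    l2 (fun i => ∑' p : ℕ × ℕ, T i p.1 p.2) ≤ bilinearConst ε * (l2 a * l2 b) := by
  set R := ∑' k, geo (ε / 2) k with hR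
  have key : ∀ i, ∑' p : ℕ × ℕ, T i p.1 p.2 ≤
      (R * l2 b) * (∑' j, if j ∈ Finset.Icc (i - 2) (i + 2) then a j else 0) +
      (R * l2 a) * (∑' k, if k ∈ Finset.Icc (i - 2) (i + 2) then b k else 0) +
      (2 ^ (2 * ε) * (l2 a * l2 b) * (R * 5)) * geo (ε / 2) i := by
    intro i
    calc ∑' p : ℕ × ℕ, T i p.1 p.2
        = ∑' j, ∑' k, T i j k := ENNReal.tsum_prod
      _ ≤ ∑' j, ∑' k,
          ((if j ∈ Finset.Icc (i - 2) (i + 2) then a j else 0) * (geo (ε / 2) k * b k) +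
          (geo (ε / 2) j * a j) * (if k ∈ Finset.Icc (i - 2) (i + 2) then b k else 0) +
          (2 ^ (2 * ε) * (l2 a * l2 b) * geo (ε / 2) i) *
            (geo (ε / 2) j * (if k ∈ Finset.Icc (j - 2) (j + 2) then 1 else 0))) := by
          gcongr with j k
          by_cases hI : Setup.Interact i j k
          · exact (h i j k hI).trans (geo_mul_le hε hI a b)
          · rw [h0 i j k hI]
            exact zero_le
      _ = (∑' j, if j ∈ Finset.Icc (i - 2) (i + 2) then a j else 0) * (∑' k, geo (ε / 2) k * b k) +
          (∑' j, geo (ε / 2) j * a j) *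
            (∑' k, if k ∈ Finset.Icc (i - 2) (i + 2) then b k else 0) +
          (2 ^ (2 * ε) * (l2 a * l2 b) * geo (ε / 2) i) *
            ∑' j, (geo (ε / 2) j * ∑' k, (if k ∈ Finset.Icc (j - 2) (j + 2) then 1 else 0)) := by
          simp_rw [ENNReal.tsum_add, ENNReal.tsum_mul_left, ENNReal.tsum_mul_right]
      _ ≤ (∑' j, if j ∈ Finset.Icc (i - 2) (i + 2) then a j else 0) * (R * l2 b) +
          (R * l2 a) * (∑' k, if k ∈ Finset.Icc (i - 2) (i + 2) then b k else 0) +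
          (2 ^ (2 * ε) * (l2 a * l2 b) * geo (ε / 2) i) * (R * 5) := by
          gcongr
          · exact tsum_geo_mul_le _ b
          · exact tsum_geo_mul_le _ a
          · rw [hR, ← ENNReal.tsum_mul_right]
            gcongr with j
            rw [tsum_ite_Icc, Finset.sum_const, nsmul_eq_mul, mul_one]
            exact card_Icc_le j
      _ = _ := by ring
  calc _ ≤ _ := l2_mono key
    _ ≤ l2 (fun i => (R * l2 b) * ∑' j, if j ∈ Finset.Icc (i - 2) (i + 2) then a j else 0) +
        l2 (fun i => (R * l2 a) * ∑' k, if k ∈ Finset.Icc (i - 2) (i + 2) then b k else 0) +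
        l2 (fun i => (2 ^ (2 * ε) * (l2 a * l2 b) * (R * 5)) * geo (ε / 2) i) :=
        (l2_add_le _ _).trans (add_le_add (l2_add_le _ _) le_rfl)
    _ ≤ (R * l2 b) * (5 * l2 a) + (R * l2 a) * (5 * l2 b) +
        (2 ^ (2 * ε) * (l2 a * l2 b) * (R * 5)) * R := by
        simp only [l2_const_mul]
        gcongr
        · exact l2_window_le a
        · exact l2_window_le b
        · exact l2_le_tsum _
    _ = _ := by
        rw [bilinearConst, ← hR]
        ring

/-! ### Norms of space-time functions -/

/-- The properties of a norm of space-time functions that are used to sum a series. -/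
structure IsSpaceTimeNorm (V : (ℝ × ℝ → ℂ) → ℝ≥0∞) : Prop where
  zero : V (fun _ => 0) = 0
  tsum_le : ∀ {f : ℝ × ℝ → ℂ} {g : ℕ → ℝ × ℝ → ℂ},
    (∀ n, AEStronglyMeasurable (g n) slabMeasure) →
    (∀ᵐ z ∂slabMeasure, HasSum (fun n => g n z) (f z)) → V f ≤ ∑' n, V (g n)
  exists_mix_le : ∃ C ≠ ⊤, ∀ f, AEStronglyMeasurable f slabMeasure →
    mix 1 2 univ (fun z => ‖f z‖ₑ) ≤ C * V f

theorem IsSpaceTimeNorm.eq_zero {V : (ℝ × ℝ → ℂ) → ℝ≥0∞} (hV : IsSpaceTimeNorm V)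
    {f : ℝ × ℝ → ℂ} (h : ∀ᵐ z ∂slabMeasure, f z = 0) : V f = 0 := by
  have := hV.tsum_le (f := f) (g := fun _ _ => 0) (fun _ => aestronglyMeasurable_const)
    (h.mono fun z hz => by rw [hz]; exact hasSum_zero)
  simpa [hV.zero] using this

theorem isSpaceTimeNorm_normL1L2 : IsSpaceTimeNorm normL1L2 where
  zero := Setup.normL1L2_zero
  tsum_le {f g} hg h := by
    simp only [normL1L2_eq_mix]
    refine le_trans (mix_mono_ae ?_) (mix_tsum_le (fun n => (hg n).enorm) one_le_two
      ENNReal.ofNat_ne_top le_rfl)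
    filter_upwards [Measure.ae_ae_of_ae_prod h] with t ht
    filter_upwards [ht] with x hx
    rw [← hx.tsum_eq]
    exact enorm_tsum_le_tsum_enorm
  exists_mix_le := ⟨1, ENNReal.one_ne_top, fun f _ => by rw [one_mul, normL1L2_eq_mix]⟩

namespace Setup

variable {𝓓 : Setup}

theorem isSpaceTimeNorm_normYj (j : ℕ) : IsSpaceTimeNorm (𝓓.normYj j) where
  zero := by
    have := normYj_le_normL1L2 (𝓓 := 𝓓) j (f := fun _ => 0) aestronglyMeasurable_const
    rw [normL1L2_zero] at this
    simpa using this
  tsum_le _ h := normYj_tsum_le h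
  exists_mix_le := ⟨2 ^ j, two_pow_ne_top' j, fun f _ => mix_le_normYj j f⟩

theorem xn_mono_ae {E : Set ℝ} {F G : ℝ × ℝ → ℝ≥0∞} (h : ∀ᵐ z ∂slabMeasure, F z ≤ G z) :
    𝓓.xn E F ≤ 𝓓.xn E G := by
  calc 𝓓.xn E F ≤ 𝓓.xn E (fun z => max (F z) (G z)) := xn_mono fun z => le_max_left _ _
    _ = 𝓓.xn E G := xn_congr_ae (h.mono fun z hz => max_eq_right hz)

theorem isSpaceTimeNorm_normXj (j : ℕ) : IsSpaceTimeNorm (𝓓.normXj j) where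
  zero := by
    simp [normXj, normX_eq_xn (aestronglyMeasurable_const (b := (0 : ℂ))), xn, normLinfL2_eq_mix,
      mix]
    rfl
  tsum_le {f g} hg h := by
    have hf := aestronglyMeasurable_of_hasSum hg h
    have hle : ∀ᵐ z ∂slabMeasure, ‖f z‖ₑ ≤ ∑' n, ‖g n z‖ₑ := by
      filter_upwards [h] with z hz
      rw [← hz.tsum_eq]
      exact enorm_tsum_le_tsum_enorm
    simp only [normXj, normX_eq_xn hf, normX_eq_xn (hg _), normLinfL2_eq_mix]
    rw [ENNReal.tsum_add, ENNReal.tsum_mul_left]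
    gcongr
    · exact (xn_mono_ae hle).trans (xn_tsum_le fun n => (hg n).enorm)
    · exact (mix_mono_ae (Measure.ae_ae_of_ae_prod hle)).trans
        (mix_tsum_le (fun n => (hg n).enorm) one_le_two ENNReal.ofNat_ne_top le_top)
  exists_mix_le := by
    refine ⟨1, ENNReal.one_ne_top, fun f hf => ?_⟩
    rw [one_mul, normXj, normLinfL2_eq_mix]
    exact le_add_left (mix_le_mix_time le_top hf.enorm two_ne_zero ENNReal.ofNat_ne_top)

theorem l1_eq_zero {V : (ℝ × ℝ → ℂ) → ℝ≥0∞} (hV : IsSpaceTimeNorm V) (i : ℕ) {f : ℝ × ℝ → ℂ}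
    (h : ∀ᵐ z ∂slabMeasure, f z = 0) : 𝓓.l1 i V f = 0 := by
  rw [l1, ENNReal.tsum_eq_zero]
  intro m
  refine hV.eq_zero ?_
  filter_upwards [h] with z hz
  rw [hz, mul_zero]

theorem l1_tsum_le {ι : Type*} [Denumerable ι] {V : (ℝ × ℝ → ℂ) → ℝ≥0∞} (hV : IsSpaceTimeNorm V)
    (i : ℕ) {f : ℝ × ℝ → ℂ} {g : ι → ℝ × ℝ → ℂ}
    (hg : ∀ n, AEStronglyMeasurable (g n) slabMeasure)
    (h : ∀ᵐ z ∂slabMeasure, HasSum (fun n => g n z) (f z)) :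
    𝓓.l1 i V f ≤ ∑' n, 𝓓.l1 i V (g n) := by
  obtain ⟨e⟩ : Nonempty (ℕ ≃ ι) := ⟨(Denumerable.eqv ι).symm⟩
  rw [← e.tsum_eq]
  simp only [l1]
  rw [ENNReal.tsum_comm]
  gcongr with m
  refine hV.tsum_le (fun n => aestronglyMeasurable_χ_mul (hg _) i m) ?_
  filter_upwards [h] with z hz
  exact ((e.hasSum_iff (f := fun n => g n z)).2 hz).mul_left _

theorem exists_mix_le_l1 {V : (ℝ × ℝ → ℂ) → ℝ≥0∞} (hV : IsSpaceTimeNorm V) (i : ℕ) :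
    ∃ C ≠ ⊤, ∀ f, AEStronglyMeasurable f slabMeasure → ∀ m,
      mix 1 2 (𝓓.Q (2 * i) m) (fun z => ‖f z‖ₑ) ≤ C * 𝓓.l1 i V f := by
  obtain ⟨C, hC, h⟩ := hV.exists_mix_le
  refine ⟨ENNReal.ofReal 𝓓.cutoffConst * C, ENNReal.mul_ne_top ENNReal.ofReal_ne_top hC,
    fun f hf m => ?_⟩
  refine (mix_Q_le_χ f i m).trans ?_
  rw [mul_assoc]
  gcongr
  refine (h _ (aestronglyMeasurable_χ_mul hf i m)).trans ?_
  gcongr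
  exact ENNReal.le_tsum (f := fun m => V (fun z => (𝓓.χ i m z.2 : ℂ) * f z)) m

/-- Convergence almost everywhere from convergence in norm. -/
theorem ae_summable_of_tsum_l1 {ι : Type*} [Countable ι] {V : (ℝ × ℝ → ℂ) → ℝ≥0∞}
    (hV : IsSpaceTimeNorm V) (i : ℕ) {g : ι → ℝ × ℝ → ℂ}
    (hg : ∀ n, AEStronglyMeasurable (g n) slabMeasure) (h : ∑' n, 𝓓.l1 i V (g n) ≠ ⊤) :
    ∀ᵐ z ∂slabMeasure, Summable fun n => g n z := by
  obtain ⟨C, hC, hCm⟩ := exists_mix_le_l1 (𝓓 := 𝓓) hV i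
  have hm : ∀ m, ∀ᵐ z ∂slabMeasure, z.2 ∈ 𝓓.Q (2 * i) m → ∑' n, ‖g n z‖ₑ < ⊤ := fun m =>
    ae_tsum_lt_top (fun n => (hg n).enorm) (𝓓.measurableSet_Q _ _)
      (ne_top_of_le_ne_top (ENNReal.mul_ne_top hC h) (by
        rw [← ENNReal.tsum_mul_left]
        exact ENNReal.tsum_le_tsum fun n => hCm _ (hg n) m))
  filter_upwards [ae_all_iff.2 hm] with z hz
  obtain ⟨m, hzm⟩ := 𝓓.exists_mem_Q (2 * i) z.2
  exact summable_of_tsum_enorm_lt_top (hz m hzm)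

/-! ### Products of functions with tempered slices -/

theorem _root_.BilEst.TemperedSlices.aestronglyMeasurable {u : ℝ × ℝ → ℂ} (hu : TemperedSlices u) :
    AEStronglyMeasurable u slabMeasure := by
  rw [← restrict_slab]
  exact hu.1

theorem _root_.BilEst.TemperedSlices.ae_slice {u : ℝ × ℝ → ℂ} (hu : TemperedSlices u) :
    ∀ᵐ t ∂timeMeasure, TemperedFun fun x => u (t, x) := hu.2

theorem aestronglyMeasurable_St {u : ℝ × ℝ → ℂ} (hu : AEStronglyMeasurable u slabMeasure) (j : ℕ) :
    AEStronglyMeasurable (𝓓.St j u) slabMeasure := by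
  rw [St_eq_convt]
  exact aestronglyMeasurable_convt _ hu

/-- The uniform norm of a function on the slab. -/
def _root_.BilEst.supNorm (u : ℝ × ℝ → ℂ) : ℝ≥0∞ := mix ⊤ ⊤ univ (fun z => ‖u z‖ₑ)

theorem _root_.BilEst.ae_enorm_le_supNorm (u : ℝ × ℝ → ℂ) :
    ∀ᵐ t ∂timeMeasure, ∀ᵐ x, ‖u (t, x)‖ₑ ≤ supNorm u := by
  filter_upwards [le_eLpNorm_top_ae (ν := timeMeasure)
    (fun t => eLpNorm (fun x => ‖u (t, x)‖ₑ) ⊤ (volume.restrict univ))] with t ht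
  have := le_eLpNorm_top_ae (ν := volume.restrict univ) (fun x => ‖u (t, x)‖ₑ)
  rw [Measure.restrict_univ] at this ht
  filter_upwards [this] with x hx
  refine hx.trans (ht.trans ?_)
  simp only [supNorm, mix, Measure.restrict_univ]
  exact le_rfl

theorem enorm_St_le_supNorm {u : ℝ × ℝ → ℂ} (hu : TemperedSlices u) :
    ∀ᵐ t ∂timeMeasure, ∀ j x, ‖𝓓.St j u (t, x)‖ₑ ≤ supNorm (𝓓.St j u) := by
  filter_upwards [hu.ae_slice, ae_all_iff.2 fun j => ae_enorm_le_supNorm (𝓓.St j u)] with t ht h j x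
  refine (enorm_S_le_eLpNorm_top 𝓓 j ht x).trans ?_
  refine (eLpNorm_exponent_top (f := 𝓓.S j fun x => u (t, x))).trans_le ?_
  exact eLpNormEssSup_le_of_ae_enorm_bound (h j)

/-- Time slices of a function whose Littlewood-Paley pieces are absolutely summable. -/
theorem exists_summable_bound {u : ℝ × ℝ → ℂ} (hu : TemperedSlices u)
    (h : ∑' j, supNorm (𝓓.St j u) ≠ ⊤) : ∃ B : ℕ → ℝ, Summable B ∧
      ∀ᵐ t ∂timeMeasure, ∀ j x, ‖𝓓.S j (fun y => u (t, y)) x‖ ≤ B j := by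
  refine ⟨fun j => (supNorm (𝓓.St j u)).toReal, ENNReal.summable_toReal h, ?_⟩
  filter_upwards [enorm_St_le_supNorm (𝓓 := 𝓓) hu] with t ht j x
  have := ENNReal.toReal_mono (ENNReal.ne_top_of_tsum_ne_top h j) (ht j x)
  rwa [toReal_enorm] at this

theorem temperedSlices_mul {u v : ℝ × ℝ → ℂ} (hu : TemperedSlices u) (hv : TemperedSlices v)
    (h : ∑' j, supNorm (𝓓.St j v) ≠ ⊤) : TemperedSlices fun z => u z * v z := by
  obtain ⟨B, hB, hvB⟩ := exists_summable_bound hv h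
  refine ⟨hu.1.mul hv.1, ?_⟩
  filter_upwards [hu.2, hv.2, hvB] with t hut hvt hB'
  exact hut.mul_bounded hvt.aestronglyMeasurable (norm_ae_le_tsum _ hvt hB hB')

/-- If the right side is finite, the double series converges absolutely almost everywhere. Its sum
is then identified along squares of indices by `tendsto_sum_S_mul`, and countable subadditivity of
the norm applies. -/
theorem l1_St_mul_le_tsum {V : (ℝ × ℝ → ℂ) → ℝ≥0∞} (hV : IsSpaceTimeNorm V) (i : ℕ)
    {u v : ℝ × ℝ → ℂ} (hu : TemperedSlices u) (hv : TemperedSlices v)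
    (h : ∑' j, supNorm (𝓓.St j v) ≠ ⊤) :
    𝓓.l1 i V (𝓓.St i fun z => u z * v z) ≤
      ∑' p : ℕ × ℕ, 𝓓.l1 i V (𝓓.St i fun z => 𝓓.St p.1 u z * 𝓓.St p.2 v z) := by
  by_cases htop : ∑' p : ℕ × ℕ, 𝓓.l1 i V (𝓓.St i fun z => 𝓓.St p.1 u z * 𝓓.St p.2 v z) = ⊤
  · rw [htop]
    exact le_top
  have hm : ∀ p : ℕ × ℕ, AEStronglyMeasurable
      (𝓓.St i fun z => 𝓓.St p.1 u z * 𝓓.St p.2 v z) slabMeasure := fun p =>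
    aestronglyMeasurable_St ((aestronglyMeasurable_St hu.aestronglyMeasurable _).mul
      (aestronglyMeasurable_St hv.aestronglyMeasurable _)) i
  refine l1_tsum_le hV i hm ?_
  obtain ⟨B, hB, hvB⟩ := exists_summable_bound hv h
  filter_upwards [ae_summable_of_tsum_l1 hV i hm htop,
    ae_slab_of_ae_time hu.ae_slice, ae_slab_of_ae_time hv.ae_slice, ae_slab_of_ae_time hvB]
    with z hz hut hvt hB'
  have h1 := tendsto_sum_S_mul 𝓓 hut hvt hB hB' i z.2
  have hT : Tendsto (fun J => Finset.range (J + 1) ×ˢ Finset.range (J + 1)) atTop atTop := by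
    refine tendsto_atTop_finset_of_monotone (fun J K hJK => ?_) fun p => ⟨max p.1 p.2, ?_⟩
    · exact Finset.product_subset_product (Finset.range_mono (by omega))
        (Finset.range_mono (by omega))
    · simp only [Finset.mem_product, Finset.mem_range]
      omega
  have h2 := hz.hasSum.comp hT
  have h3 : ∑' p : ℕ × ℕ, 𝓓.St i (fun z => 𝓓.St p.1 u z * 𝓓.St p.2 v z) z =
      𝓓.St i (fun z => u z * v z) z := tendsto_nhds_unique h2 h1
  rw [← h3]
  exact hz.hasSum

theorem l1_St_mul_eq_zero {V : (ℝ × ℝ → ℂ) → ℝ≥0∞} (hV : IsSpaceTimeNorm V) {i j k : ℕ}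
    (h : ¬ Interact i j k) {u v : ℝ × ℝ → ℂ} (hu : TemperedSlices u) (hv : TemperedSlices v) :
    𝓓.l1 i V (𝓓.St i fun z => 𝓓.St j u z * 𝓓.St k v z) = 0 := by
  refine l1_eq_zero hV i ?_
  filter_upwards [ae_slab_of_ae_time hu.ae_slice, ae_slab_of_ae_time hv.ae_slice] with z hut hvt
  exact S_mul_eq_zero 𝓓 h hut hvt z.2

/-- The norm `(∑_j 2^{2sj} ‖S_j u‖²_{l^1_{2j} V_j})^{1/2}`. -/
def besov (𝓓 : Setup) (V : ℕ → (ℝ × ℝ → ℂ) → ℝ≥0∞) (s : ℝ) (u : ℝ × ℝ → ℂ) : ℝ≥0∞ :=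
  l2 fun j => 2 ^ (s * j) * 𝓓.l1 j (V j) (𝓓.St j u)

theorem besov_eq (V : ℕ → (ℝ × ℝ → ℂ) → ℝ≥0∞) (s : ℝ) (u : ℝ × ℝ → ℂ) :
    𝓓.besov V s u =
      (∑' j : ℕ, (2 : ℝ≥0∞) ^ (2 * s * j) * 𝓓.l1 j (V j) (𝓓.St j u) ^ 2) ^ (1 / 2 : ℝ) := by
  unfold besov l2
  congr 2
  ext j
  rw [mul_pow, ← ENNReal.rpow_two (2 ^ (s * j)), ← ENNReal.rpow_mul]
  ring_nf

/-- The product estimate, reduced to estimates of products of Littlewood-Paley pieces. -/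
theorem besov_mul_le {V : ℕ → (ℝ × ℝ → ℂ) → ℝ≥0∞} (hV : ∀ i, IsSpaceTimeNorm (V i)) {ε s : ℝ}
    (hε : 0 < ε) {u v : ℝ × ℝ → ℂ} (hu : TemperedSlices u) (hv : TemperedSlices v)
    (hb : ∑' j, supNorm (𝓓.St j u) ≠ ⊤ ∨ ∑' j, supNorm (𝓓.St j v) ≠ ⊤) {C : ℝ≥0∞}
    {a b : ℕ → ℝ≥0∞}
    (h : ∀ i j k, Interact i j k →
      2 ^ (s * i) * 𝓓.l1 i (V i) (𝓓.St i fun z => 𝓓.St j u z * 𝓓.St k v z) ≤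
        C * (geo ε (min j k) * (a j * b k))) :
    TemperedSlices (fun z => u z * v z) ∧
      𝓓.besov V s (fun z => u z * v z) ≤ C * bilinearConst ε * l2 a * l2 b := by
  -- Interaction, the minimum and the product are symmetric, so `v` may be taken as the factor with
  -- summable sup norms.
  wlog hbv : ∑' j, supNorm (𝓓.St j v) ≠ ⊤ generalizing u v a b with H
  · have := @H v u hv hu hb.symm b a (fun i j k hI => by
      have := h i k j (Interact.symm hI)
      simp only [mul_comm (𝓓.St j v _)]
      rwa [min_comm, mul_comm (b j)]) (hb.resolve_right hbv)
    simp only [mul_comm (v _)] at this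
    exact ⟨this.1, this.2.trans_eq (by ring)⟩
  refine ⟨temperedSlices_mul hu hv hbv, ?_⟩
  have h1 := l2_bilinear_le hε (a := fun j => C * a j) (b := b)
    (T := fun i j k => 2 ^ (s * i) * 𝓓.l1 i (V i) (𝓓.St i fun z => 𝓓.St j u z * 𝓓.St k v z))
    (fun i j k hI => (h i j k hI).trans_eq (by ring))
    (fun i j k hI => by rw [l1_St_mul_eq_zero (hV i) hI hu hv, mul_zero])
  rw [l2_const_mul] at h1
  calc _ ≤ _ := l2_mono fun i => ?_
    _ ≤ _ := h1
    _ = _ := by ring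
  rw [ENNReal.tsum_mul_left]
  gcongr
  exact l1_St_mul_le_tsum (hV i) i hu hv hbv

end Setup

end BilEst

end

/-! ### Products of functions, measured at a fixed output frequency. -/

noncomputable section

namespace BilEst

open Filter Topology SchwartzMap

theorem sqrtTwoPow_eq (j : ℕ) : sqrtTwoPow j = 2 ^ ((j : ℝ) / 2) := by
  rw [sqrtTwoPow, ← ENNReal.rpow_natCast, ← ENNReal.rpow_mul]
  ring_nf

theorem two_pow_inv_eq (i : ℕ) : ((2 : ℝ≥0∞) ^ i)⁻¹ = 2 ^ (-(i : ℝ)) := by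
  rw [ENNReal.rpow_neg, two_pow_eq_rpow]

theorem count_le {i k : ℕ} {w : ℝ} (hw : 0 ≤ w) (h : 2 * ((k : ℝ) - i) ≤ w) :
    Setup.count (2 * i) (2 * k) ≤ 3 * 2 ^ w := by
  have h1 : (1 : ℝ≥0∞) ≤ 2 ^ w := by
    simpa using two_rpow_le_two_rpow hw
  have h2 : (2 : ℝ≥0∞) ^ (2 * k) / 2 ^ (2 * i) ≤ 2 ^ w := by
    rw [ENNReal.div_eq_inv_mul, two_pow_inv_eq, two_pow_eq_rpow, ← two_rpow_add]
    refine two_rpow_le_two_rpow ?_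
    push_cast
    linarith
  calc Setup.count (2 * i) (2 * k) ≤ 2 ^ w + 2 * 2 ^ w := by
        unfold Setup.count
        gcongr
        exact le_mul_of_one_le_right zero_le h1
    _ = _ := by ring

theorem count_rpow_half_le {i k : ℕ} {w : ℝ} (hw : 0 ≤ w) (h : (k : ℝ) - i ≤ w) :
    Setup.count (2 * i) (2 * k) ^ (1 / 2 : ℝ) ≤ 3 * 2 ^ w := by
  calc Setup.count (2 * i) (2 * k) ^ (1 / 2 : ℝ) ≤ (3 * 2 ^ (2 * w)) ^ (1 / 2 : ℝ) := by
        gcongr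
        exact count_le (by linarith) (by linarith)
    _ = 3 ^ (1 / 2 : ℝ) * 2 ^ w := by
        rw [ENNReal.mul_rpow_of_nonneg _ _ (by norm_num), ← ENNReal.rpow_mul]
        ring_nf
    _ ≤ 3 * 2 ^ w := by
        gcongr
        calc (3 : ℝ≥0∞) ^ (1 / 2 : ℝ) ≤ 3 ^ (1 : ℝ) :=
              ENNReal.rpow_le_rpow_of_exponent_le (by norm_num) (by norm_num)
          _ = 3 := ENNReal.rpow_one 3

theorem le_mul_of_forall_pos {a D N : ℝ≥0∞} (hD : D ≠ ⊤)
    (h : ∀ ε : ℝ≥0, 0 < ε → a ≤ D * (N + ε)) : a ≤ D * N := by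
  lift D to ℝ≥0 using hD
  refine ENNReal.le_of_forall_pos_le_add fun ε hε _ => ?_
  refine (h (ε / (D + 1)) (by positivity)).trans ?_
  rw [mul_add]
  gcongr
  rw [← ENNReal.coe_mul, ENNReal.coe_le_coe]
  calc D * (ε / (D + 1)) ≤ (D + 1) * (ε / (D + 1)) := by gcongr; simp
    _ = ε := by field_simp

theorem mix_le_supNorm (E : Set ℝ) (u : ℝ × ℝ → ℂ) :
    mix ⊤ ⊤ E (fun z => ‖u z‖ₑ) ≤ supNorm u := mix_mono_set (subset_univ E) _

theorem supNorm_le {u : ℝ × ℝ → ℂ} {C : ℝ≥0∞}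
    (h : ∀ᵐ t ∂timeMeasure, ∀ᵐ x, ‖u (t, x)‖ₑ ≤ C) : supNorm u ≤ C := by
  unfold supNorm mix
  refine eLpNorm_top_le ?_
  filter_upwards [h] with t ht
  rw [Measure.restrict_univ]
  exact eLpNorm_top_le ht

theorem ae_slab_enorm_le_supNorm {u : ℝ × ℝ → ℂ} (hu : AEStronglyMeasurable u slabMeasure) :
    ∀ᵐ z ∂slabMeasure, ‖u z‖ₑ ≤ supNorm u := by
  have h := ae_enorm_le_supNorm u
  have hmk := Measure.ae_ae_of_ae_prod hu.ae_eq_mk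
  have hs : MeasurableSet {z | ‖hu.mk u z‖ₑ ≤ supNorm u} :=
    measurableSet_le hu.stronglyMeasurable_mk.measurable.enorm measurable_const
  have h' : ∀ᵐ z ∂slabMeasure, z ∈ {z | ‖hu.mk u z‖ₑ ≤ supNorm u} := by
    refine (Measure.ae_prod_mem_iff_ae_ae_mem hs).2 ?_
    filter_upwards [h, hmk] with t ht hmt
    filter_upwards [ht, hmt] with x hx hmx
    rw [← hmx]
    exact hx
  filter_upwards [h', hu.ae_eq_mk] with z hz hmz
  rw [hmz]
  exact hz

namespace Setup

variable {𝓓 : Setup}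

/-! ### Norms with sharp cutoffs -/

variable (𝓓)

/-- The norm `l^1_{2j} X` with sharp cutoffs. -/
def sharpX (j : ℕ) (u : ℝ × ℝ → ℂ) : ℝ≥0∞ := ∑' m, 𝓓.xn (𝓓.Q (2 * j) m) (fun z => ‖u z‖ₑ)

/-- The norm `l^1_{2j} L^∞ L^2` with sharp cutoffs. -/
def sharpL (j : ℕ) (u : ℝ × ℝ → ℂ) : ℝ≥0∞ := ∑' m, mix ⊤ 2 (𝓓.Q (2 * j) m) (fun z => ‖u z‖ₑ)

/-- The norm `l^1_{2j} L^1 L^2` with sharp cutoffs. -/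
def sharpH (j : ℕ) (u : ℝ × ℝ → ℂ) : ℝ≥0∞ := ∑' m, mix 1 2 (𝓓.Q (2 * j) m) (fun z => ‖u z‖ₑ)

/-- The constant that compares sharp and smooth cutoffs. -/
def cutC : ℝ≥0∞ := ENNReal.ofReal 𝓓.cutoffConst

variable {𝓓}

theorem cutC_ne_top : 𝓓.cutC ≠ ⊤ := ENNReal.ofReal_ne_top

section Product

variable {f g h : ℝ × ℝ → ℂ}

theorem mix_univ_le_sharpL (hg : AEStronglyMeasurable g slabMeasure) (k : ℕ) :
    mix ⊤ 2 univ (fun z => ‖g z‖ₑ) ≤ 𝓓.sharpL k g :=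
  le_tsum_Q (subadditiveSetFn_mix hg.enorm one_le_two ENNReal.ofNat_ne_top le_top) _

theorem xn_univ_le_sharpX (hg : AEStronglyMeasurable g slabMeasure) (k : ℕ) :
    𝓓.xn univ (fun z => ‖g z‖ₑ) ≤ 𝓓.sharpX k g :=
  le_tsum_Q (subadditiveSetFn_xn hg.enorm) _

theorem supNorm_le_tsum (u : ℝ × ℝ → ℂ) (l : ℕ) :
    supNorm u ≤ ∑' n, mix ⊤ ⊤ (𝓓.Q l n) (fun z => ‖u z‖ₑ) := by
  refine supNorm_le ?_
  have h1 : ∀ n, ∀ᵐ t ∂timeMeasure, ∀ᵐ x, x ∈ 𝓓.Q l n →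
      ‖u (t, x)‖ₑ ≤ mix ⊤ ⊤ (𝓓.Q l n) (fun z => ‖u z‖ₑ) := by
    intro n
    filter_upwards [le_eLpNorm_top_ae (ν := timeMeasure)
      (fun t => eLpNorm (fun x => ‖u (t, x)‖ₑ) ⊤ (volume.restrict (𝓓.Q l n)))] with t ht
    have := le_eLpNorm_top_ae (ν := volume.restrict (𝓓.Q l n)) (fun x => ‖u (t, x)‖ₑ)
    rw [ae_restrict_iff' (𝓓.measurableSet_Q l n)] at this
    filter_upwards [this] with x hx hxQ
    exact (hx hxQ).trans ht
  filter_upwards [ae_all_iff.2 h1] with t ht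
  filter_upwards [ae_all_iff.2 ht] with x hx
  obtain ⟨n, hn⟩ := 𝓓.exists_mem_Q l x
  exact (hx n hn).trans (ENNReal.le_tsum (f := fun n => mix ⊤ ⊤ (𝓓.Q l n) (fun z => ‖u z‖ₑ)) n)

theorem sharpX_mul_le (hg : AEStronglyMeasurable g slabMeasure) (hb : supNorm f ≠ ⊤) (i k : ℕ) :
    𝓓.sharpX i (fun z => f z * g z) ≤
      supNorm f * (count (2 * i) (2 * k) * 𝓓.sharpX k g) := by
  refine le_trans ?_ (mul_le_mul' le_rfl (tsum_Q_le (subadditiveSetFn_xn hg.enorm) _ _))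
  rw [← ENNReal.tsum_mul_left]
  refine ENNReal.tsum_le_tsum fun m => ?_
  simp only [enorm_mul]
  have := mix_le_supNorm (𝓓.Q (2 * i) m) f
  exact (xn_mul_le_top_mul (ne_top_of_le_ne_top hb this)).trans (mul_le_mul' this le_rfl)

theorem sharpL_mul_le (hg : AEStronglyMeasurable g slabMeasure) (hb : supNorm f ≠ ⊤) (i k : ℕ) :
    𝓓.sharpL i (fun z => f z * g z) ≤
      supNorm f * (count (2 * i) (2 * k) * 𝓓.sharpL k g) := by
  refine le_trans ?_ (mul_le_mul' le_rfl (tsum_Q_le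
    (subadditiveSetFn_mix hg.enorm one_le_two ENNReal.ofNat_ne_top le_top) _ _))
  rw [← ENNReal.tsum_mul_left]
  refine ENNReal.tsum_le_tsum fun m => ?_
  simp only [enorm_mul]
  have := mix_le_supNorm (𝓓.Q (2 * i) m) f
  exact (mix_mul_le_top_mul (ne_top_of_le_ne_top hb this)).trans (mul_le_mul' this le_rfl)

theorem sharpH_mul_le (hg : AEStronglyMeasurable g slabMeasure) (hb : supNorm f ≠ ⊤) (i k : ℕ) :
    𝓓.sharpH i (fun z => f z * g z) ≤
      supNorm f * (count (2 * i) (2 * k) ^ (1 / 2 : ℝ) * 𝓓.sharpH k g) := by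
  refine le_trans ?_ (mul_le_mul' le_rfl (tsum_mix_one_two_le hg.enorm _ _))
  rw [← ENNReal.tsum_mul_left]
  refine ENNReal.tsum_le_tsum fun m => ?_
  simp only [enorm_mul]
  have := mix_le_supNorm (𝓓.Q (2 * i) m) f
  exact (mix_mul_le_top_mul (ne_top_of_le_ne_top hb this)).trans (mul_le_mul' this le_rfl)

theorem sharpX_St_le (hh : AEStronglyMeasurable h slabMeasure) (i : ℕ) :
    𝓓.sharpX i (𝓓.St i h) ≤ 9 * 𝓓.kerConst * 𝓓.sharpX i h := by
  rw [St_eq_convt]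
  exact tsum_xn_convt_le (𝓓.blockBound_ker i) hh _

theorem sharpL_St_le (hh : AEStronglyMeasurable h slabMeasure) (i : ℕ) :
    𝓓.sharpL i (𝓓.St i h) ≤ 3 * 𝓓.kerConst * 𝓓.sharpL i h := by
  rw [St_eq_convt]
  refine (tsum_mix_convt_le avgBound_two_two one_le_two ENNReal.ofNat_ne_top one_le_two le_top
    ENNReal.one_ne_top (𝓓.blockBound_ker i) hh _).trans_eq ?_
  rw [mul_one]
  rfl

theorem sharpH_St_le (hh : AEStronglyMeasurable h slabMeasure) (i : ℕ) :
    𝓓.sharpH i (𝓓.St i h) ≤ 3 * 𝓓.kerConst * 𝓓.sharpH i h := by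
  rw [St_eq_convt]
  refine (tsum_mix_convt_le avgBound_two_two one_le_two ENNReal.ofNat_ne_top one_le_two le_rfl
    ENNReal.one_ne_top (𝓓.blockBound_ker i) hh _).trans_eq ?_
  rw [mul_one]
  rfl

/-- For high-high interactions, Bernstein's inequality from `L^1` to `L^2` is applied at the output
frequency and costs only `2^(i/2)`; no factor is placed in `L^∞_x`. The product is estimated by
Cauchy-Schwarz at fixed time, after the change of partition in `L^∞L^1`. -/
theorem sharpL_St_mul_le (hf : AEStronglyMeasurable f slabMeasure)
    (hg : AEStronglyMeasurable g slabMeasure) (i k : ℕ) :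
    𝓓.sharpL i (𝓓.St i fun z => f z * g z) ≤ 3 * sqrtTwoPow i * 𝓓.kerConst *
      (count (2 * i) (2 * k) * (mix ⊤ 2 univ (fun z => ‖f z‖ₑ) * 𝓓.sharpL k g)) := by
  rw [St_eq_convt]
  refine (tsum_mix_convt_le avgBound_one_two le_rfl ENNReal.one_ne_top one_le_two le_top
    (sqrtTwoPow_ne_top i) (𝓓.blockBound_ker i) (hf.mul hg) _).trans ?_
  gcongr
  refine (tsum_Q_le (subadditiveSetFn_mix (hf.mul hg).enorm le_rfl ENNReal.one_ne_top le_top)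
    _ (2 * k)).trans ?_
  refine mul_le_mul' le_rfl ?_
  rw [sharpL, ← ENNReal.tsum_mul_left]
  gcongr with n
  simp only [Pi.mul_apply, enorm_mul]
  refine (mix_top_one_mul_le hf.enorm hg.enorm).trans ?_
  gcongr
  exact mix_mono_set (subset_univ _) _

theorem tsum_mix_one_one_le {F : ℝ × ℝ → ℝ≥0∞} (hF : AEMeasurable F slabMeasure) (l : ℕ) :
    ∑' m, mix 1 1 (𝓓.Q l m) F ≤ mix 1 1 univ F := by
  simp only [mix, eLpNorm_one_eq]
  rw [← lintegral_tsum fun m => ?_]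
  · refine lintegral_mono fun t => ?_
    rw [← lintegral_iUnion (fun m => 𝓓.measurableSet_Q l m) (𝓓.pairwise_disjoint_Q l), 𝓓.iUnion_Q]
  · have := aemeasurable_slice_norm hF one_ne_zero ENNReal.one_ne_top (𝓓.Q l m)
    simpa only [eLpNorm_one_eq] using this

/-- In `L^1_t L^1_x` the norms over disjoint intervals add up to at most the norm over the line.
Hence no count appears, and the factors enter through plain `L^∞L^2` norms. -/
theorem sharpH_St_mul_le (hf : AEStronglyMeasurable f slabMeasure)
    (hg : AEStronglyMeasurable g slabMeasure) (i : ℕ) :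
    𝓓.sharpH i (𝓓.St i fun z => f z * g z) ≤ 3 * sqrtTwoPow i * 𝓓.kerConst *
      (mix ⊤ 2 univ (fun z => ‖f z‖ₑ) * mix ⊤ 2 univ (fun z => ‖g z‖ₑ)) := by
  rw [St_eq_convt]
  refine (tsum_mix_convt_le avgBound_one_two le_rfl ENNReal.one_ne_top one_le_two le_rfl
    (sqrtTwoPow_ne_top i) (𝓓.blockBound_ker i) (hf.mul hg) _).trans ?_
  gcongr
  refine (tsum_mix_one_one_le (hf.mul hg).enorm _).trans ?_
  refine (mix_le_mix_time le_top (hf.mul hg).enorm one_ne_zero ENNReal.one_ne_top).trans ?_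
  simp only [Pi.mul_apply, enorm_mul]
  exact mix_top_one_mul_le hf.enorm hg.enorm

/-- Bernstein's inequality. -/
theorem tsum_mix_top_St_le {u : ℝ × ℝ → ℂ} (hu : TemperedSlices u) (k : ℕ) :
    ∑' n, mix ⊤ ⊤ (𝓓.Q (2 * k) n) (fun z => ‖𝓓.St k u z‖ₑ) ≤
      6 * 𝓓.kerConst * 2 ^ ((k : ℝ) / 2) * 𝓓.sharpL k (𝓓.St k u) := by
  have hm := aestronglyMeasurable_St (𝓓 := 𝓓) hu.aestronglyMeasurable k
  -- The symbol of `low (k + 1)` equals 1 on the support of `φ k`, so the piece reproduces itself as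
  -- a convolution and the bound from `L^2` to `L^∞` applies.
  have h1 : ∀ᵐ z ∂slabMeasure, ‖𝓓.St k u z‖ₑ = ‖convt (𝓓.low (k + 1)) (𝓓.St k u) z‖ₑ := by
    filter_upwards [ae_slab_of_ae_time hu.ae_slice] with z hz
    have : convt (𝓓.low (k + 1)) (𝓓.St k u) z = 𝓓.St k u z := conv_low_S 𝓓 k hz z.2
    rw [this]
  simp_rw [mix_congr_ae h1]
  refine (tsum_mix_convt_le avgBound_two_top one_le_two ENNReal.ofNat_ne_top le_top le_top
    (sqrtTwoPow_ne_top (k + 1)) (𝓓.blockBound_low (k + 1)) hm (2 * k)).trans ?_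
  change 3 * sqrtTwoPow (k + 1) * 𝓓.kerConst * 𝓓.sharpL k (𝓓.St k u) ≤ _
  have h2 : sqrtTwoPow (k + 1) ≤ 2 * 2 ^ ((k : ℝ) / 2) := by
    rw [sqrtTwoPow_eq]
    calc (2 : ℝ≥0∞) ^ (((k + 1 : ℕ) : ℝ) / 2) ≤ 2 ^ (1 + (k : ℝ) / 2) := by
          refine two_rpow_le_two_rpow ?_
          push_cast
          linarith
      _ = _ := by rw [two_rpow_add, ENNReal.rpow_one]
  calc _ ≤ 3 * (2 * 2 ^ ((k : ℝ) / 2)) * 𝓓.kerConst * 𝓓.sharpL k (𝓓.St k u) := by gcongr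
    _ = _ := by ring

theorem supNorm_St_le {u : ℝ × ℝ → ℂ} (hu : TemperedSlices u) (k : ℕ) :
    supNorm (𝓓.St k u) ≤ 6 * 𝓓.kerConst * 2 ^ ((k : ℝ) / 2) * 𝓓.sharpL k (𝓓.St k u) :=
  (supNorm_le_tsum _ _).trans (tsum_mix_top_St_le hu k)

/-! ### Products in `X` -/

theorem l1_normXj_St_mul_le_add (hf : AEStronglyMeasurable f slabMeasure)
    (hg : AEStronglyMeasurable g slabMeasure) (hb : supNorm f ≠ ⊤) (i k : ℕ) :
    𝓓.l1 i (𝓓.normXj i) (𝓓.St i fun z => f z * g z) ≤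
      27 * 𝓓.kerConst * (2 ^ i * (supNorm f * (count (2 * i) (2 * k) * 𝓓.sharpX k g))) +
        3 * 𝓓.sharpL i (𝓓.St i fun z => f z * g z) := by
  have hfg : AEStronglyMeasurable (fun z => f z * g z) slabMeasure := hf.mul hg
  refine (l1_normXj_le (aestronglyMeasurable_St hfg i) i).trans ?_
  rw [mul_add]
  refine add_le_add ?_ le_rfl
  calc 3 * (2 ^ i * 𝓓.sharpX i (𝓓.St i fun z => f z * g z))
      ≤ 3 * (2 ^ i * (9 * 𝓓.kerConst *
        (supNorm f * (count (2 * i) (2 * k) * 𝓓.sharpX k g)))) := by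
        gcongr
        refine (sharpX_St_le hfg i).trans ?_
        gcongr
        exact sharpX_mul_le hg hb i k
    _ = _ := by ring

theorem two_pow_mul_sharpX_le (hg : AEStronglyMeasurable g slabMeasure) (k : ℕ) :
    𝓓.sharpX k g ≤ 2 ^ (-(k : ℝ)) * (𝓓.cutC * 𝓓.l1 k (𝓓.normXj k) g) := by
  have := (le_add_right le_rfl).trans (sharp_le_l1_normXj (𝓓 := 𝓓) hg k)
  calc 𝓓.sharpX k g = 2 ^ (-(k : ℝ)) * (2 ^ k * 𝓓.sharpX k g) := by
        rw [← mul_assoc, two_pow_eq_rpow, two_rpow_neg_mul_self, one_mul]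
    _ ≤ _ := by
        exact mul_le_mul' le_rfl this

theorem sharpL_le_l1_normXj (hg : AEStronglyMeasurable g slabMeasure) (k : ℕ) :
    𝓓.sharpL k g ≤ 𝓓.cutC * 𝓓.l1 k (𝓓.normXj k) g :=
  (le_add_left le_rfl).trans (sharp_le_l1_normXj (𝓓 := 𝓓) hg k)

/-- Two losses are absorbed by `2^w`: the count `2^(2(k-i))` when the output partition is finer, and
`2^(i-k)` from the weight `2^i` of `X_i` against `2^k` of `X_k`. In the `X` part both occur and
partly compensate each other. -/
theorem l1_normXj_St_mul_le (hf : AEStronglyMeasurable f slabMeasure)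
    (hg : AEStronglyMeasurable g slabMeasure) (hb : supNorm f ≠ ⊤) {i k : ℕ} {w : ℝ}
    (h1 : 2 * ((k : ℝ) - i) ≤ w) (h2 : (i : ℝ) - k ≤ w) :
    𝓓.l1 i (𝓓.normXj i) (𝓓.St i fun z => f z * g z) ≤
      162 * 𝓓.kerConst * 𝓓.cutC * 2 ^ w * (supNorm f * 𝓓.l1 k (𝓓.normXj k) g) := by
  have hfg : AEStronglyMeasurable (fun z => f z * g z) slabMeasure := hf.mul hg
  have hw : 0 ≤ w := by
    rcases le_total (k : ℝ) i with h | h <;> linarith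
  set N := 𝓓.l1 k (𝓓.normXj k) g
  have hX : 2 ^ i * (count (2 * i) (2 * k) * 𝓓.sharpX k g) ≤ 3 * 2 ^ w * (𝓓.cutC * N) := by
    calc 2 ^ i * (count (2 * i) (2 * k) * 𝓓.sharpX k g)
        ≤ 2 ^ (i : ℝ) * ((3 * 2 ^ (w - (i - k))) * (2 ^ (-(k : ℝ)) * (𝓓.cutC * N))) := by
          rw [two_pow_eq_rpow]
          gcongr
          · exact count_le (by linarith) (by rcases le_total (k : ℝ) i with h | h <;> linarith)
          · exact two_pow_mul_sharpX_le hg k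
      _ = 3 * (2 ^ (i : ℝ) * 2 ^ (w - (i - k)) * 2 ^ (-(k : ℝ))) * (𝓓.cutC * N) := by ring
      _ = _ := by
          rw [← two_rpow_add, ← two_rpow_add]
          ring_nf
  have hL : count (2 * i) (2 * k) * 𝓓.sharpL k g ≤ 3 * 2 ^ w * (𝓓.cutC * N) := by
    gcongr
    · exact count_le hw h1
    · exact sharpL_le_l1_normXj hg k
  calc _ ≤ _ := l1_normXj_St_mul_le_add hf hg hb i k
    _ ≤ 27 * 𝓓.kerConst * (2 ^ i * (supNorm f * (count (2 * i) (2 * k) * 𝓓.sharpX k g))) +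
        9 * (3 * 𝓓.kerConst * (supNorm f * (count (2 * i) (2 * k) * 𝓓.sharpL k g))) := by
        gcongr
        · norm_num
        · refine (sharpL_St_le hfg i).trans ?_
          gcongr
          exact sharpL_mul_le hg hb i k
    _ = 27 * 𝓓.kerConst * supNorm f * (2 ^ i * (count (2 * i) (2 * k) * 𝓓.sharpX k g) +
        count (2 * i) (2 * k) * 𝓓.sharpL k g) := by ring
    _ ≤ 27 * 𝓓.kerConst * supNorm f * (3 * 2 ^ w * (𝓓.cutC * N) + 3 * 2 ^ w * (𝓓.cutC * N)) := by
        gcongr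
    _ = _ := by ring

/-- High-high interactions in `X`. -/
theorem l1_normXj_St_mul_le_of_le (hf : AEStronglyMeasurable f slabMeasure)
    (hg : AEStronglyMeasurable g slabMeasure) (hb : supNorm f ≠ ⊤) {i k : ℕ} (hik : i ≤ k) :
    𝓓.l1 i (𝓓.normXj i) (𝓓.St i fun z => f z * g z) ≤
      81 * 𝓓.kerConst * 𝓓.cutC * (2 ^ ((k : ℝ) - i) * supNorm f +
        2 ^ (2 * (k : ℝ) - 3 / 2 * i) * mix ⊤ 2 univ (fun z => ‖f z‖ₑ)) *
          𝓓.l1 k (𝓓.normXj k) g := by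
  have hik' : (i : ℝ) ≤ k := by exact_mod_cast hik
  set N := 𝓓.l1 k (𝓓.normXj k) g
  set A := supNorm f
  set M := mix ⊤ 2 univ (fun z => ‖f z‖ₑ)
  have hc : count (2 * i) (2 * k) ≤ 3 * 2 ^ (2 * ((k : ℝ) - i)) :=
    count_le (by linarith) le_rfl
  calc _ ≤ _ := l1_normXj_St_mul_le_add hf hg hb i k
    _ ≤ 27 * 𝓓.kerConst * (2 ^ (i : ℝ) * (A * (3 * 2 ^ (2 * ((k : ℝ) - i)) *
          (2 ^ (-(k : ℝ)) * (𝓓.cutC * N))))) +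
        9 * (3 * 2 ^ ((i : ℝ) / 2) * 𝓓.kerConst *
          (3 * 2 ^ (2 * ((k : ℝ) - i)) * (M * (𝓓.cutC * N)))) := by
        rw [← two_pow_eq_rpow]
        gcongr
        · exact two_pow_mul_sharpX_le hg k
        · norm_num
        · refine (sharpL_St_mul_le hf hg i k).trans ?_
          rw [sqrtTwoPow_eq]
          gcongr
          exact sharpL_le_l1_normXj hg k
    _ = 81 * 𝓓.kerConst * 𝓓.cutC * ((2 ^ (i : ℝ) * 2 ^ (2 * ((k : ℝ) - i)) * 2 ^ (-(k : ℝ))) * A +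
        (2 ^ ((i : ℝ) / 2) * 2 ^ (2 * ((k : ℝ) - i))) * M) * N := by ring
    _ = _ := by
        simp only [← two_rpow_add]
        ring_nf

/-! ### Products in `L^1 L^2` -/

theorem sharpH_le_l1 (k : ℕ) (g : ℝ × ℝ → ℂ) : 𝓓.sharpH k g ≤ 𝓓.cutC * 𝓓.l1 k normL1L2 g :=
  sharp_le_l1_normL1L2 g k

theorem l1_normL1L2_St_mul_le (hf : AEStronglyMeasurable f slabMeasure)
    (hg : AEStronglyMeasurable g slabMeasure) (hb : supNorm f ≠ ⊤) {i k : ℕ} {w : ℝ}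
    (hw : 0 ≤ w) (h : (k : ℝ) - i ≤ w) :
    𝓓.l1 i normL1L2 (𝓓.St i fun z => f z * g z) ≤
      27 * 𝓓.kerConst * 2 ^ w * (supNorm f * 𝓓.sharpH k g) := by
  have hfg : AEStronglyMeasurable (fun z => f z * g z) slabMeasure := hf.mul hg
  calc _ ≤ 3 * 𝓓.sharpH i (𝓓.St i fun z => f z * g z) :=
        l1_normL1L2_le (aestronglyMeasurable_St hfg i) i
    _ ≤ 3 * (3 * 𝓓.kerConst * (supNorm f * ((3 * 2 ^ w) * 𝓓.sharpH k g))) := by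
        gcongr
        refine (sharpH_St_le hfg i).trans ?_
        gcongr
        refine (sharpH_mul_le hg hb i k).trans ?_
        gcongr
        exact count_rpow_half_le hw h
    _ = _ := by ring

theorem l1_normL1L2_St_mul_le_sqrt (hf : AEStronglyMeasurable f slabMeasure)
    (hg : AEStronglyMeasurable g slabMeasure) (i : ℕ) :
    𝓓.l1 i normL1L2 (𝓓.St i fun z => f z * g z) ≤ 9 * 𝓓.kerConst * 2 ^ ((i : ℝ) / 2) *
      (mix ⊤ 2 univ (fun z => ‖f z‖ₑ) * mix ⊤ 2 univ (fun z => ‖g z‖ₑ)) := by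
  have hfg : AEStronglyMeasurable (fun z => f z * g z) slabMeasure := hf.mul hg
  calc _ ≤ 3 * 𝓓.sharpH i (𝓓.St i fun z => f z * g z) :=
        l1_normL1L2_le (aestronglyMeasurable_St hfg i) i
    _ ≤ 3 * (3 * sqrtTwoPow i * 𝓓.kerConst *
        (mix ⊤ 2 univ (fun z => ‖f z‖ₑ) * mix ⊤ 2 univ (fun z => ‖g z‖ₑ))) := by
        gcongr
        exact sharpH_St_mul_le hf hg i
    _ = _ := by
        rw [sqrtTwoPow_eq]
        ring

/-! ### Products in `Y` -/

theorem l1_normYj_le_l1_normL1L2 (hh : AEStronglyMeasurable h slabMeasure) (i : ℕ) :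
    𝓓.l1 i (𝓓.normYj i) h ≤ 𝓓.l1 i normL1L2 h :=
  ENNReal.tsum_le_tsum fun m => normYj_le_normL1L2 i (aestronglyMeasurable_χ_mul hh i m)

/-- High-low interactions in `Y`. -/
theorem l1_normYj_St_mul_le_of_le (hf : AEStronglyMeasurable f slabMeasure)
    (hg : AEStronglyMeasurable g slabMeasure) {i k : ℕ} (hki : k ≤ i) {D : ℝ≥0∞}
    (hD : ∀ n, mix 2 2 (𝓓.Q (2 * k) n) (fun z => ‖f z‖ₑ) ≤ D)
    (hb : ∑' n, mix ⊤ ⊤ (𝓓.Q (2 * k) n) (fun z => ‖g z‖ₑ) ≠ ⊤) :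
    𝓓.l1 i (𝓓.normYj i) (𝓓.St i fun z => f z * g z) ≤ 27 * 𝓓.kerConst * 2 ^ ((k : ℝ) - i) *
      (D * ∑' n, mix ⊤ ⊤ (𝓓.Q (2 * k) n) (fun z => ‖g z‖ₑ)) := by
  have hfg : AEStronglyMeasurable (fun z => f z * g z) slabMeasure := hf.mul hg
  have hS := aestronglyMeasurable_St (𝓓 := 𝓓) hfg i
  have h1 : ∑' n, mix 2 2 (𝓓.Q (2 * k) n) (fun z => ‖𝓓.St i (fun z => f z * g z) z‖ₑ) ≤
      3 * 𝓓.kerConst * (D * ∑' n, mix ⊤ ⊤ (𝓓.Q (2 * k) n) (fun z => ‖g z‖ₑ)) := by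
    rw [St_eq_convt]
    refine (tsum_mix_convt_le avgBound_two_two one_le_two ENNReal.ofNat_ne_top one_le_two
      one_le_two ENNReal.one_ne_top (𝓓.blockBound_ker i) hfg _).trans ?_
    rw [mul_one]
    refine mul_le_mul' le_rfl ?_
    rw [← ENNReal.tsum_mul_left]
    gcongr with n
    simp only [enorm_mul, mul_comm ‖f _‖ₑ]
    refine (mix_mul_le_top_mul (ENNReal.ne_top_of_tsum_ne_top hb n)).trans ?_
    rw [mul_comm]
    gcongr
    exact hD n
  calc _ ≤ ∑' m, ((2 : ℝ≥0∞) ^ i)⁻¹ *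
        𝓓.normY (fun z => (𝓓.χ i m z.2 : ℂ) * 𝓓.St i (fun z => f z * g z) z) :=
        ENNReal.tsum_le_tsum fun m => normYj_le_normY i (aestronglyMeasurable_χ_mul hS i m)
    _ = 2 ^ (-(i : ℝ)) *
        ∑' m, 𝓓.normY (fun z => (𝓓.χ i m z.2 : ℂ) * 𝓓.St i (fun z => f z * g z) z) := by
        rw [ENNReal.tsum_mul_left, two_pow_inv_eq]
    -- Atoms of length `2^(2k)` are used: `k ≤ i` makes this scale admissible for the cutoffs, the
    -- atoms cost `2^k`, and the weight of `Y_i` supplies `2^(-i)`.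
    _ ≤ 2 ^ (-(i : ℝ)) * (9 * (2 ^ (((2 * k : ℕ) : ℝ) / 2) *
        (3 * 𝓓.kerConst * (D * ∑' n, mix ⊤ ⊤ (𝓓.Q (2 * k) n) (fun z => ‖g z‖ₑ))))) := by
        gcongr
        refine (tsum_normY_χ_le hS (by omega : 2 * k ≤ 2 * i)).trans ?_
        gcongr
    _ = 27 * 𝓓.kerConst * (2 ^ (((2 * k : ℕ) : ℝ) / 2) * 2 ^ (-(i : ℝ))) *
        (D * ∑' n, mix ⊤ ⊤ (𝓓.Q (2 * k) n) (fun z => ‖g z‖ₑ)) := by ring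
    _ = _ := by
        rw [← two_rpow_add]
        push_cast
        ring_nf

/-- The `X` norm controls the `L^2` norm on an interval of length `2^(2k)` at the cost `2^k`.
Against the weight `2^j` of `X_j` this is the local smoothing gain `2^(k-j)`. -/
theorem mix_two_two_le_sharpX (hf : AEStronglyMeasurable f slabMeasure) (j k : ℕ) (n : ℤ) :
    mix 2 2 (𝓓.Q (2 * k) n) (fun z => ‖f z‖ₑ) ≤ 2 ^ (k : ℝ) * 𝓓.sharpX j f := by
  have h := (𝓓.le_xn univ (fun z => ‖f z‖ₑ) (2 * k) n).trans (xn_univ_le_sharpX hf j)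
  rw [univ_inter] at h
  calc _ = 2 ^ (k : ℝ) * (2 ^ (-(((2 * k : ℕ) : ℝ)) / 2) *
        mix 2 2 (𝓓.Q (2 * k) n) (fun z => ‖f z‖ₑ)) := by
        rw [← mul_assoc, ← two_rpow_add]
        push_cast
        rw [show (k : ℝ) + -(2 * k) / 2 = 0 by ring, ENNReal.rpow_zero, one_mul]
    _ ≤ _ := by gcongr

theorem mix_two_two_le (hf : AEStronglyMeasurable f slabMeasure) (E : Set ℝ) :
    mix 2 2 E (fun z => ‖f z‖ₑ) ≤ mix ⊤ 2 univ (fun z => ‖f z‖ₑ) :=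
  (mix_le_mix_time le_top hf.enorm two_ne_zero ENNReal.ofNat_ne_top).trans
    (mix_mono_set (subset_univ _) _)

/-- Multiplication by bounded functions in `Y`. -/
theorem l1_normYj_St_mul_le (hf : AEStronglyMeasurable f slabMeasure) (hb : supNorm f ≠ ⊤)
    {i k : ℕ} (hg : 𝓓.l1 k (𝓓.normYj k) g ≠ ⊤) {w : ℝ} (hw : 0 ≤ w) (h : (k : ℝ) - i ≤ w) :
    𝓓.l1 i (𝓓.normYj i) (𝓓.St i fun z => f z * g z) ≤
      54 * 𝓓.kerConst * 𝓓.cutC * 2 ^ w * (supNorm f * 𝓓.l1 k (𝓓.normYj k) g) := by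
  have hK := 𝓓.kerConst_ne_top
  have hc := 𝓓.cutC_ne_top
  have hw' := two_rpow_ne_top w
  set A := supNorm f with hA
  suffices ∀ ε : ℝ≥0, 0 < ε → 𝓓.l1 i (𝓓.normYj i) (𝓓.St i fun z => f z * g z) ≤
      (54 * 𝓓.kerConst * 2 ^ w * A * 𝓓.cutC) * (𝓓.l1 k (𝓓.normYj k) g + ε) by
    refine (le_mul_of_forall_pos (by finiteness) this).trans_eq (by ring)
  intro ε hε
  -- The atomic half pays for the change of weight from `2^(-k)` to `2^(-i)`, the `L^1L^2` half for
  -- the change of partition; both costs are at most a constant times `2^w`.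
  obtain ⟨g₁, g₂, hm₁, hm₂, hsum, hle⟩ := exists_decomp_of_l1_normYj hg hε
  have hfin : 𝓓.cutC * (𝓓.l1 k (𝓓.normYj k) g + ε) ≠ ⊤ := by finiteness
  obtain ⟨hfin₁, hfin₂⟩ := ENNReal.add_ne_top.1 (ne_top_of_le_ne_top hfin hle)
  have hY₁ : 𝓓.normY (fun z => f z * g₁ z) ≤ A * 𝓓.normY g₁ := by
    lift A to ℝ≥0 using hb with A'
    exact normY_mul_le hf (by simpa only [hA] using ae_slab_enorm_le_supNorm hf)
  have hY₁' : 𝓓.normY g₁ ≠ ⊤ := by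
    intro hcon
    rw [hcon, ENNReal.mul_top (ENNReal.inv_ne_zero.2 (two_pow_ne_top' k))] at hfin₁
    exact hfin₁ rfl
  have hfg₁ : AEStronglyMeasurable (fun z => f z * g₁ z) slabMeasure := hf.mul hm₁
  have hfg₂ : AEStronglyMeasurable (fun z => f z * g₂ z) slabMeasure := hf.mul hm₂
  have hH₂ : 𝓓.sharpH i (fun z => f z * g₂ z) ≤ A * (3 * 2 ^ w * 𝓓.sharpH k g₂) := by
    refine (sharpH_mul_le hm₂ hb i k).trans ?_
    gcongr
    exact count_rpow_half_le hw h
  have hfin₂' : 𝓓.sharpH k g₂ ≠ ⊤ := hfin₂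
  -- The convolution is additive only where both integrals converge, hence the finiteness of the
  -- norms of both products is used here.
  have hlin := convt_add (𝓓.ker i) hfg₁ hfg₂
    (ne_top_of_le_ne_top (ENNReal.mul_ne_top hb hY₁') (((mix_le_mix_time one_le_two hfg₁.enorm
      two_ne_zero ENNReal.ofNat_ne_top).trans (mix_le_normY _)).trans hY₁))
    (ne_top_of_le_ne_top (by finiteness) ((le_tsum_Q (subadditiveSetFn_mix hfg₂.enorm one_le_two
      ENNReal.ofNat_ne_top le_rfl) (2 * i)).trans hH₂))
    (h := fun z => f z * g z) (hsum.mono fun z hz => by rw [hz, mul_add])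
  simp only [← St_eq_convt] at hlin
  have hS₁ := aestronglyMeasurable_St (𝓓 := 𝓓) hfg₁ i
  have hS₂ := aestronglyMeasurable_St (𝓓 := 𝓓) hfg₂ i
  calc 𝓓.l1 i (𝓓.normYj i) (𝓓.St i fun z => f z * g z)
      ≤ ∑' m, (((2 : ℝ≥0∞) ^ i)⁻¹ *
          𝓓.normY (fun z => (𝓓.χ i m z.2 : ℂ) * 𝓓.St i (fun z => f z * g₁ z) z) +
          normL1L2 (fun z => (𝓓.χ i m z.2 : ℂ) * 𝓓.St i (fun z => f z * g₂ z) z)) := by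
        refine ENNReal.tsum_le_tsum fun m => ?_
        refine normYj_le (aestronglyMeasurable_χ_mul hS₁ i m) (aestronglyMeasurable_χ_mul hS₂ i m) ?_
        filter_upwards [hlin] with z hz
        rw [hz, mul_add]
    _ = 2 ^ (-(i : ℝ)) *
          ∑' m, 𝓓.normY (fun z => (𝓓.χ i m z.2 : ℂ) * 𝓓.St i (fun z => f z * g₁ z) z) +
          𝓓.l1 i normL1L2 (𝓓.St i (fun z => f z * g₂ z)) := by
        rw [ENNReal.tsum_add, ENNReal.tsum_mul_left, two_pow_inv_eq]
        rfl
    _ ≤ 2 ^ (w - k) * (54 * 𝓓.kerConst * (A * 𝓓.normY g₁)) +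
          27 * 𝓓.kerConst * 2 ^ w * (A * 𝓓.sharpH k g₂) := by
        gcongr
        · exact one_le_two
        · linarith
        · exact (tsum_normY_χ_St_le _ i).trans (mul_le_mul' le_rfl hY₁)
        · exact l1_normL1L2_St_mul_le hf hm₂ hb hw h
    _ ≤ 2 ^ w * 2 ^ (-(k : ℝ)) * (54 * 𝓓.kerConst * (A * 𝓓.normY g₁)) +
          54 * 𝓓.kerConst * 2 ^ w * (A * 𝓓.sharpH k g₂) := by
        rw [← two_rpow_add, sub_eq_add_neg]
        gcongr
        norm_num
    _ = 54 * 𝓓.kerConst * 2 ^ w * A * (((2 : ℝ≥0∞) ^ k)⁻¹ * 𝓓.normY g₁ + 𝓓.sharpH k g₂) := by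
        rw [two_pow_inv_eq]
        ring
    _ ≤ 54 * 𝓓.kerConst * 2 ^ w * A * (𝓓.cutC * (𝓓.l1 k (𝓓.normYj k) g + ε)) :=
        mul_le_mul' le_rfl hle
    _ = _ := by ring

end Product

end Setup

end BilEst

end

/-! ### Products of Littlewood-Paley pieces with explicit powers of two. -/

noncomputable section

namespace BilEst

open Filter Topology SchwartzMap

/-! ### Time-independent functions -/

theorem temperedSlices_snd {a : ℝ → ℂ} (ha : TemperedFun a) : TemperedSlices fun z => a z.2 := by
  refine ⟨?_, Eventually.of_forall fun _ => ha⟩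
  rw [restrict_slab]
  exact ha.aestronglyMeasurable.comp_quasiMeasurePreserving Measure.quasiMeasurePreserving_snd

/-- All slices coincide, so one good time suffices. -/
theorem temperedFun_of_temperedSlices_snd {a : ℝ → ℂ} (h : TemperedSlices fun z => a z.2) :
    TemperedFun a := by
  obtain ⟨_, ht⟩ := (h.ae_slice).exists
  exact ht

theorem supNorm_snd (a : ℝ → ℂ) : supNorm (fun z => a z.2) = eLpNorm a ⊤ volume := by
  rw [supNorm, mix_comp_snd (g := fun x => ‖a x‖ₑ) ENNReal.top_ne_zero, Measure.restrict_univ]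
  exact eLpNorm_enorm _

namespace Setup

variable {𝓓 : Setup}

theorem sharpL_snd (k : ℕ) (a : ℝ → ℂ) :
    𝓓.sharpL k (fun z => a z.2) = 𝓓.sharpH k (fun z => a z.2) := by
  simp only [sharpL, sharpH, mix_comp_snd (g := fun x => ‖a x‖ₑ) ENNReal.top_ne_zero,
    mix_comp_snd (g := fun x => ‖a x‖ₑ) one_ne_zero]

theorem sharpL_snd_le (k : ℕ) (a : ℝ → ℂ) :
    𝓓.sharpL k (fun z => a z.2) ≤ 𝓓.cutC * 𝓓.l1 k normL1L2 (fun z => a z.2) := by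
  rw [sharpL_snd]
  exact sharpH_le_l1 k _

theorem normL1X_eq (s : ℝ) (u : ℝ × ℝ → ℂ) : 𝓓.normL1X s u = 𝓓.besov 𝓓.normXj s u :=
  (besov_eq _ _ _).symm

theorem normL1Y_eq (s : ℝ) (u : ℝ × ℝ → ℂ) : 𝓓.normL1Y s u = 𝓓.besov 𝓓.normYj s u :=
  (besov_eq _ _ _).symm

theorem normL1H_eq (s : ℝ) (a : ℝ → ℂ) :
    𝓓.normL1H s a = 𝓓.besov (fun _ => normL1L2) s (fun z => a z.2) := by
  rw [besov_eq, normL1H]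
  simp only [l1L2_eq_l1]
  rfl

theorem l1_ne_top_of_besov {V : ℕ → (ℝ × ℝ → ℂ) → ℝ≥0∞} {s : ℝ} {u : ℝ × ℝ → ℂ}
    (h : 𝓓.besov V s u ≠ ⊤) (j : ℕ) : 𝓓.l1 j (V j) (𝓓.St j u) ≠ ⊤ := by
  intro hcon
  have := le_l2 (fun j => 2 ^ (s * j) * 𝓓.l1 j (V j) (𝓓.St j u)) j
  rw [hcon, ENNReal.mul_top (two_rpow_ne_zero _), top_le_iff] at this
  exact h this

/-! ### Estimates of products of Littlewood-Paley pieces -/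

variable (𝓓)

/-- A common constant for the estimates of products of Littlewood-Paley pieces. -/
def prodConst : ℝ≥0∞ := 1000 * (𝓓.kerConst + 1) ^ 2 * (𝓓.cutC + 1) ^ 2

variable {𝓓}

theorem prodConst_ne_top : 𝓓.prodConst ≠ ⊤ := by
  have h1 := 𝓓.kerConst_ne_top
  have h2 := 𝓓.cutC_ne_top
  unfold prodConst
  finiteness

theorem le_prodConst {n : ℝ≥0∞} (hn : n ≤ 1000) {a b : ℕ} (ha : a ≤ 2) (hb : b ≤ 2) :
    n * 𝓓.kerConst ^ a * 𝓓.cutC ^ b ≤ 𝓓.prodConst := by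
  have h : ∀ (x : ℝ≥0∞) {a : ℕ}, a ≤ 2 → x ^ a ≤ (x + 1) ^ 2 := fun x a ha =>
    (pow_le_pow_left' le_self_add a).trans (pow_le_pow_right₀ le_add_self ha)
  exact mul_le_mul' (mul_le_mul' hn (h _ ha)) (h _ hb)

/-- Conversion of an estimate of a product of Littlewood-Paley pieces into weighted form. -/
theorem weight_le {i j k : ℕ} {s α β ε w D : ℝ} {X C N M : ℝ≥0∞} (hX : X ≤ C * 2 ^ w * (N * M))
    (h : s * i + w ≤ D - ε * (min j k : ℕ) + α * j + β * k) :
    2 ^ (s * i) * X ≤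
      C * 2 ^ D * (geo ε (min j k) * ((2 ^ (α * j) * N) * (2 ^ (β * k) * M))) := by
  calc 2 ^ (s * i) * X ≤ 2 ^ (s * i) * (C * 2 ^ w * (N * M)) := by gcongr
    _ = C * 2 ^ (s * i + w) * (N * M) := by
        rw [two_rpow_add]
        ring
    _ ≤ C * 2 ^ (D + -(ε * (min j k : ℕ)) + α * j + β * k) * (N * M) := by
        gcongr ?_ * _
        refine mul_le_mul' le_rfl (two_rpow_le_two_rpow ?_)
        linarith
    _ = _ := by
        rw [two_rpow_add, two_rpow_add, two_rpow_add, geo]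
        ring

section Pieces

variable {u v : ℝ × ℝ → ℂ} {N M : ℕ → ℝ≥0∞}

theorem supNorm_le_of_sharpL (hu : TemperedSlices u)
    (hN : ∀ j, 𝓓.sharpL j (𝓓.St j u) ≤ 𝓓.cutC * N j) (j : ℕ) :
    supNorm (𝓓.St j u) ≤ 6 * 𝓓.kerConst * 𝓓.cutC * 2 ^ ((j : ℝ) / 2) * N j := by
  refine (supNorm_St_le hu j).trans ?_
  calc _ ≤ 6 * 𝓓.kerConst * 2 ^ ((j : ℝ) / 2) * (𝓓.cutC * N j) := by
        gcongr
        exact hN j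
    _ = _ := by ring

theorem mix_le_of_sharpL (hu : TemperedSlices u)
    (hN : ∀ j, 𝓓.sharpL j (𝓓.St j u) ≤ 𝓓.cutC * N j) (j : ℕ) :
    mix ⊤ 2 univ (fun z => ‖𝓓.St j u z‖ₑ) ≤ 𝓓.cutC * N j :=
  (mix_univ_le_sharpL (aestronglyMeasurable_St hu.aestronglyMeasurable j) j).trans (hN j)

theorem tsum_supNorm_ne_top {δ : ℝ} (hδ : 0 < δ) {C : ℝ≥0∞} (hC : C ≠ ⊤) {a : ℕ → ℝ≥0∞}
    (ha : l2 a ≠ ⊤) (h : ∀ j, supNorm (𝓓.St j u) ≤ C * (geo δ j * a j)) :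
    ∑' j, supNorm (𝓓.St j u) ≠ ⊤ := by
  refine ne_top_of_le_ne_top (ENNReal.mul_ne_top hC (ENNReal.mul_ne_top (tsum_geo_ne_top hδ) ha))
    ((ENNReal.tsum_le_tsum h).trans ?_)
  rw [ENNReal.tsum_mul_left]
  gcongr
  exact tsum_geo_mul_le δ a

/-- Bernstein's inequality loses `2^(j/2)`, and a weight with `α > 1/2` leaves a summable geometric
factor. This is the Sobolev embedding that makes one factor of the product bounded. -/
theorem tsum_supNorm_ne_top_of_sharpL (hu : TemperedSlices u)
    {α : ℝ} (hα : 1 / 2 < α)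
    (hN : ∀ j, 𝓓.sharpL j (𝓓.St j u) ≤ 𝓓.cutC * N j)
    (h : l2 (fun j => 2 ^ (α * j) * N j) ≠ ⊤) : ∑' j, supNorm (𝓓.St j u) ≠ ⊤ := by
  have hK := 𝓓.kerConst_ne_top
  have hc := 𝓓.cutC_ne_top
  refine tsum_supNorm_ne_top (sub_pos.2 hα) (C := 6 * 𝓓.kerConst * 𝓓.cutC) (by finiteness) h
    fun j => (supNorm_le_of_sharpL hu hN j).trans_eq ?_
  rw [geo, ← mul_assoc (2 ^ _ : ℝ≥0∞), ← two_rpow_add,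
    show -((α - 1 / 2) * (j : ℝ)) + α * j = j / 2 by ring]
  ring

/-- High-low interactions in `X`. -/
theorem l1_normXj_pieces_high_low (hu : TemperedSlices u) (hv : TemperedSlices v)
    (hM : ∀ k, 𝓓.sharpL k (𝓓.St k v) ≤ 𝓓.cutC * M k)
    (hM' : ∀ k, M k ≠ ⊤) {i j k : ℕ} (h1 : i ≤ j + 2) (h2 : j ≤ i + 2) :
    𝓓.l1 i (𝓓.normXj i) (𝓓.St i fun z => 𝓓.St j u z * 𝓓.St k v z) ≤
      𝓓.prodConst * 2 ^ (4 + (k : ℝ) / 2) * (𝓓.l1 j (𝓓.normXj j) (𝓓.St j u) * M k) := by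
  have hK := 𝓓.kerConst_ne_top
  have hc := 𝓓.cutC_ne_top
  have h1' : (i : ℝ) ≤ j + 2 := by exact_mod_cast h1
  have h2' : (j : ℝ) ≤ i + 2 := by exact_mod_cast h2
  have hk := hM' k
  have hb := supNorm_le_of_sharpL hv hM k
  have hw := two_rpow_ne_top ((k : ℝ) / 2)
  have := l1_normXj_St_mul_le (𝓓 := 𝓓) (aestronglyMeasurable_St hv.aestronglyMeasurable k)
    (aestronglyMeasurable_St (𝓓 := 𝓓) hu.aestronglyMeasurable j)
    (ne_top_of_le_ne_top (by finiteness) hb) (i := i) (k := j) (w := 4) (by linarith) (by linarith)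
  simp only [mul_comm (𝓓.St k v _)] at this
  refine this.trans ?_
  calc _ ≤ 162 * 𝓓.kerConst * 𝓓.cutC * 2 ^ (4 : ℝ) *
        ((6 * 𝓓.kerConst * 𝓓.cutC * 2 ^ ((k : ℝ) / 2) * M k) *
          𝓓.l1 j (𝓓.normXj j) (𝓓.St j u)) := by gcongr
    _ = (972 * 𝓓.kerConst ^ 2 * 𝓓.cutC ^ 2) * 2 ^ (4 + (k : ℝ) / 2) *
          (𝓓.l1 j (𝓓.normXj j) (𝓓.St j u) * M k) := by
        rw [two_rpow_add]
        ring
    _ ≤ _ := by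
        gcongr
        exact le_prodConst (by norm_num) le_rfl le_rfl

/-- High-high interactions in `X`. -/
theorem l1_normXj_pieces_high_high (hu : TemperedSlices u) (hv : TemperedSlices v)
    (hN : ∀ j, 𝓓.sharpL j (𝓓.St j u) ≤ 𝓓.cutC * N j)
    (hN' : ∀ j, N j ≠ ⊤) {i j k : ℕ} (h1 : i ≤ k) (h2 : j ≤ k + 2) :
    𝓓.l1 i (𝓓.normXj i) (𝓓.St i fun z => 𝓓.St j u z * 𝓓.St k v z) ≤
      𝓓.prodConst * 2 ^ (2 * (k : ℝ) - 3 / 2 * i + 2) *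
        (N j * 𝓓.l1 k (𝓓.normXj k) (𝓓.St k v)) := by
  have hK := 𝓓.kerConst_ne_top
  have hc := 𝓓.cutC_ne_top
  have h1' : (i : ℝ) ≤ k := by exact_mod_cast h1
  have h2' : (j : ℝ) ≤ k + 2 := by exact_mod_cast h2
  have hj := hN' j
  have hb := supNorm_le_of_sharpL hu hN j
  have hw := two_rpow_ne_top ((j : ℝ) / 2)
  refine (l1_normXj_St_mul_le_of_le (aestronglyMeasurable_St hu.aestronglyMeasurable j)
    (aestronglyMeasurable_St hv.aestronglyMeasurable k)
    (ne_top_of_le_ne_top (by finiteness) hb) h1).trans ?_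
  calc _ ≤ 81 * 𝓓.kerConst * 𝓓.cutC * (2 ^ ((k : ℝ) - i) *
        (6 * 𝓓.kerConst * 𝓓.cutC * 2 ^ ((j : ℝ) / 2) * N j) +
        2 ^ (2 * (k : ℝ) - 3 / 2 * i) * (𝓓.cutC * N j)) * 𝓓.l1 k (𝓓.normXj k) (𝓓.St k v) := by
        gcongr
        exact mix_le_of_sharpL hu hN j
    _ = ((486 * 𝓓.kerConst ^ 2 * 𝓓.cutC ^ 2) * 2 ^ ((k : ℝ) - i + j / 2) +
        (81 * 𝓓.kerConst ^ 1 * 𝓓.cutC ^ 2) * 2 ^ (2 * (k : ℝ) - 3 / 2 * i)) *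
        (N j * 𝓓.l1 k (𝓓.normXj k) (𝓓.St k v)) := by
        rw [two_rpow_add]
        ring
    _ ≤ (𝓓.prodConst * 2 ^ (2 * (k : ℝ) - 3 / 2 * i + 1) +
        𝓓.prodConst * 2 ^ (2 * (k : ℝ) - 3 / 2 * i + 1)) *
        (N j * 𝓓.l1 k (𝓓.normXj k) (𝓓.St k v)) := by
        refine mul_le_mul' (add_le_add (mul_le_mul' (le_prodConst (by norm_num) le_rfl le_rfl)
          (two_rpow_le_two_rpow (by linarith))) (mul_le_mul' (le_prodConst (by norm_num)
            (by norm_num) le_rfl) (two_rpow_le_two_rpow (by linarith)))) le_rfl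
    _ = _ := by
        rw [show 2 * (k : ℝ) - 3 / 2 * i + 2 = 2 * (k : ℝ) - 3 / 2 * i + 1 + 1 by ring,
          two_rpow_add (2 * (k : ℝ) - 3 / 2 * i + 1) 1, ENNReal.rpow_one]
        generalize (2 : ℝ≥0∞) ^ (2 * (k : ℝ) - 3 / 2 * i + 1) = y
        ring

/-- High-low interactions in `L^1 L^2`. -/
theorem l1_normL1L2_pieces_high_low (hu : TemperedSlices u) (hv : TemperedSlices v)
    (hN : ∀ j, 𝓓.sharpH j (𝓓.St j u) ≤ 𝓓.cutC * N j)
    (hM : ∀ k, 𝓓.sharpL k (𝓓.St k v) ≤ 𝓓.cutC * M k)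
    (hM' : ∀ k, M k ≠ ⊤) {i j k : ℕ} (h : j ≤ i + 2) :
    𝓓.l1 i normL1L2 (𝓓.St i fun z => 𝓓.St j u z * 𝓓.St k v z) ≤
      𝓓.prodConst * 2 ^ (2 + (k : ℝ) / 2) * (N j * M k) := by
  have hK := 𝓓.kerConst_ne_top
  have hc := 𝓓.cutC_ne_top
  have h' : (j : ℝ) ≤ i + 2 := by exact_mod_cast h
  have hk := hM' k
  have hb := supNorm_le_of_sharpL hv hM k
  have hw := two_rpow_ne_top ((k : ℝ) / 2)
  have := l1_normL1L2_St_mul_le (𝓓 := 𝓓) (aestronglyMeasurable_St hv.aestronglyMeasurable k)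
    (aestronglyMeasurable_St (𝓓 := 𝓓) hu.aestronglyMeasurable j)
    (ne_top_of_le_ne_top (by finiteness) hb) (i := i) (k := j) (w := 2) (by norm_num)
    (by linarith)
  simp only [mul_comm (𝓓.St k v _)] at this
  refine this.trans ?_
  calc _ ≤ 27 * 𝓓.kerConst * 2 ^ (2 : ℝ) *
        ((6 * 𝓓.kerConst * 𝓓.cutC * 2 ^ ((k : ℝ) / 2) * M k) * (𝓓.cutC * N j)) := by
        gcongr
        exact hN j
    _ = (162 * 𝓓.kerConst ^ 2 * 𝓓.cutC ^ 2) * 2 ^ (2 + (k : ℝ) / 2) * (N j * M k) := by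
        rw [two_rpow_add]
        ring
    _ ≤ _ := by
        gcongr
        exact le_prodConst (by norm_num) le_rfl le_rfl

/-- High-high interactions in `L^1 L^2`. -/
theorem l1_normL1L2_pieces_high_high (hu : TemperedSlices u) (hv : TemperedSlices v)
    (hN : ∀ j, 𝓓.sharpL j (𝓓.St j u) ≤ 𝓓.cutC * N j)
    (hM : ∀ k, 𝓓.sharpL k (𝓓.St k v) ≤ 𝓓.cutC * M k) (i j k : ℕ) :
    𝓓.l1 i normL1L2 (𝓓.St i fun z => 𝓓.St j u z * 𝓓.St k v z) ≤
      𝓓.prodConst * 2 ^ ((i : ℝ) / 2) * (N j * M k) := by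
  refine (l1_normL1L2_St_mul_le_sqrt (aestronglyMeasurable_St hu.aestronglyMeasurable j)
    (aestronglyMeasurable_St hv.aestronglyMeasurable k) i).trans ?_
  calc _ ≤ 9 * 𝓓.kerConst * 2 ^ ((i : ℝ) / 2) * ((𝓓.cutC * N j) * (𝓓.cutC * M k)) := by
        gcongr
        · exact mix_le_of_sharpL hu hN j
        · exact mix_le_of_sharpL hv hM k
    _ = (9 * 𝓓.kerConst ^ 1 * 𝓓.cutC ^ 2) * 2 ^ ((i : ℝ) / 2) * (N j * M k) := by ring
    _ ≤ _ := by
        gcongr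
        exact le_prodConst (by norm_num) (by norm_num) le_rfl

/-- High-high interactions in `Y`. -/
theorem l1_normYj_pieces_high_high (hu : TemperedSlices u) (hv : TemperedSlices v)
    (hN : ∀ j, 𝓓.sharpL j (𝓓.St j u) ≤ 𝓓.cutC * N j)
    (hM : ∀ k, 𝓓.sharpL k (𝓓.St k v) ≤ 𝓓.cutC * M k) (i j k : ℕ) :
    𝓓.l1 i (𝓓.normYj i) (𝓓.St i fun z => 𝓓.St j u z * 𝓓.St k v z) ≤
      𝓓.prodConst * 2 ^ ((i : ℝ) / 2) * (N j * M k) :=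
  (l1_normYj_le_l1_normL1L2 (aestronglyMeasurable_St
    ((aestronglyMeasurable_St hu.aestronglyMeasurable j).mul
      (aestronglyMeasurable_St hv.aestronglyMeasurable k)) i) i).trans
    (l1_normL1L2_pieces_high_high hu hv hN hM i j k)

/-- High-low interactions in `Y`, in terms of the local `L^2` norms of the high frequency factor. -/
theorem l1_normYj_pieces_of_mix_le (hu : TemperedSlices u) (hv : TemperedSlices v)
    (hM : ∀ k, 𝓓.sharpL k (𝓓.St k v) ≤ 𝓓.cutC * M k)
    (hM' : ∀ k, M k ≠ ⊤) {i j k : ℕ} (h : k ≤ i) {w : ℝ} {A : ℝ≥0∞}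
    (hA : ∀ n, mix 2 2 (𝓓.Q (2 * k) n) (fun z => ‖𝓓.St j u z‖ₑ) ≤ 2 ^ w * (𝓓.cutC * A)) :
    𝓓.l1 i (𝓓.normYj i) (𝓓.St i fun z => 𝓓.St j u z * 𝓓.St k v z) ≤
      𝓓.prodConst * 2 ^ (3 / 2 * (k : ℝ) - i + w) * (A * M k) := by
  have hK := 𝓓.kerConst_ne_top
  have hc := 𝓓.cutC_ne_top
  have hk := hM' k
  have hw := two_rpow_ne_top ((k : ℝ) / 2)
  have hb : ∑' n, mix ⊤ ⊤ (𝓓.Q (2 * k) n) (fun z => ‖𝓓.St k v z‖ₑ) ≤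
      6 * 𝓓.kerConst * 2 ^ ((k : ℝ) / 2) * (𝓓.cutC * M k) := by
    refine (tsum_mix_top_St_le hv k).trans ?_
    gcongr
    exact hM k
  refine (l1_normYj_St_mul_le_of_le (aestronglyMeasurable_St hu.aestronglyMeasurable j)
    (aestronglyMeasurable_St hv.aestronglyMeasurable k) h hA
    (ne_top_of_le_ne_top (by finiteness) hb)).trans ?_
  calc _ ≤ 27 * 𝓓.kerConst * 2 ^ ((k : ℝ) - i) * ((2 ^ w * (𝓓.cutC * A)) *
        (6 * 𝓓.kerConst * 2 ^ ((k : ℝ) / 2) * (𝓓.cutC * M k))) := by gcongr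
    _ = (162 * 𝓓.kerConst ^ 2 * 𝓓.cutC ^ 2) *
        (2 ^ ((k : ℝ) - i) * 2 ^ ((k : ℝ) / 2) * 2 ^ w) * (A * M k) := by ring
    _ ≤ 𝓓.prodConst * (2 ^ ((k : ℝ) - i) * 2 ^ ((k : ℝ) / 2) * 2 ^ w) * (A * M k) := by
        gcongr
        exact le_prodConst (by norm_num) le_rfl le_rfl
    _ = _ := by
        simp only [← two_rpow_add]
        ring_nf

/-- High-low interactions in `Y` without local smoothing. -/
theorem l1_normYj_pieces_high_low (hu : TemperedSlices u) (hv : TemperedSlices v)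
    (hN : ∀ j, 𝓓.sharpL j (𝓓.St j u) ≤ 𝓓.cutC * N j)
    (hM : ∀ k, 𝓓.sharpL k (𝓓.St k v) ≤ 𝓓.cutC * M k)
    (hM' : ∀ k, M k ≠ ⊤) {i j k : ℕ} (h : k ≤ i) :
    𝓓.l1 i (𝓓.normYj i) (𝓓.St i fun z => 𝓓.St j u z * 𝓓.St k v z) ≤
      𝓓.prodConst * 2 ^ (3 / 2 * (k : ℝ) - i) * (N j * M k) := by
  have := l1_normYj_pieces_of_mix_le hu hv hM hM' (j := j) h (w := 0) (A := N j) fun n => by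
    rw [ENNReal.rpow_zero, one_mul]
    exact (mix_two_two_le (aestronglyMeasurable_St hu.aestronglyMeasurable j) _).trans
      (mix_le_of_sharpL hu hN j)
  rwa [add_zero] at this

/-- High-low interactions in `Y` with local smoothing. -/
theorem l1_normYj_pieces_high_low_smoothing (hu : TemperedSlices u) (hv : TemperedSlices v)
    (hM : ∀ k, 𝓓.sharpL k (𝓓.St k v) ≤ 𝓓.cutC * M k)
    (hM' : ∀ k, M k ≠ ⊤) {i j k : ℕ} (h : k ≤ i) :
    𝓓.l1 i (𝓓.normYj i) (𝓓.St i fun z => 𝓓.St j u z * 𝓓.St k v z) ≤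
      𝓓.prodConst * 2 ^ (3 / 2 * (k : ℝ) - i + (k - j)) *
        (𝓓.l1 j (𝓓.normXj j) (𝓓.St j u) * M k) := by
  have hm := aestronglyMeasurable_St (𝓓 := 𝓓) hu.aestronglyMeasurable j
  refine l1_normYj_pieces_of_mix_le hu hv hM hM' h fun n => ?_
  refine (mix_two_two_le_sharpX hm j k n).trans ?_
  rw [sub_eq_add_neg, two_rpow_add, mul_assoc]
  gcongr
  exact two_pow_mul_sharpX_le hm j

end Pieces

end Setup

end BilEst

end

/-! ### Verification of the exponents in the three frequency regimes. -/

noncomputable section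

namespace BilEst

open Filter Topology SchwartzMap

namespace Setup

variable {𝓓 : Setup} {u v : ℝ × ℝ → ℂ}

theorem St_mul_comm (i : ℕ) (f g : ℝ × ℝ → ℂ) :
    (𝓓.St i fun z => f z * g z) = 𝓓.St i fun z => g z * f z := by
  simp only [mul_comm]

theorem sharpL_le_of_temperedSlices (hu : TemperedSlices u) (j : ℕ) :
    𝓓.sharpL j (𝓓.St j u) ≤ 𝓓.cutC * 𝓓.l1 j (𝓓.normXj j) (𝓓.St j u) :=
  sharpL_le_l1_normXj (aestronglyMeasurable_St hu.aestronglyMeasurable j) j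

/-- The weights in high-high interactions. -/
theorem weight_high_high {i j k : ℕ} {s α β : ℝ} (hs : 1 / 2 < s) (h1 : i ≤ j) (h2 : i ≤ k)
    (h3 : j ≤ k + 2) (h4 : k ≤ j + 2) :
    s * i + (i : ℝ) / 2 ≤ 2 * s + 2 + 2 * |α| + 2 * |β| -
      (α + β - s - 1 / 2) * (min j k : ℕ) + α * j + β * k := by
  -- Here `j` and `k` exceed their minimum by at most 2; replacing them by the minimum changes the
  -- exponents by at most `2 * |α|` and `2 * |β|`, whatever the signs of `α` and `β`.
  have aux : ∀ {γ x : ℝ}, 0 ≤ x → x ≤ 2 → -(2 * |γ|) ≤ γ * x := by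
    intro γ x h0 h2
    nlinarith [neg_abs_le γ, abs_nonneg γ, mul_le_mul_of_nonneg_right (neg_abs_le γ) h0,
      mul_le_mul_of_nonneg_left h2 (abs_nonneg γ)]
  have hm1 : (i : ℝ) ≤ (min j k : ℕ) := by exact_mod_cast le_min h1 h2
  have hm2 : ((min j k : ℕ) : ℝ) ≤ j := by exact_mod_cast min_le_left j k
  have hm3 : ((min j k : ℕ) : ℝ) ≤ k := by exact_mod_cast min_le_right j k
  have hm4 : (j : ℝ) ≤ (min j k : ℕ) + 2 := by exact_mod_cast (by omega : j ≤ min j k + 2)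
  have hm5 : (k : ℝ) ≤ (min j k : ℕ) + 2 := by exact_mod_cast (by omega : k ≤ min j k + 2)
  generalize ((min j k : ℕ) : ℝ) = m at *
  have e1 := aux (γ := α) (sub_nonneg.2 hm2) (by linarith)
  have e2 := aux (γ := β) (sub_nonneg.2 hm3) (by linarith)
  have e3 : s * i ≤ s * m := by gcongr
  linarith

/-! ### Algebra estimates -/

/-- High-low interactions lose half a power of the low frequency and would allow `s > 1/2`.
High-high interactions lose `2^(2k - 3i/2)`; for small `i` the available `2^(2sk)` beats this with
room to spare only if `s > 1`. -/
theorem besov_normXj_mul_le {s : ℝ} (hs : 1 < s) (hu : TemperedSlices u) (hv : TemperedSlices v)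
    (hu' : 𝓓.besov 𝓓.normXj s u ≠ ⊤) (hv' : 𝓓.besov 𝓓.normXj s v ≠ ⊤) :
    TemperedSlices (fun z => u z * v z) ∧
      𝓓.besov 𝓓.normXj s (fun z => u z * v z) ≤ 𝓓.prodConst * 2 ^ (2 * s + 4) *
        bilinearConst (s - 1) * 𝓓.besov 𝓓.normXj s u * 𝓓.besov 𝓓.normXj s v := by
  have hN := sharpL_le_of_temperedSlices (𝓓 := 𝓓) hu
  have hM := sharpL_le_of_temperedSlices (𝓓 := 𝓓) hv
  have hN' := l1_ne_top_of_besov hu'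
  have hM' := l1_ne_top_of_besov hv'
  refine besov_mul_le isSpaceTimeNorm_normXj (sub_pos.2 hs) hu hv
    (Or.inr (tsum_supNorm_ne_top_of_sharpL hv (by linarith) hM hv')) fun i j k hI => ?_
  have hi : (0 : ℝ) ≤ i := Nat.cast_nonneg i
  have hj : (0 : ℝ) ≤ j := Nat.cast_nonneg j
  have hk : (0 : ℝ) ≤ k := Nat.cast_nonneg k
  rcases hI.cases with ⟨h1, h2, h3, h4⟩ | ⟨h1, h2, h3, h4⟩ | ⟨h1, h2, h3, h4⟩
  · refine weight_le (l1_normXj_pieces_high_low hu hv hM hM' h3 h4) ?_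
    have h3' : (i : ℝ) ≤ j + 2 := by exact_mod_cast h3
    rw [min_eq_right h2]
    nlinarith
  · rw [St_mul_comm]
    refine weight_le ((l1_normXj_pieces_high_low hv hu hN hN' h3 h4).trans_eq
      (by rw [mul_comm (𝓓.l1 k _ _)])) ?_
    have h3' : (i : ℝ) ≤ k + 2 := by exact_mod_cast h3
    rw [min_eq_left h2]
    nlinarith
  · refine weight_le (l1_normXj_pieces_high_high hu hv hN hN' h2 h3) ?_
    have h2' : (i : ℝ) ≤ k := by exact_mod_cast h2
    have h4' : (k : ℝ) ≤ j + 2 := by exact_mod_cast h4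
    have hm : ((min j k : ℕ) : ℝ) ≤ k := by exact_mod_cast min_le_right j k
    have e1 : (s - 1) * (min j k : ℕ) ≤ (s - 1) * k :=
      mul_le_mul_of_nonneg_left hm (by linarith)
    have e2 : s * k ≤ s * j + 2 * s := by nlinarith
    have e3 : (s - 3 / 2) * i ≤ (s - 1) * k := by nlinarith
    linarith

/-- High-low interactions lose half a power of the low frequency and high-high interactions half a
power of the output frequency, so `s > 1/2` suffices in every regime. -/
theorem besov_normL1L2_mul_le {s : ℝ} (hs : 1 / 2 < s) {a b : ℝ → ℂ} (ha : TemperedFun a)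
    (hb : TemperedFun b) (ha' : 𝓓.besov (fun _ => normL1L2) s (fun z => a z.2) ≠ ⊤)
    (hb' : 𝓓.besov (fun _ => normL1L2) s (fun z => b z.2) ≠ ⊤) :
    TemperedSlices (fun z => a z.2 * b z.2) ∧
      𝓓.besov (fun _ => normL1L2) s (fun z => a z.2 * b z.2) ≤
        𝓓.prodConst * 2 ^ (2 * s + 2 + 2 * |s| + 2 * |s|) * bilinearConst (s + s - s - 1 / 2) *
          𝓓.besov (fun _ => normL1L2) s (fun z => a z.2) *
          𝓓.besov (fun _ => normL1L2) s (fun z => b z.2) := by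
  have hu := temperedSlices_snd ha
  have hv := temperedSlices_snd hb
  have hN : ∀ j, 𝓓.sharpL j (𝓓.St j fun z => a z.2) ≤ 𝓓.cutC *
    𝓓.l1 j normL1L2 (𝓓.St j fun z => a z.2) := fun j => sharpL_snd_le j (𝓓.S j a)
  have hM : ∀ j, 𝓓.sharpL j (𝓓.St j fun z => b z.2) ≤ 𝓓.cutC *
    𝓓.l1 j normL1L2 (𝓓.St j fun z => b z.2) := fun j => sharpL_snd_le j (𝓓.S j b)
  have hN' := l1_ne_top_of_besov ha'
  have hM' := l1_ne_top_of_besov hb'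
  refine besov_mul_le (fun _ => isSpaceTimeNorm_normL1L2) (by linarith) hu hv
    (Or.inr (tsum_supNorm_ne_top_of_sharpL hv hs hM hb')) fun i j k hI => ?_
  have hs0 := abs_nonneg s
  rcases hI.cases with ⟨h1, h2, h3, h4⟩ | ⟨h1, h2, h3, h4⟩ | ⟨h1, h2, h3, h4⟩
  · refine weight_le (l1_normL1L2_pieces_high_low hu hv (fun j => sharpH_le_l1 j _) hM hM' h4) ?_
    have h3' : (i : ℝ) ≤ j + 2 := by exact_mod_cast h3
    rw [min_eq_right h2]
    nlinarith
  · rw [St_mul_comm]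
    refine weight_le ((l1_normL1L2_pieces_high_low hv hu (fun j => sharpH_le_l1 j _) hN hN'
      h4).trans_eq (by rw [mul_comm (𝓓.l1 k _ _)])) ?_
    have h3' : (i : ℝ) ≤ k + 2 := by exact_mod_cast h3
    rw [min_eq_left h2]
    nlinarith
  · exact weight_le (l1_normL1L2_pieces_high_high hu hv hN hM i j k)
      (weight_high_high hs h1 h2 h3 h4)

/-! ### Products in `Y` -/

/-- With `i` close to `j` and `k` low, the smoothing bound leaves the power `s - 2 - α` of the high
frequency. As it is nonpositive and `k ≤ j`, it may be transferred to the low frequency, where the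
condition on `α + β` gives exactly the decay `α + β - s - 1/2`. -/
theorem besov_normYj_mul_le {s α β : ℝ} (hs : 1 / 2 < s) (hα : s - 2 ≤ α) (hβ : s - 2 ≤ β)
    (hαβ : s + 1 / 2 < α + β) (hu : TemperedSlices u) (hv : TemperedSlices v)
    (hu' : 𝓓.besov 𝓓.normXj α u ≠ ⊤) (hv' : 𝓓.besov 𝓓.normXj β v ≠ ⊤) :
    TemperedSlices (fun z => u z * v z) ∧
      𝓓.besov 𝓓.normYj s (fun z => u z * v z) ≤
        𝓓.prodConst * 2 ^ (2 * s + 2 + 2 * |α| + 2 * |β|) * bilinearConst (α + β - s - 1 / 2) *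
          𝓓.besov 𝓓.normXj α u * 𝓓.besov 𝓓.normXj β v := by
  have hN := sharpL_le_of_temperedSlices (𝓓 := 𝓓) hu
  have hM := sharpL_le_of_temperedSlices (𝓓 := 𝓓) hv
  have hN' := l1_ne_top_of_besov hu'
  have hM' := l1_ne_top_of_besov hv'
  have hα0 := abs_nonneg α
  have hβ0 := abs_nonneg β
  refine besov_mul_le isSpaceTimeNorm_normYj (by linarith) hu hv ?_ fun i j k hI => ?_
  · rcases lt_or_ge (1 / 2) α with h | h
    · exact Or.inl (tsum_supNorm_ne_top_of_sharpL hu h hN hu')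
    · exact Or.inr (tsum_supNorm_ne_top_of_sharpL hv (by linarith) hM hv')
  rcases hI.cases with ⟨h1, h2, h3, h4⟩ | ⟨h1, h2, h3, h4⟩ | ⟨h1, h2, h3, h4⟩
  · refine weight_le (l1_normYj_pieces_high_low_smoothing hu hv hM hM' h1) ?_
    have h2' : (k : ℝ) ≤ j := by exact_mod_cast h2
    have h3' : (i : ℝ) ≤ j + 2 := by exact_mod_cast h3
    have h4' : (j : ℝ) ≤ i + 2 := by exact_mod_cast h4
    rw [min_eq_right h2]
    nlinarith [mul_nonneg (sub_nonneg.2 hα) (sub_nonneg.2 h2')]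
  · rw [St_mul_comm]
    refine weight_le ((l1_normYj_pieces_high_low_smoothing hv hu hN hN' h1).trans_eq
      (by rw [mul_comm (𝓓.l1 k _ _)])) ?_
    have h2' : (j : ℝ) ≤ k := by exact_mod_cast h2
    have h3' : (i : ℝ) ≤ k + 2 := by exact_mod_cast h3
    have h4' : (k : ℝ) ≤ i + 2 := by exact_mod_cast h4
    rw [min_eq_left h2]
    nlinarith [mul_nonneg (sub_nonneg.2 hβ) (sub_nonneg.2 h2')]
  · exact weight_le (l1_normYj_pieces_high_high hu hv hN hM i j k)
      (weight_high_high hs h1 h2 h3 h4)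

/-- A time-independent factor carries no local energy norm. If it has the high frequency, the gain
`2^(k-j)` is missing, and one more derivative must be asked of it. If `v` has the high frequency,
the smoothing bound is still available. -/
theorem besov_normYj_snd_mul_le {s α β : ℝ} (hs : 1 / 2 < s) (hα : s - 1 ≤ α) (hβ : s - 1 ≤ β)
    (hαβ : s + 1 / 2 < α + β) {a : ℝ → ℂ} (ha : TemperedFun a) (hv : TemperedSlices v)
    (ha' : 𝓓.besov (fun _ => normL1L2) α (fun z => a z.2) ≠ ⊤)
    (hv' : 𝓓.besov 𝓓.normXj β v ≠ ⊤) :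
    TemperedSlices (fun z => a z.2 * v z) ∧
      𝓓.besov 𝓓.normYj s (fun z => a z.2 * v z) ≤
        𝓓.prodConst * 2 ^ (2 * s + 2 + 2 * |α| + 2 * |β|) * bilinearConst (α + β - s - 1 / 2) *
          𝓓.besov (fun _ => normL1L2) α (fun z => a z.2) * 𝓓.besov 𝓓.normXj β v := by
  have hu := temperedSlices_snd ha
  have hN : ∀ j, 𝓓.sharpL j (𝓓.St j fun z => a z.2) ≤ 𝓓.cutC *
    𝓓.l1 j normL1L2 (𝓓.St j fun z => a z.2) := fun j => sharpL_snd_le j (𝓓.S j a)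
  have hM := sharpL_le_of_temperedSlices (𝓓 := 𝓓) hv
  have hN' := l1_ne_top_of_besov ha'
  have hM' := l1_ne_top_of_besov hv'
  have hα0 := abs_nonneg α
  have hβ0 := abs_nonneg β
  refine besov_mul_le isSpaceTimeNorm_normYj (by linarith) hu hv ?_ fun i j k hI => ?_
  · rcases lt_or_ge (1 / 2) α with h | h
    · exact Or.inl (tsum_supNorm_ne_top_of_sharpL hu h hN ha')
    · exact Or.inr (tsum_supNorm_ne_top_of_sharpL hv (by linarith) hM hv')
  rcases hI.cases with ⟨h1, h2, h3, h4⟩ | ⟨h1, h2, h3, h4⟩ | ⟨h1, h2, h3, h4⟩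
  · refine weight_le (l1_normYj_pieces_high_low hu hv hN hM hM' h1) ?_
    have h2' : (k : ℝ) ≤ j := by exact_mod_cast h2
    have h3' : (i : ℝ) ≤ j + 2 := by exact_mod_cast h3
    have h4' : (j : ℝ) ≤ i + 2 := by exact_mod_cast h4
    rw [min_eq_right h2]
    nlinarith [mul_nonneg (sub_nonneg.2 hα) (sub_nonneg.2 h2')]
  · rw [St_mul_comm]
    refine weight_le ((l1_normYj_pieces_high_low_smoothing hv hu hN hN' h1).trans_eq
      (by rw [mul_comm (𝓓.l1 k _ _)])) ?_
    have h2' : (j : ℝ) ≤ k := by exact_mod_cast h2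
    have h3' : (i : ℝ) ≤ k + 2 := by exact_mod_cast h3
    have h4' : (k : ℝ) ≤ i + 2 := by exact_mod_cast h4
    rw [min_eq_left h2]
    nlinarith [mul_nonneg (sub_nonneg.2 hβ) (sub_nonneg.2 h2')]
  · exact weight_le (l1_normYj_pieces_high_high hu hv hN hM i j k)
      (weight_high_high hs h1 h2 h3 h4)

/-! ### Multiplication by Zygmund functions -/

theorem supNorm_St_snd_le (γ : ℝ) (a : ℝ → ℂ) (j : ℕ) :
    supNorm (𝓓.St j fun z => a z.2) ≤ geo γ j * 𝓓.normZyg γ a := by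
  have h : 2 ^ (γ * j) * supNorm (𝓓.St j fun z => a z.2) ≤ 𝓓.normZyg γ a := by
    have : supNorm (𝓓.St j fun z => a z.2) = eLpNorm (𝓓.S j a) ⊤ volume := supNorm_snd (𝓓.S j a)
    rw [this]
    exact le_iSup (fun j : ℕ => (2 : ℝ≥0∞) ^ (γ * j) * eLpNorm (𝓓.S j a) ⊤ volume) j
  calc _ = geo γ j * (2 ^ (γ * j) * supNorm (𝓓.St j fun z => a z.2)) := by
        rw [← mul_assoc, geo, two_rpow_neg_mul_self, one_mul]
    _ ≤ _ := by gcongr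

/-- The supremum in the Zygmund norm leaves the weights `2^(-(γ-γ')j)`, a convergent geometric
series once `γ' < γ`; the strict inequalities on `γ` are spent here. -/
theorem l2_supNorm_le (γ γ' : ℝ) (a : ℝ → ℂ) :
    l2 (fun j => 2 ^ (γ' * j) * supNorm (𝓓.St j fun z => a z.2)) ≤
      (∑' j, geo (γ - γ') j) * 𝓓.normZyg γ a := by
  refine (l2_le_tsum _).trans ?_
  rw [← ENNReal.tsum_mul_right]
  refine ENNReal.tsum_le_tsum fun j => ?_
  calc _ ≤ 2 ^ (γ' * j) * (geo γ j * 𝓓.normZyg γ a) := by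
        gcongr
        exact supNorm_St_snd_le γ a j
    _ = geo (γ - γ') j * 𝓓.normZyg γ a := by
        rw [← mul_assoc, geo, geo, ← two_rpow_add]
        ring_nf

theorem supNorm_St_snd_ne_top {γ : ℝ} {a : ℝ → ℂ} (h : 𝓓.normZyg γ a ≠ ⊤) (j : ℕ) :
    supNorm (𝓓.St j fun z => a z.2) ≠ ⊤ :=
  ne_top_of_le_ne_top (ENNReal.mul_ne_top (two_rpow_ne_top _) h) (supNorm_St_snd_le γ a j)

theorem tsum_supNorm_St_snd_ne_top {γ : ℝ} (hγ : 0 < γ) {a : ℝ → ℂ} (h : 𝓓.normZyg γ a ≠ ⊤) :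
    ∑' j, supNorm (𝓓.St j fun z => a z.2) ≠ ⊤ := by
  refine ne_top_of_le_ne_top (ENNReal.mul_ne_top (tsum_geo_ne_top hγ) h)
    ((ENNReal.tsum_le_tsum (supNorm_St_snd_le γ a)).trans_eq ?_)
  rw [ENNReal.tsum_mul_right]

/-- If `a` has the high frequency, the output weight `2^i` of `X_i` replaces `2^k`, which costs one
derivative; hence `a` is measured with weight `s + 1`. High-high interactions lose `2^(2(k-i))`, and
for small `i` this requires `2 < 2s + 1`. -/
theorem besov_normXj_zyg_mul_le {s γ : ℝ} (hs : 1 / 2 < s) (hγ : s + 1 < γ) {a : ℝ → ℂ}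
    (ha : TemperedFun a) (hv : TemperedSlices v) (ha' : 𝓓.normZyg γ a ≠ ⊤) :
    TemperedSlices (fun z => a z.2 * v z) ∧
      𝓓.besov 𝓓.normXj s (fun z => a z.2 * v z) ≤
        𝓓.prodConst * 2 ^ (2 * s + 4) * bilinearConst (s - 1 / 2) * (∑' j, geo (γ - (s + 1)) j) *
          𝓓.normZyg γ a * 𝓓.besov 𝓓.normXj s v := by
  have hu := temperedSlices_snd ha
  have hfin := supNorm_St_snd_ne_top ha'
  have hmu := fun j => aestronglyMeasurable_St (𝓓 := 𝓓) hu.aestronglyMeasurable j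
  have hmv := fun j => aestronglyMeasurable_St (𝓓 := 𝓓) hv.aestronglyMeasurable j
  have key : ∀ {i j k : ℕ} {w : ℝ}, 2 * ((k : ℝ) - i) ≤ w → (i : ℝ) - k ≤ w →
      𝓓.l1 i (𝓓.normXj i) (𝓓.St i fun z => 𝓓.St j (fun z => a z.2) z * 𝓓.St k v z) ≤
        𝓓.prodConst * 2 ^ w * (supNorm (𝓓.St j fun z => a z.2) *
          𝓓.l1 k (𝓓.normXj k) (𝓓.St k v)) := by
    intro i j k w h1 h2
    refine (l1_normXj_St_mul_le (hmu j) (hmv k) (hfin j) h1 h2).trans ?_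
    gcongr
    simpa only [pow_one] using le_prodConst (𝓓 := 𝓓) (n := 162) (a := 1) (b := 1) (by norm_num)
      (by norm_num) (by norm_num)
  have main := besov_mul_le (𝓓 := 𝓓) (V := 𝓓.normXj) isSpaceTimeNorm_normXj (sub_pos.2 hs) (s := s) hu hv
    (Or.inl (tsum_supNorm_St_snd_ne_top (by linarith) ha')) (C := 𝓓.prodConst * 2 ^ (2 * s + 4))
    (a := fun j => 2 ^ ((s + 1) * j) * supNorm (𝓓.St j fun z => a z.2))
    (b := fun k => 2 ^ (s * k) * 𝓓.l1 k (𝓓.normXj k) (𝓓.St k v)) fun i j k hI => ?_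
  · refine ⟨main.1, main.2.trans ?_⟩
    calc _ ≤ 𝓓.prodConst * 2 ^ (2 * s + 4) * bilinearConst (s - 1 / 2) *
          ((∑' j, geo (γ - (s + 1)) j) * 𝓓.normZyg γ a) * 𝓓.besov 𝓓.normXj s v := by
          gcongr
          · exact l2_supNorm_le γ (s + 1) a
          · exact le_rfl
      _ = _ := by ring
  have hi : (0 : ℝ) ≤ i := Nat.cast_nonneg i
  have hj : (0 : ℝ) ≤ j := Nat.cast_nonneg j
  have hk : (0 : ℝ) ≤ k := Nat.cast_nonneg k
  rcases hI.cases with ⟨h1, h2, h3, h4⟩ | ⟨h1, h2, h3, h4⟩ | ⟨h1, h2, h3, h4⟩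
  · have h1' : (k : ℝ) ≤ i := by exact_mod_cast h1
    have h3' : (i : ℝ) ≤ j + 2 := by exact_mod_cast h3
    refine weight_le (key (w := (i : ℝ) - k) (by linarith) le_rfl) ?_
    rw [min_eq_right h2]
    nlinarith
  · have h3' : (i : ℝ) ≤ k + 2 := by exact_mod_cast h3
    have h4' : (k : ℝ) ≤ i + 2 := by exact_mod_cast h4
    refine weight_le (key (w := 4) (by linarith) (by linarith)) ?_
    rw [min_eq_left h2]
    nlinarith
  · have h2' : (i : ℝ) ≤ k := by exact_mod_cast h2
    have h4' : (k : ℝ) ≤ j + 2 := by exact_mod_cast h4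
    refine weight_le (key (w := 2 * ((k : ℝ) - i)) le_rfl (by linarith)) ?_
    have hm : ((min j k : ℕ) : ℝ) ≤ k := by exact_mod_cast min_le_right j k
    have e1 : (s - 1 / 2) * (min j k : ℕ) ≤ (s - 1 / 2) * k :=
      mul_le_mul_of_nonneg_left hm (by linarith)
    have e2 : (s + 1) * k ≤ (s + 1) * j + 2 * (s + 1) := by nlinarith
    have e3 : (s - 2) * i ≤ (s - 1 / 2) * k := by nlinarith
    linarith

/-- Multiplication by Zygmund functions, for norms in which multiplication by a bounded function
costs at most the factor `2^{k-i}` when the frequency drops from `2^k` to `2^i`. -/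
theorem besov_zyg_mul_le {V : ℕ → (ℝ × ℝ → ℂ) → ℝ≥0∞} (hV : ∀ i, IsSpaceTimeNorm (V i)) {s γ : ℝ}
    (hs : 1 < s) (hγ : s < γ) {a : ℝ → ℂ} (ha : TemperedFun a) (hv : TemperedSlices v)
    (ha' : 𝓓.normZyg γ a ≠ ⊤)
    (key : ∀ {i j k : ℕ} {w : ℝ}, 0 ≤ w → (k : ℝ) - i ≤ w →
      𝓓.l1 i (V i) (𝓓.St i fun z => 𝓓.St j (fun z => a z.2) z * 𝓓.St k v z) ≤
        𝓓.prodConst * 2 ^ w * (supNorm (𝓓.St j fun z => a z.2) *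
          𝓓.l1 k (V k) (𝓓.St k v))) :
    TemperedSlices (fun z => a z.2 * v z) ∧
      𝓓.besov V s (fun z => a z.2 * v z) ≤
        𝓓.prodConst * 2 ^ (2 * s + 2) * bilinearConst s * (∑' j, geo (γ - s) j) *
          𝓓.normZyg γ a * 𝓓.besov V s v := by
  have hu := temperedSlices_snd ha
  have main := besov_mul_le (𝓓 := 𝓓) hV (by linarith : 0 < s) (s := s) hu hv
    (Or.inl (tsum_supNorm_St_snd_ne_top (by linarith) ha')) (C := 𝓓.prodConst * 2 ^ (2 * s + 2))
    (a := fun j => 2 ^ (s * j) * supNorm (𝓓.St j fun z => a z.2))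
    (b := fun k => 2 ^ (s * k) * 𝓓.l1 k (V k) (𝓓.St k v)) fun i j k hI => ?_
  · refine ⟨main.1, main.2.trans ?_⟩
    calc _ ≤ 𝓓.prodConst * 2 ^ (2 * s + 2) * bilinearConst s *
          ((∑' j, geo (γ - s) j) * 𝓓.normZyg γ a) * 𝓓.besov V s v := by
          gcongr
          · exact l2_supNorm_le γ s a
          · exact le_rfl
      _ = _ := by ring
  have hi : (0 : ℝ) ≤ i := Nat.cast_nonneg i
  have hj : (0 : ℝ) ≤ j := Nat.cast_nonneg j
  have hk : (0 : ℝ) ≤ k := Nat.cast_nonneg k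
  rcases hI.cases with ⟨h1, h2, h3, h4⟩ | ⟨h1, h2, h3, h4⟩ | ⟨h1, h2, h3, h4⟩
  · have h1' : (k : ℝ) ≤ i := by exact_mod_cast h1
    have h3' : (i : ℝ) ≤ j + 2 := by exact_mod_cast h3
    refine weight_le (key (w := 0) le_rfl (by linarith)) ?_
    rw [min_eq_right h2]
    nlinarith
  · have h3' : (i : ℝ) ≤ k + 2 := by exact_mod_cast h3
    have h4' : (k : ℝ) ≤ i + 2 := by exact_mod_cast h4
    refine weight_le (key (w := 2) (by norm_num) (by linarith)) ?_
    rw [min_eq_left h2]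
    nlinarith
  -- High-high regime: the exponent `s * i + (k - i)` is at most `s * k` because `s > 1`, and the
  -- weight `2^(sj)` of `a` pays for the decay in the minimum.
  · have h2' : (i : ℝ) ≤ k := by exact_mod_cast h2
    have h4' : (k : ℝ) ≤ j + 2 := by exact_mod_cast h4
    refine weight_le (key (w := (k : ℝ) - i) (by linarith) le_rfl) ?_
    have hm : ((min j k : ℕ) : ℝ) ≤ k := by exact_mod_cast min_le_right j k
    have e1 : s * (min j k : ℕ) ≤ s * k := mul_le_mul_of_nonneg_left hm (by linarith)
    have e2 : s * k ≤ s * j + 2 * s := by nlinarith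
    have e3 : (s - 1) * i ≤ (s - 1) * k := mul_le_mul_of_nonneg_left h2' (by linarith)
    linarith

theorem besov_normYj_zyg_mul_le {s γ : ℝ} (hs : 1 < s) (hγ : s < γ) {a : ℝ → ℂ}
    (ha : TemperedFun a) (hv : TemperedSlices v) (ha' : 𝓓.normZyg γ a ≠ ⊤)
    (hv' : 𝓓.besov 𝓓.normYj s v ≠ ⊤) :
    TemperedSlices (fun z => a z.2 * v z) ∧
      𝓓.besov 𝓓.normYj s (fun z => a z.2 * v z) ≤
        𝓓.prodConst * 2 ^ (2 * s + 2) * bilinearConst s * (∑' j, geo (γ - s) j) *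
          𝓓.normZyg γ a * 𝓓.besov 𝓓.normYj s v := by
  refine besov_zyg_mul_le isSpaceTimeNorm_normYj hs hγ ha hv ha' fun {i j k w} hw h => ?_
  refine (l1_normYj_St_mul_le (aestronglyMeasurable_St (temperedSlices_snd ha).aestronglyMeasurable
    j) (supNorm_St_snd_ne_top ha' j) (l1_ne_top_of_besov hv' k) hw h).trans ?_
  gcongr
  simpa only [pow_one] using le_prodConst (𝓓 := 𝓓) (n := 54) (a := 1) (b := 1) (by norm_num)
    (by norm_num) (by norm_num)

theorem besov_normL1L2_zyg_mul_le {s γ : ℝ} (hs : 1 < s) (hγ : s < γ) {a b : ℝ → ℂ}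
    (ha : TemperedFun a) (hb : TemperedFun b) (ha' : 𝓓.normZyg γ a ≠ ⊤) :
    TemperedSlices (fun z => a z.2 * b z.2) ∧
      𝓓.besov (fun _ => normL1L2) s (fun z => a z.2 * b z.2) ≤
        𝓓.prodConst * 2 ^ (2 * s + 2) * bilinearConst s * (∑' j, geo (γ - s) j) *
          𝓓.normZyg γ a * 𝓓.besov (fun _ => normL1L2) s (fun z => b z.2) := by
  refine besov_zyg_mul_le (fun _ => isSpaceTimeNorm_normL1L2) hs hγ ha (temperedSlices_snd hb) ha'
    fun {i j k w} hw h => ?_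
  refine (l1_normL1L2_St_mul_le
    (aestronglyMeasurable_St (temperedSlices_snd ha).aestronglyMeasurable j)
    (aestronglyMeasurable_St (temperedSlices_snd hb).aestronglyMeasurable k)
    (supNorm_St_snd_ne_top ha' j) hw h).trans ?_
  calc _ ≤ 27 * 𝓓.kerConst * 2 ^ w * (supNorm (𝓓.St j fun z => a z.2) *
        (𝓓.cutC * 𝓓.l1 k normL1L2 (𝓓.St k fun z => b z.2))) := by
        gcongr
        exact sharpH_le_l1 k _
    _ = (27 * 𝓓.kerConst ^ 1 * 𝓓.cutC ^ 1) * 2 ^ w * (supNorm (𝓓.St j fun z => a z.2) *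
        𝓓.l1 k normL1L2 (𝓓.St k fun z => b z.2)) := by ring
    _ ≤ _ := by
        gcongr
        exact le_prodConst (by norm_num) (by norm_num) (by norm_num)

end Setup

theorem lt_top_and_le {x C A B : ℝ≥0∞} (h : x ≤ C * A * B) (hC : C ≠ ⊤) (hA : A ≠ ⊤)
    (hB : B ≠ ⊤) : x < ⊤ ∧ x ≤ C.toNNReal * A * B := by
  refine ⟨h.trans_lt (by finiteness), ?_⟩
  rwa [ENNReal.coe_toNNReal hC]

end BilEst

end

/-! ### The seven estimates. -/

open BilEst BilEst.Setup

theorem mainTheorem2 (𝓓 : BilEst.Setup) :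
    -- algebra estimates
    (∀ s : ℝ, 1 < s → ∃ C : ℝ≥0, ∀ u v : ℝ × ℝ → ℂ, 𝓓.MemL1X s u → 𝓓.MemL1X s v →
      𝓓.MemL1X s (fun p => u p * v p) ∧
      𝓓.normL1X s (fun p => u p * v p) ≤ C * 𝓓.normL1X s u * 𝓓.normL1X s v) ∧
    (∀ s : ℝ, 1 / 2 < s → ∃ C : ℝ≥0, ∀ a b : ℝ → ℂ, 𝓓.MemL1H s a → 𝓓.MemL1H s b →
      𝓓.MemL1H s (fun x => a x * b x) ∧
      𝓓.normL1H s (fun x => a x * b x) ≤ C * 𝓓.normL1H s a * 𝓓.normL1H s b) ∧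
    -- bilinear estimates into `l^1 Y^s`
    (∀ s α β : ℝ, 1 / 2 < s → s - 2 ≤ α → s - 2 ≤ β → s + 1 / 2 < α + β →
      ∃ C : ℝ≥0, ∀ u v : ℝ × ℝ → ℂ, 𝓓.MemL1X α u → 𝓓.MemL1X β v →
        𝓓.MemL1Y s (fun p => u p * v p) ∧
        𝓓.normL1Y s (fun p => u p * v p) ≤ C * 𝓓.normL1X α u * 𝓓.normL1X β v) ∧
    (∀ s α β : ℝ, 1 / 2 < s → s - 1 ≤ α → s - 1 ≤ β → s + 1 / 2 < α + β →
      ∃ C : ℝ≥0, ∀ (a : ℝ → ℂ) (u : ℝ × ℝ → ℂ), 𝓓.MemL1H α a → 𝓓.MemL1X β u →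
        𝓓.MemL1Y s (fun p => a p.2 * u p) ∧
        𝓓.normL1Y s (fun p => a p.2 * u p) ≤ C * 𝓓.normL1H α a * 𝓓.normL1X β u) ∧
    -- multiplication by Zygmund functions
    (∀ s γ : ℝ, 1 / 2 < s → s + 1 < γ →
      ∃ C : ℝ≥0, ∀ (a : ℝ → ℂ) (u : ℝ × ℝ → ℂ), 𝓓.MemZyg γ a → 𝓓.MemL1X s u →
        𝓓.MemL1X s (fun p => a p.2 * u p) ∧
        𝓓.normL1X s (fun p => a p.2 * u p) ≤ C * 𝓓.normZyg γ a * 𝓓.normL1X s u) ∧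
    (∀ s γ : ℝ, 3 / 2 < s → s < γ →
      ∃ C : ℝ≥0, ∀ (a : ℝ → ℂ) (u : ℝ × ℝ → ℂ), 𝓓.MemZyg γ a → 𝓓.MemL1Y s u →
        𝓓.MemL1Y s (fun p => a p.2 * u p) ∧
        𝓓.normL1Y s (fun p => a p.2 * u p) ≤ C * 𝓓.normZyg γ a * 𝓓.normL1Y s u) ∧
    (∀ s γ : ℝ, 1 < s → s < γ →
      ∃ C : ℝ≥0, ∀ a b : ℝ → ℂ, 𝓓.MemZyg γ a → 𝓓.MemL1H s b →
        𝓓.MemL1H s (fun x => a x * b x) ∧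
        𝓓.normL1H s (fun x => a x * b x) ≤ C * 𝓓.normZyg γ a * 𝓓.normL1H s b) := by
  have hP := 𝓓.prodConst_ne_top
  have hw := two_rpow_ne_top
  refine ⟨fun s hs => ?_, fun s hs => ?_, fun s α β hs hα hβ hαβ => ?_,
    fun s α β hs hα hβ hαβ => ?_, fun s γ hs hγ => ?_, fun s γ hs hγ => ?_, fun s γ hs hγ => ?_⟩
  · have hb := bilinearConst_ne_top (sub_pos.2 hs)
    refine ⟨(𝓓.prodConst * 2 ^ (2 * s + 4) * bilinearConst (s - 1)).toNNReal,
      fun u v hu hv => ?_⟩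
    simp only [MemL1X, normL1X_eq] at hu hv ⊢
    have h := besov_normXj_mul_le hs hu.1 hv.1 hu.2.ne hv.2.ne
    have h' := lt_top_and_le h.2 (by finiteness [hw (2 * s + 4)]) hu.2.ne hv.2.ne
    exact ⟨⟨h.1, h'.1⟩, h'.2⟩
  · have hb := bilinearConst_ne_top (by linarith : 0 < s + s - s - 1 / 2)
    refine ⟨(𝓓.prodConst * 2 ^ (2 * s + 2 + 2 * |s| + 2 * |s|) *
      bilinearConst (s + s - s - 1 / 2)).toNNReal,
      fun a b ha hb' => ?_⟩
    simp only [MemL1H, normL1H_eq] at ha hb' ⊢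
    have h := besov_normL1L2_mul_le hs ha.1 hb'.1 ha.2.ne hb'.2.ne
    have h' := lt_top_and_le h.2
      (by finiteness [hw (2 * s + 2 + 2 * |s| + 2 * |s|)]) ha.2.ne hb'.2.ne
    exact ⟨⟨temperedFun_of_temperedSlices_snd h.1, h'.1⟩, h'.2⟩
  · have hb := bilinearConst_ne_top (by linarith : 0 < α + β - s - 1 / 2)
    refine ⟨(𝓓.prodConst * 2 ^ (2 * s + 2 + 2 * |α| + 2 * |β|) *
      bilinearConst (α + β - s - 1 / 2)).toNNReal,
      fun u v hu hv => ?_⟩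
    simp only [MemL1X, MemL1Y, normL1X_eq, normL1Y_eq] at hu hv ⊢
    have h := besov_normYj_mul_le hs hα hβ hαβ hu.1 hv.1 hu.2.ne hv.2.ne
    have h' := lt_top_and_le h.2
      (by finiteness [hw (2 * s + 2 + 2 * |α| + 2 * |β|)]) hu.2.ne hv.2.ne
    exact ⟨⟨h.1, h'.1⟩, h'.2⟩
  · have hb := bilinearConst_ne_top (by linarith : 0 < α + β - s - 1 / 2)
    refine ⟨(𝓓.prodConst * 2 ^ (2 * s + 2 + 2 * |α| + 2 * |β|) *
      bilinearConst (α + β - s - 1 / 2)).toNNReal,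
      fun a v ha hv => ?_⟩
    simp only [MemL1X, MemL1Y, MemL1H, normL1X_eq, normL1Y_eq, normL1H_eq] at ha hv ⊢
    have h := besov_normYj_snd_mul_le hs hα hβ hαβ ha.1 hv.1 ha.2.ne hv.2.ne
    have h' := lt_top_and_le h.2
      (by finiteness [hw (2 * s + 2 + 2 * |α| + 2 * |β|)]) ha.2.ne hv.2.ne
    exact ⟨⟨h.1, h'.1⟩, h'.2⟩
  · have hb := bilinearConst_ne_top (sub_pos.2 hs)
    have hg := tsum_geo_ne_top (sub_pos.2 hγ)
    refine ⟨(𝓓.prodConst * 2 ^ (2 * s + 4) * bilinearConst (s - 1 / 2) *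
      ∑' j, geo (γ - (s + 1)) j).toNNReal,
      fun a v ha hv => ?_⟩
    simp only [MemL1X, normL1X_eq] at hv ⊢
    have h := besov_normXj_zyg_mul_le hs hγ ha.1 hv.1 ha.2.ne
    have h' := lt_top_and_le h.2 (by finiteness [hw (2 * s + 4)]) ha.2.ne hv.2.ne
    exact ⟨⟨h.1, h'.1⟩, h'.2⟩
  · have hb := bilinearConst_ne_top (by linarith : 0 < s)
    have hg := tsum_geo_ne_top (sub_pos.2 hγ)
    refine ⟨(𝓓.prodConst * 2 ^ (2 * s + 2) * bilinearConst s * ∑' j, geo (γ - s) j).toNNReal,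
      fun a v ha hv => ?_⟩
    simp only [MemL1Y, normL1Y_eq] at hv ⊢
    have h := besov_normYj_zyg_mul_le (by linarith) hγ ha.1 hv.1 ha.2.ne hv.2.ne
    have h' := lt_top_and_le h.2 (by finiteness [hw (2 * s + 2)]) ha.2.ne hv.2.ne
    exact ⟨⟨h.1, h'.1⟩, h'.2⟩
  · have hb := bilinearConst_ne_top (by linarith : 0 < s)
    have hg := tsum_geo_ne_top (sub_pos.2 hγ)
    refine ⟨(𝓓.prodConst * 2 ^ (2 * s + 2) * bilinearConst s * ∑' j, geo (γ - s) j).toNNReal,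
      fun a b ha hb' => ?_⟩
    simp only [MemL1H, normL1H_eq] at hb' ⊢
    have h := besov_normL1L2_zyg_mul_le hs hγ ha.1 hb'.1 ha.2.ne
    have h' := lt_top_and_le h.2 (by finiteness [hw (2 * s + 2)]) ha.2.ne hb'.2.ne
    exact ⟨⟨temperedFun_of_temperedSlices_snd h.1, h'.1⟩, h'.2⟩
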